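/- **Model counting for clauses and XOR constraints.** A *system* $F$ is a conjunction of finitely many constraints over finitely many Boolean variables, each of which is either a clause (a disjunction of literals) or an XOR constraint ($x_1\oplus\dots\oplus x_r=0$ or $x_1\oplus\dots\oplus x_r=1$). Its *incidence graph* $G_F$ has the variables and the constraints of $F$ as vertices, with an edge between a variable $x$ and a constraint $c$ if and only if $x$ occurs in $c$; $|G_F|$ is the number of its vertices. A *tree decomposition* of $G_F$ is a pair $\mathcal T=(T,b)$ of a tree $T$ and a bag function $b$ from the nodes of $T$ to sets of vertices of $G_F$, such that every vertex lies in a bag, both ends of every edge lie in a common bag, and for every vertex $v$ the nodes $t$ with $v\in b(t)$ induce a connected subgraph of $T$. Its *width* is $\max_t|b(t)|$, and its *size* $\|\mathcal T\|$ is the number of its nodes plus $\sum_t|b(t)|$. Operations are counted in the unit-cost model, where every arithmetic operation on integers (addition, subtraction, multiplication), every comparison and every memory access is one elementary operation. There is an algorithm that, given a system $F$ of clauses and XOR constraints and a tree decomposition $\mathcal T$ of $G_F$ of width $k$, computes the number of models (satisfying assignments) of $F$ with $$O\bigl(2^k\cdot k\cdot|G_F|+\|\mathcal T\|\bigr)$$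 elementary operations. In particular, the same algorithm uses $O(2^k\cdot k\cdot|G_F|)$ elementary operations when the given tree decomposition has $O(|G_F|)$ nodes. -/

import Mathlib

namespace ModelCounting

/-! ### Systems of clauses and XOR constraints -/

/-- A constraint over the Boolean variables `0, …, n - 1`: either the clause that is the disjunction
of the literals `x` (for `x ∈ pos`) and `¬ x` (for `x ∈ neg`), or the parity constraint
`⊕_{x ∈ vars} x = rhs`. -/
inductive Constraint (n : ℕ) : Type
  | clause (pos neg : Finset (Fin n)) : Constraint n
  | xor (vars : Finset (Fin n)) (rhs : Bool) : Constraint n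

/-- The set of variables of a constraint. -/
def Constraint.vars {n : ℕ} : Constraint n → Finset (Fin n)
  | .clause pos neg => pos ∪ neg
  | .xor vars _ => vars

/-- The Boolean function given by a constraint. -/
def Constraint.eval {n : ℕ} (α : Fin n → Bool) : Constraint n → Bool
  | .clause pos neg => decide ((∃ x ∈ pos, α x = true) ∨ (∃ x ∈ neg, α x = false))
  | .xor vars rhs => decide ((∑ x ∈ vars, (α x).toNat) % 2 = rhs.toNat)

/-- A system (conjunction) of `numCons` clauses and XOR constraints over `numVars` variables. -/
structure ConstraintSystem : Type where
  numVars : ℕ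
  numCons : ℕ
  con : Fin numCons → Constraint numVars

/-- The number of assignments to the variables that satisfy every constraint. -/
def ConstraintSystem.modelCount (F : ConstraintSystem) : ℕ :=
  (Finset.univ.filter fun α : Fin F.numVars → Bool => ∀ j, (F.con j).eval α = true).card

/-- The vertices of the incidence graph: the variables and the constraints. -/
abbrev ConstraintSystem.Vertex (F : ConstraintSystem) : Type := Fin F.numVars ⊕ Fin F.numCons

/-- The incidence graph `G_F`: the variable `x` and the constraint `c` are adjacent if and only if
`x` is a variable of `c`, and there are no other edges. -/
def ConstraintSystem.incidenceGraph (F : ConstraintSystem) : SimpleGraph F.Vertex where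
  Adj
    | .inl x, .inr j => x ∈ (F.con j).vars
    | .inr j, .inl x => x ∈ (F.con j).vars
    | _, _ => False
  symm := ⟨by rintro (x | j) (y | l) h <;> exact h⟩
  loopless := ⟨by rintro (x | j) h <;> exact h⟩

/-- `|G_F|`, the number of vertices of the incidence graph. -/
def ConstraintSystem.graphSize (F : ConstraintSystem) : ℕ := Fintype.card F.Vertex

/-! ### Tree decompositions -/

/-- A tree decomposition of `G`, with tree nodes `0, …, numNodes - 1`. -/
structure TreeDecomposition {V : Type} (G : SimpleGraph V) : Type where
  numNodes : ℕ
  tree : SimpleGraph (Fin numNodes)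
  isTree : tree.IsTree
  bag : Fin numNodes → Finset V
  cover : ∀ v, ∃ t, v ∈ bag t
  cover_edge : ∀ u v, G.Adj u v → ∃ t, u ∈ bag t ∧ v ∈ bag t
  connected : ∀ v, (tree.induce {t | v ∈ bag t}).Connected

/-- The width, in the convention `max_t |b(t)|` (without subtracting one). -/
def TreeDecomposition.width {V : Type} {G : SimpleGraph V} (T : TreeDecomposition G) : ℕ :=
  Finset.univ.sup fun t => (T.bag t).card

/-- The size of a tree decomposition: the number of its nodes plus the total size of its bags. -/
def TreeDecomposition.size {V : Type} {G : SimpleGraph V} (T : TreeDecomposition G) : ℕ :=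
  T.numNodes + ∑ t, (T.bag t).card

/-! ### The unit-cost random access machine

Registers and array cells hold arbitrary integers. Every arithmetic operation, comparison, memory
access, constant and assignment costs one step. Arithmetic is addition, subtraction and
multiplication; there are no divisions, shifts or bitwise operations. -/

/-- The memory: registers, and arrays (`arr a i` is the cell `i` of the array `a`). A program
mentions only finitely many registers and arrays. -/
structure Store : Type where
  reg : ℕ → ℤ
  arr : ℕ → ℕ → ℤ

/-- Assign to the register `x`. -/
def Store.setReg (σ : Store) (x : ℕ) (z : ℤ) : Store :=
  { σ with reg := Function.update σ.reg x z }

/-- Assign to the cell `i` of the array `a`. -/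
def Store.setCell (σ : Store) (a i : ℕ) (z : ℤ) : Store :=
  { σ with arr := Function.update σ.arr a (Function.update (σ.arr a) i z) }

/-- Expressions: constants, registers, indirect array reads and arithmetic. -/
inductive Expr : Type
  | const (z : ℤ)
  | reg (x : ℕ)
  | read (a : ℕ) (i : Expr)
  | add (e f : Expr)
  | sub (e f : Expr)
  | mul (e f : Expr)

/-- The value of an expression. A negative address is taken to be the address `0`. -/
def Expr.eval (σ : Store) : Expr → ℤ
  | .const z => z
  | .reg x => σ.reg x
  | .read a i => σ.arr a (i.eval σ).toNat
  | .add e f => e.eval σ + f.eval σ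
  | .sub e f => e.eval σ - f.eval σ
  | .mul e f => e.eval σ * f.eval σ

/-- The number of steps for evaluating an expression. -/
def Expr.cost : Expr → ℕ
  | .const _ => 1
  | .reg _ => 1
  | .read _ i => i.cost + 1
  | .add e f => e.cost + f.cost + 1
  | .sub e f => e.cost + f.cost + 1
  | .mul e f => e.cost + f.cost + 1

/-- Programs. The tests of `ite` and `loop` ask whether the value of an expression is positive. -/
inductive Program : Type
  | skip
  | set (x : ℕ) (e : Expr)
  | write (a : ℕ) (i e : Expr)
  | seq (p q : Program)
  | ite (b : Expr) (p q : Program)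
  | loop (b : Expr) (p : Program)

/-- `Exec p σ τ t`: started in the memory `σ`, the program `p` halts after exactly `t` steps with
the memory `τ`. -/
inductive Exec : Program → Store → Store → ℕ → Prop
  | skip (σ : Store) : Exec .skip σ σ 1
  | set (x : ℕ) (e : Expr) (σ : Store) :
      Exec (.set x e) σ (σ.setReg x (e.eval σ)) (e.cost + 1)
  | write (a : ℕ) (i e : Expr) (σ : Store) :
      Exec (.write a i e) σ (σ.setCell a (i.eval σ).toNat (e.eval σ)) (i.cost + e.cost + 1)
  | seq {p q : Program} {σ τ ρ : Store} {s t : ℕ} (hp : Exec p σ τ s) (hq : Exec q τ ρ t) :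
      Exec (.seq p q) σ ρ (s + t)
  | ite_pos {b : Expr} {p q : Program} {σ τ : Store} {t : ℕ} (hb : 0 < b.eval σ)
      (hp : Exec p σ τ t) : Exec (.ite b p q) σ τ (b.cost + 1 + t)
  | ite_neg {b : Expr} {p q : Program} {σ τ : Store} {t : ℕ} (hb : ¬ 0 < b.eval σ)
      (hq : Exec q σ τ t) : Exec (.ite b p q) σ τ (b.cost + 1 + t)
  | loop_done {b : Expr} {p : Program} {σ : Store} (hb : ¬ 0 < b.eval σ) :
      Exec (.loop b p) σ σ (b.cost + 1)
  | loop_step {b : Expr} {p : Program} {σ τ ρ : Store} {s t : ℕ} (hb : 0 < b.eval σ)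
      (hp : Exec p σ τ s) (hl : Exec (.loop b p) τ ρ t) :
      Exec (.loop b p) σ ρ (b.cost + 1 + s + t)

/-- The initial memory on an input word: the input is in the array `0`, all else is zero. -/
def initialStore (w : List ℕ) : Store where
  reg _ := 0
  arr a i := if a = 0 then ((w.getD i 0 : ℕ) : ℤ) else 0

/-! ### Inputs -/

/-- A finite set of numbers, written as its elements in increasing order. -/
def encodeFinset {n : ℕ} (s : Finset (Fin n)) : List ℕ := (s.sort (· ≤ ·)).map Fin.val

/-- A constraint: a tag, two header entries, and the variables. -/
def Constraint.encode {n : ℕ} : Constraint n → List ℕ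
  | .clause pos neg => [0, pos.card, neg.card] ++ encodeFinset pos ++ encodeFinset neg
  | .xor vars rhs => [1, rhs.toNat, vars.card] ++ encodeFinset vars

/-- A system: the numbers of variables and of constraints, and the list of the constraints. -/
def ConstraintSystem.encode (F : ConstraintSystem) : List ℕ :=
  [F.numVars, F.numCons] ++ (List.finRange F.numCons).flatMap fun j => (F.con j).encode

/-- The variable `x` is the vertex number `x`, the constraint `j` the vertex number
`numVars + j`. -/
def ConstraintSystem.vertexNumber (F : ConstraintSystem) : F.Vertex → Fin (F.numVars + F.numCons) :=
  finSumFinEquiv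

open Classical in
/-- A tree decomposition of the incidence graph: the number of nodes, and for every node the number
and the list of its neighbours in the tree, and the size and the list of the elements of its bag. -/
noncomputable def encodeDecomposition (F : ConstraintSystem)
    (T : TreeDecomposition F.incidenceGraph) : List ℕ :=
  [T.numNodes] ++ (List.finRange T.numNodes).flatMap fun t =>
    [(Finset.univ.filter (T.tree.Adj t)).card] ++
      encodeFinset (Finset.univ.filter (T.tree.Adj t)) ++
    [(T.bag t).card] ++ encodeFinset ((T.bag t).image F.vertexNumber)

/-- Given `F` and `T`, the program `p` halts after exactly `t` steps, and then its register `0`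
holds the number of models of `F`. -/
def CountsModelsIn (p : Program) (F : ConstraintSystem) (T : TreeDecomposition F.incidenceGraph)
    (t : ℕ) : Prop :=
  ∃ τ : Store, Exec p (initialStore (F.encode ++ encodeDecomposition F T)) τ t ∧
    τ.reg 0 = (F.modelCount : ℤ)

end ModelCounting

namespace ModelCounting

/-! ### A program logic with running times -/

-- Give every vertex of the incidence graph a bit, constraints as well as variables, and give every
-- ordered pair of vertices with bits `a`, `b` the weight `1 + b * (a * A + (1 - a) * B)`, which is
-- 1 when `b = 0`. For fixed variables, the two values of the bit of one constraint contribute `1 +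
-- (1 + coefSelf) * ∏ ...`. For a clause the self-factor is `-1` and a variable contributes 0
-- exactly when it makes a literal true, so the sum is 1 minus the indicator of falsification. For
-- an XOR constraint the self-factor is `(-1)^rhs` and its variables contribute `(-1)^x`, so the sum
-- is 2 or 0. Hence the total weight of all bit vectors is `2^numXor` times the number of models
-- (`constraint_sum`, `sum_prod_pairWeight`). Both kinds of constraints have become edge weights
-- with one bit per vertex; this is why the base of the exponential is 2 and why the incidence graph
-- itself governs the elimination.
--
-- The total weight is computed by variable elimination. A breadth-first search orders the tree
-- nodes so that each node except the first has an earlier neighbour. Vertices are ranked by the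
-- first bag that contains them, and the scope of a vertex consists of the vertices of smaller rank
-- in that bag. By uniqueness of paths in a tree (`first_mem_of_meet`), a vertex of smaller rank
-- that shares any bag with `u` already lies in the first bag of `u`. So every edge joins a vertex
-- to a member of its scope, and a scope without its largest element `p` is contained in the scope
-- of `p`: the ranking is a perfect elimination order. Summing out the vertices by decreasing rank,
-- the message of a vertex depends only on its scope and absorbs the messages of its children
-- (`message_congr`, `sumBits_localTerm`).
--
-- A scope has fewer than `k` elements, and an entry of the table of `r` costs a constant times `(|S
-- r| + 1) * (children + 1)`. The numbers of children add up to at most `|G_F|`, which gives `2^k *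
-- k * |G_F|`. The incidences inject into pairs of a vertex and a scope member, so the system is
-- read in time `O(k * |G_F|)`; only reading and searching the tree costs `‖T‖`.
--
-- The machine cannot divide, so the factor `2^numXor` is removed by extracting binary digits. Its
-- memory starts as zero, so the sparse square matrices need no initialisation. Correctness and time
-- are proved together, in a program logic with syntactic frame conditions.

infixr:60 " ;; " => Program.seq

instance : Add Expr := ⟨Expr.add⟩
instance : Sub Expr := ⟨Expr.sub⟩
instance : Mul Expr := ⟨Expr.mul⟩
instance (n : ℕ) : OfNat Expr n := ⟨Expr.const n⟩

/-! ### Evaluation of expressions and updates of the memory. -/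

namespace Expr

variable (σ : Store) (e f : Expr)

@[simp] theorem eval_const (z : ℤ) : (Expr.const z).eval σ = z := rfl
@[simp] theorem eval_reg (x : ℕ) : (Expr.reg x).eval σ = σ.reg x := rfl
@[simp] theorem eval_read (a : ℕ) : (Expr.read a e).eval σ = σ.arr a (e.eval σ).toNat := rfl
@[simp] theorem eval_add : (e + f).eval σ = e.eval σ + f.eval σ := rfl
@[simp] theorem eval_sub : (e - f).eval σ = e.eval σ - f.eval σ := rfl
@[simp] theorem eval_mul : (e * f).eval σ = e.eval σ * f.eval σ := rfl
@[simp] theorem eval_ofNat (n : ℕ) [n.AtLeastTwo] :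
    (ofNat(n) : Expr).eval σ = ofNat(n) := rfl
@[simp] theorem eval_zero : (0 : Expr).eval σ = 0 := rfl
@[simp] theorem eval_one : (1 : Expr).eval σ = 1 := rfl

end Expr

namespace Store

variable (σ : Store) (x y a b i : ℕ) (z : ℤ)

@[simp] theorem setReg_reg : (σ.setReg x z).reg y = if y = x then z else σ.reg y := by
  simp [setReg, Function.update_apply]
@[simp] theorem setReg_arr : (σ.setReg x z).arr = σ.arr := rfl
@[simp] theorem setCell_reg : (σ.setCell a i z).reg = σ.reg := rfl
@[simp] theorem setCell_arr : (σ.setCell a i z).arr b =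
    if b = a then Function.update (σ.arr a) i z else σ.arr b := by
  simp only [setCell, Function.update_apply]

end Store

namespace Program

/-- The registers that a program assigns to. -/
def regs : Program → List ℕ
  | skip => []
  | set x _ => [x]
  | write _ _ _ => []
  | seq p q => p.regs ++ q.regs
  | ite _ p q => p.regs ++ q.regs
  | loop _ p => p.regs

/-- The arrays that a program writes to. -/
def arrs : Program → List ℕ
  | skip => []
  | set _ _ => []
  | write a _ _ => [a]
  | seq p q => p.arrs ++ q.arrs
  | ite _ p q => p.arrs ++ q.arrs
  | loop _ p => p.arrs

/-- Programs without loops. -/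
def loopFree : Program → Bool
  | seq p q => p.loopFree && q.loopFree
  | ite _ p q => p.loopFree && q.loopFree
  | loop _ _ => false
  | _ => true

/-- The effect of a loop-free program. -/
def apply : Program → Store → Store
  | skip, σ => σ
  | set x e, σ => σ.setReg x (e.eval σ)
  | write a i e, σ => σ.setCell a (i.eval σ).toNat (e.eval σ)
  | seq p q, σ => q.apply (p.apply σ)
  | ite b p q, σ => if 0 < b.eval σ then p.apply σ else q.apply σ
  | loop _ _, σ => σ

/-- An upper bound for the running time of a loop-free program. -/
def time : Program → ℕ
  | skip => 1
  | set _ e => e.cost + 1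
  | write _ i e => i.cost + e.cost + 1
  | seq p q => p.time + q.time
  | ite b p q => b.cost + 1 + max p.time q.time
  | loop _ _ => 0

/-- `for i := 0 to e - 1 do p`. -/
def forLoop (i : ℕ) (e : Expr) (p : Program) : Program :=
  .set i 0 ;; .loop (e - .reg i) (p ;; .set i (.reg i + 1))

end Program

/-- The stores `σ` and `τ` agree except where `p` may write. -/
structure Frame (p : Program) (σ τ : Store) : Prop where
  reg : ∀ x, x ∉ p.regs → τ.reg x = σ.reg x
  arr : ∀ a, a ∉ p.arrs → τ.arr a = σ.arr a

theorem Frame.refl (p : Program) (σ : Store) : Frame p σ σ := ⟨fun _ _ => rfl, fun _ _ => rfl⟩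

theorem Frame.trans {p q r : Program} {σ τ ρ : Store} (h : Frame p σ τ) (h' : Frame q τ ρ)
    (hr : p.regs ⊆ r.regs ∧ q.regs ⊆ r.regs) (ha : p.arrs ⊆ r.arrs ∧ q.arrs ⊆ r.arrs) :
    Frame r σ ρ :=
  ⟨fun x hx => (h'.reg x fun hh => hx (hr.2 hh)).trans (h.reg x fun hh => hx (hr.1 hh)),
    fun a hx => (h'.arr a fun hh => hx (ha.2 hh)).trans (h.arr a fun hh => hx (ha.1 hh))⟩

/-- Write sets are syntactic, so for a concrete program a frame condition is non-membership in an
explicit list, settled by `decide`. This carries facts across the phases of the algorithm. -/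
theorem Exec.frame {p : Program} {σ τ : Store} {t : ℕ} (h : Exec p σ τ t) : Frame p σ τ := by
  induction h with
  | skip σ => exact Frame.refl _ _
  | set x e σ =>
    refine ⟨fun y hy => ?_, fun _ _ => rfl⟩
    have : y ≠ x := by simpa [Program.regs] using hy
    simp [this]
  | write a i e σ =>
    refine ⟨fun _ _ => rfl, fun b hb => ?_⟩
    have : b ≠ a := by simpa [Program.arrs] using hb
    simp [this]
  | seq _ _ ih ih' => exact ih.trans ih' (by simp [Program.regs]) (by simp [Program.arrs])
  | ite_pos _ _ ih =>
    exact (Frame.refl .skip _).trans ih (by simp [Program.regs]) (by simp [Program.arrs])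
  | ite_neg _ _ ih =>
    exact (Frame.refl .skip _).trans ih (by simp [Program.regs]) (by simp [Program.arrs])
  | loop_done _ => exact Frame.refl _ _
  | loop_step _ _ _ ih ih' => exact ih.trans ih' (by simp [Program.regs]) (by simp [Program.arrs])

/-- Started in `σ`, the program `p` halts after at most `c` steps in a store with the property
`Q`. -/
def Runs (p : Program) (σ : Store) (Q : Store → Prop) (c : ℕ) : Prop :=
  ∃ τ t, Exec p σ τ t ∧ t ≤ c ∧ Q τ

/-! ### Rules for total correctness with time bounds. -/

namespace Runs

theorem conseq {p : Program} {σ : Store} {Q Q' : Store → Prop} {c c' : ℕ} (h : Runs p σ Q c)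
    (hQ : ∀ τ, Frame p σ τ → Q τ → Q' τ) (hc : c ≤ c') : Runs p σ Q' c' := by
  obtain ⟨τ, t, he, ht, hq⟩ := h
  exact ⟨τ, t, he, ht.trans hc, hQ τ he.frame hq⟩

theorem seq {p q : Program} {σ : Store} {P Q : Store → Prop} {c d e : ℕ} (hp : Runs p σ P c)
    (hq : ∀ τ, Frame p σ τ → P τ → Runs q τ Q d) (he : c + d ≤ e) : Runs (p ;; q) σ Q e := by
  obtain ⟨τ, t, hx, ht, hP⟩ := hp
  obtain ⟨ρ, s, hy, hs, hQ⟩ := hq τ hx.frame hP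
  exact ⟨ρ, t + s, hx.seq hy, by omega, hQ⟩

theorem ite {b : Expr} {p q : Program} {σ : Store} {Q : Store → Prop} {c d : ℕ}
    (hp : 0 < b.eval σ → Runs p σ Q c) (hq : ¬ 0 < b.eval σ → Runs q σ Q c)
    (hc : b.cost + 1 + c ≤ d) : Runs (.ite b p q) σ Q d := by
  by_cases h : 0 < b.eval σ
  · obtain ⟨τ, t, hx, ht, hQ⟩ := hp h
    exact ⟨τ, _, .ite_pos h hx, by omega, hQ⟩
  · obtain ⟨τ, t, hx, ht, hQ⟩ := hq h
    exact ⟨τ, _, .ite_neg h hx, by omega, hQ⟩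

/-- Straight-line code is a function on memories with a constant time bound: its effect can be found
by simplifying `apply`, and its bound by computation. -/
theorem loopFree {p : Program} (hp : p.loopFree = true) (σ : Store) :
    Runs p σ (fun τ => τ = p.apply σ) p.time := by
  induction p generalizing σ with
  | skip => exact ⟨σ, 1, .skip σ, le_rfl, rfl⟩
  | set x e => exact ⟨_, _, .set x e σ, le_rfl, rfl⟩
  | write a i e => exact ⟨_, _, .write a i e σ, le_rfl, rfl⟩
  | seq p q ihp ihq =>
    simp only [Program.loopFree, Bool.and_eq_true] at hp
    refine (ihp hp.1 σ).seq (fun τ _ h => ?_) le_rfl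
    subst h
    exact ihq hp.2 _
  | ite b p q ihp ihq =>
    simp only [Program.loopFree, Bool.and_eq_true] at hp
    refine Runs.ite (c := max p.time q.time) (fun h => ?_) (fun h => ?_) le_rfl
    · exact (ihp hp.1 σ).conseq (fun τ _ ht => by simp [Program.apply, h, ht]) (le_max_left _ _)
    · exact (ihq hp.2 σ).conseq (fun τ _ ht => by simp only [Program.apply, if_neg h, ht])
        (le_max_right _ _)
  | loop b p => simp [Program.loopFree] at hp

/-- A loop-free program followed by `q`. -/
theorem block {p q : Program} {σ : Store} {Q : Store → Prop} {c d : ℕ}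
    (hp : p.loopFree = true) (hq : Runs q (p.apply σ) Q c) (hd : p.time + c ≤ d) :
    Runs (p ;; q) σ Q d :=
  (loopFree hp σ).seq (fun _ _ h => h ▸ hq) hd

theorem block_end {p : Program} {σ : Store} {Q : Store → Prop} {d : ℕ}
    (hp : p.loopFree = true) (hq : Q (p.apply σ)) (hd : p.time ≤ d) : Runs p σ Q d :=
  (loopFree hp σ).conseq (fun _ _ h => h ▸ hq) hd

/-- The bound `e` is evaluated afresh in every round, hence `he`; the counter must survive the body,
hence `hi`. A round costs its body, `e.cost + 3` for the test and 4 for the increment; the final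
`e.cost + 5` is the initial assignment and the failing test. -/
theorem forLoop {i : ℕ} {e : Expr} {p : Program} {σ : Store} {n : ℕ} (I : ℕ → Store → Prop)
    (c : ℕ → ℕ) (hi : i ∉ p.regs)
    (he : ∀ τ, Frame (Program.forLoop i e p) σ τ → e.eval τ = n)
    (h0 : I 0 (σ.setReg i 0))
    (hs : ∀ j τ, j < n → Frame (Program.forLoop i e p) σ τ → τ.reg i = j → I j τ →
      Runs p τ (fun ρ => I (j + 1) (ρ.setReg i (j + 1))) (c j)) {d : ℕ}
    (hd : ∑ j ∈ Finset.range n, (c j + (e.cost + 7)) + (e.cost + 5) ≤ d) :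
    Runs (Program.forLoop i e p) σ (I n) d := by
  have key : ∀ m j τ, j + m = n → Frame (Program.forLoop i e p) σ τ → τ.reg i = j → I j τ →
      Runs (.loop (e - .reg i) (p ;; .set i (.reg i + 1))) τ (I n)
        (∑ l ∈ Finset.Ico j n, (c l + (e.cost + 7)) + (e.cost + 3)) := by
    intro m
    induction m with
    | zero =>
      intro j τ hj hF hr hI
      obtain rfl : j = n := by omega
      refine ⟨τ, _, .loop_done (by simp [he τ hF, hr]), ?_, hI⟩
      change e.cost + 1 + 1 + 1 ≤ _
      omega
    | succ m ih =>
      intro j τ hj hF hr hI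
      obtain ⟨ρ, t, hx, ht, hρ⟩ := hs j τ (by omega) hF hr hI
      have hri : ρ.reg i = j := (hx.frame.reg i hi).trans hr
      have hset : Exec (.set i (.reg i + 1)) ρ (ρ.setReg i (j + 1)) 4 := by
        have := Exec.set i (.reg i + 1) ρ
        simp only [Expr.eval_add, Expr.eval_reg, hri, Expr.eval_one] at this
        exact this
      have hF' : Frame (Program.forLoop i e p) σ (ρ.setReg i (j + 1)) :=
        hF.trans (hx.seq hset).frame (by simp [Program.forLoop, Program.regs])
          (by simp [Program.forLoop, Program.arrs])
      obtain ⟨υ, s, hy, hs', hQ⟩ := ih (j + 1) (ρ.setReg i (j + 1)) (by omega) hF'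
        (by simp) hρ
      refine ⟨υ, _, .loop_step ?_ (hx.seq hset) hy, ?_, hQ⟩
      · simp only [Expr.eval_sub, he τ hF, Expr.eval_reg, hr]
        omega
      · rw [Finset.sum_eq_sum_Ico_succ_bot (by omega : j < n)]
        change e.cost + 1 + 1 + 1 + (t + 4) + s ≤ _
        omega
  have hF0 : Frame (Program.forLoop i e p) σ (σ.setReg i 0) :=
    (Frame.refl .skip σ).trans (Exec.set i 0 σ).frame
      (by simp [Program.forLoop, Program.regs]) (by simp [Program.forLoop, Program.arrs])
  have h := key n 0 (σ.setReg i 0) (by omega) hF0 (by simp) h0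
  refine Runs.seq (P := fun τ => τ = σ.setReg i 0) (c := 2)
    ⟨_, _, Exec.set i 0 σ, le_rfl, rfl⟩ (fun τ _ hτ => hτ ▸ h) ?_
  rw [Finset.range_eq_Ico] at hd
  omega

end Runs

end ModelCounting

namespace ModelCounting

/-! ### The algorithm

Registers: `0` the result, `1` and `2` the numbers of variables and of constraints, `3` the number
of vertices, `4` a position in the input, `5` the number of tree nodes, `11` the number of XOR
constraints, `27` the partition function; all others are local.

Arrays: `0` the input, `1` and `2` the interaction matrices, `4` and `17` the positions of the
neighbour lists and of the bags in the input, `5` marks for visited nodes, `6` the search order of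
the nodes, `7` the ranks of the vertices (plus one), `8` the vertex of a given rank, `9` the
position of its first bag, `10` and `11` the scopes and their lengths, `12` and `13` the children
and their numbers, `14` the current assignment, `15` the tables, `16` the powers of two. -/

namespace Algo

open Program (forLoop)

def header : Program :=
  .set 1 (.read 0 0) ;; .set 2 (.read 0 1) ;; .set 3 (.reg 1 + .reg 2) ;; .set 4 2 ;;
  .write 16 0 1

def powers : Program :=
  forLoop 6 (.reg 3) (.write 16 (.reg 6 + 1) (2 * .read 16 (.reg 6)))

/-- Write `z` to the cells `x * V + c` of the array `a`, for the next `len` input entries `x`. -/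
def markLoop (a : ℕ) (len : ℕ) (z : ℤ) : Program :=
  forLoop 10 (.reg len)
    (.write a (.read 0 (.reg 4) * .reg 3 + .reg 8) (.const z) ;; .set 4 (.reg 4 + 1))

/-- The diagonal entry `-2 * rhs` makes the self-factor `(-1)^rhs`; an entry `-2` makes a true
variable contribute `-1`. -/
def xorCase : Program :=
  (.write 1 (.reg 8 * .reg 3 + .reg 8) (0 - 2 * .read 0 (.reg 4 + 1)) ;;
    .set 9 (.read 0 (.reg 4 + 2)) ;; .set 4 (.reg 4 + 3) ;; .set 11 (.reg 11 + 1)) ;;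
  markLoop 1 9 (-2)

/-- The diagonal entry `-2` makes the self-factor `-1`; an entry `-1` makes a true literal
contribute 0. Positive literals go to the first matrix, negative ones to the second. -/
def clauseCase : Program :=
  (.write 1 (.reg 8 * .reg 3 + .reg 8) (0 - 2) ;;
    .set 9 (.read 0 (.reg 4 + 1)) ;; .set 12 (.read 0 (.reg 4 + 2)) ;; .set 4 (.reg 4 + 3)) ;;
  markLoop 1 9 (-1) ;; markLoop 2 12 (-1)

def parseConstraint : Program :=
  .set 8 (.reg 1 + .reg 7) ;; .ite (.read 0 (.reg 4)) xorCase clauseCase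

def parseSystem : Program := forLoop 7 (.reg 2) parseConstraint

def parseNode : Program :=
  .write 4 (.reg 13) (.reg 4) ;; .set 4 (.reg 4 + .read 0 (.reg 4) + 1) ;;
  .write 17 (.reg 13) (.reg 4) ;; .set 4 (.reg 4 + .read 0 (.reg 4) + 1)

def parseTree : Program :=
  (.set 5 (.read 0 (.reg 4)) ;; .set 4 (.reg 4 + 1)) ;; forLoop 13 (.reg 5) parseNode

def visitNode : Program :=
  .set 18 (.read 0 (.read 4 (.reg 16) + 1 + .reg 17)) ;;
  .ite (1 - .read 5 (.reg 18))
    (.write 5 (.reg 18) 1 ;; .write 6 (.reg 14) (.reg 18) ;; .set 14 (.reg 14 + 1)) .skip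

/-- Array 6 is the queue of a breadth-first search from node 0, with head in register 15 and tail in
register 14. -/
def search : Program :=
  (.write 5 0 1 ;; .set 14 1) ;;
  forLoop 15 (.reg 5)
    (.set 16 (.read 6 (.reg 15)) ;; forLoop 17 (.read 0 (.read 4 (.reg 16))) visitNode)

/-- The rank is stored plus one, so that the initial value zero means "not yet ranked". -/
def rankVertex : Program :=
  .set 18 (.read 0 (.reg 21 + 1 + .reg 22)) ;;
  .ite (1 - .read 7 (.reg 18))
    (.write 7 (.reg 18) (.reg 19 + 1) ;; .write 8 (.reg 19) (.reg 18) ;;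
      .write 9 (.reg 19) (.reg 21) ;; .set 19 (.reg 19 + 1)) .skip

def rankVertices : Program :=
  forLoop 20 (.reg 5)
    (.set 21 (.read 17 (.read 6 (.reg 20))) ;; forLoop 22 (.read 0 (.reg 21)) rankVertex)

/-- Register 24 counts the scope and register 25 keeps its maximum, the future parent. -/
def scopeEntry : Program :=
  .set 18 (.read 7 (.read 0 (.reg 21 + 1 + .reg 26)) - 1) ;;
  .ite (.reg 23 - .reg 18)
    (.write 10 (.reg 23 * .reg 3 + .reg 24) (.reg 18) ;; .set 24 (.reg 24 + 1) ;;
      .ite (.reg 18 - .reg 25) (.set 25 (.reg 18)) .skip) .skip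

def addChild : Program :=
  .write 11 (.reg 23) (.reg 24) ;;
  .ite (.reg 24)
    (.write 12 (.reg 25 * .reg 3 + .read 13 (.reg 25)) (.reg 23) ;;
      .write 13 (.reg 25) (.read 13 (.reg 25) + 1)) .skip

def scopes : Program :=
  forLoop 23 (.reg 3)
    ((.set 21 (.read 9 (.reg 23)) ;; .set 24 0 ;; .set 25 0) ;;
      forLoop 26 (.read 0 (.reg 21)) scopeEntry ;; addChild)

/-- Assign the binary digits of the register `32` to the scope of the vertex of rank `29`. -/
def decode : Program :=
  .set 33 (.reg 32) ;;
  forLoop 34 (.reg 30)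
    (.set 35 (.read 16 (.reg 30 - 1 - .reg 34)) ;;
      .set 18 (.read 10 (.reg 29 * .reg 3 + .reg 34)) ;;
      .ite (.reg 33 - .reg 35 + 1)
        (.write 14 (.reg 18) 1 ;; .set 33 (.reg 33 - .reg 35)) (.write 14 (.reg 18) 0))

/-- The interaction of the vertices `u` and `v` with the values `a` and `b`. -/
def pairExpr (u v a b : Expr) : Expr :=
  1 + b * (a * .read 1 (u * .reg 3 + v) + (1 - a) * .read 2 (u * .reg 3 + v))

def interactions : Program :=
  forLoop 39 (.reg 30)
    ((.set 18 (.read 10 (.reg 29 * .reg 3 + .reg 39)) ;; .set 41 (.read 14 (.reg 18)) ;;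
      .set 18 (.read 8 (.reg 18))) ;;
      .set 38 (.reg 38 * (pairExpr (.reg 18) (.reg 31) (.reg 41) (.reg 37) *
        pairExpr (.reg 31) (.reg 18) (.reg 37) (.reg 41))))

/-- The index of the current assignment in the table of the vertex of rank `43`. -/
def tableIndex : Program :=
  .set 44 0 ;;
  forLoop 45 (.read 11 (.reg 43))
    (.set 44 (2 * .reg 44 + .read 14 (.read 10 (.reg 43 * .reg 3 + .reg 45))))

def childTables : Program :=
  forLoop 42 (.read 13 (.reg 29))
    (.set 43 (.read 12 (.reg 29 * .reg 3 + .reg 42)) ;; tableIndex ;;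
      .set 38 (.reg 38 * .read 15 (.reg 44 * .reg 3 + .reg 43)))

def summand : Program :=
  (.write 14 (.reg 29) (.reg 37) ;;
    .set 38 (pairExpr (.reg 31) (.reg 31) (.reg 37) (.reg 37))) ;;
  interactions ;; childTables ;; .set 36 (.reg 36 + .reg 38)

def tableEntry : Program :=
  decode ;; .set 36 0 ;; forLoop 37 2 summand ;;
  .write 15 (.reg 32 * .reg 3 + .reg 29) (.reg 36)

/-- Ranks are processed downwards. The tables are interleaved, entry `j` of rank `r` having address
`j * V + r`, so no space has to be allocated. A vertex with empty scope is a root, and its single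
entry is a factor of the result. -/
def eliminate : Program :=
  (.set 29 (.reg 3 - 1 - .reg 28) ;; .set 30 (.read 11 (.reg 29)) ;;
    .set 31 (.read 8 (.reg 29))) ;;
  forLoop 32 (.read 16 (.reg 30)) tableEntry ;;
  .ite (.reg 30) .skip (.set 27 (.reg 27 * .read 15 (.reg 29)))

def eliminateAll : Program := .set 27 1 ;; forLoop 28 (.reg 3) eliminate

/-- Divide the register `27` by two to the power of the register `11`. -/
def divide : Program :=
  forLoop 46 (.reg 1 + 1)
    (.set 47 (.reg 1 - .reg 46) ;; .set 35 (.read 16 (.reg 47 + .reg 11)) ;;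
      .ite (.reg 27 - .reg 35 + 1)
        (.set 27 (.reg 27 - .reg 35) ;; .set 0 (.reg 0 + .read 16 (.reg 47))) .skip)

def main : Program :=
  header ;; powers ;; parseSystem ;; parseTree ;; search ;; rankVertices ;; scopes ;;
  eliminateAll ;; divide

end Algo

end ModelCounting

namespace ModelCounting

/-! ### Variable elimination -/

/-- The sum of `Φ` over all values in `{0, 1}` of the coordinates `i, …, i + n - 1`. -/
def sumBits : ℕ → ℕ → ((ℕ → ℤ) → ℤ) → (ℕ → ℤ) → ℤ
  | 0, _, Φ, s => Φ s
  | n + 1, i, Φ, s => ∑ b ∈ Finset.range 2, sumBits n (i + 1) Φ (Function.update s i b)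

/-- Only coordinates from `i` on are summed over, and `h` does not read them. -/
theorem sumBits_mul (n i : ℕ) (h Φ : (ℕ → ℤ) → ℤ)
    (hh : ∀ s s', (∀ p < i, s p = s' p) → h s = h s') (s : ℕ → ℤ) :
    sumBits n i (fun s => h s * Φ s) s = h s * sumBits n i Φ s := by
  induction n generalizing i s with
  | zero => rfl
  | succ n ih =>
    simp only [sumBits, Finset.mul_sum]
    refine Finset.sum_congr rfl fun b _ => ?_
    rw [ih (i + 1) (fun s s' hs => hh s s' fun p hp => hs p (by omega))]
    rw [hh (Function.update s i b) s fun p hp => Function.update_of_ne (by omega) _ _]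

theorem sumBits_eq_sum (n i : ℕ) (Φ : (ℕ → ℤ) → ℤ) (s : ℕ → ℤ) :
    sumBits n i Φ s = ∑ x : Fin n → Bool,
      Φ fun p => if h : i ≤ p ∧ p < i + n then ((x ⟨p - i, by omega⟩).toNat : ℤ) else s p := by
  induction n generalizing i s with
  | zero =>
    simp only [sumBits, Finset.univ_unique, Finset.sum_singleton]
    congr 1
    ext p
    rw [dif_neg (by omega)]
  | succ n ih =>
    have key : ∀ b : Bool, sumBits n (i + 1) Φ (Function.update s i (b.toNat : ℤ)) =
        ∑ x : Fin n → Bool, Φ fun p => if h : i ≤ p ∧ p < i + (n + 1) then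
          (((Fin.cons b x : Fin (n + 1) → Bool) ⟨p - i, by omega⟩).toNat : ℤ) else s p := by
      intro b
      rw [ih]
      refine Finset.sum_congr rfl fun x _ => ?_
      congr 1
      ext p
      rcases lt_trichotomy p i with hp | rfl | hp
      · rw [dif_neg (by omega), dif_neg (by omega), Function.update_of_ne (by omega)]
      · rw [dif_neg (by omega), dif_pos (by omega), Function.update_self]
        simp
      · by_cases hp' : p < i + (n + 1)
        · rw [dif_pos (by omega), dif_pos (by omega)]
          have : (⟨p - i, by omega⟩ : Fin (n + 1)) = Fin.succ ⟨p - (i + 1), by omega⟩ := by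
            ext; simp; omega
          rw [this, Fin.cons_succ]
        · rw [dif_neg (by omega), dif_neg (by omega), Function.update_of_ne (by omega)]
    have h0 := key false
    have h1 := key true
    simp only [Bool.toNat_false, Bool.toNat_true, Nat.cast_zero, Nat.cast_one] at h0 h1
    rw [sumBits, Finset.sum_range_succ, Finset.sum_range_one]
    simp only [Nat.cast_zero, Nat.cast_one]
    rw [h0, h1, ← (Fin.consEquiv fun _ : Fin (n + 1) => Bool).sum_comp, Fintype.sum_prod_type,
      Fintype.sum_bool, add_comm]
    rfl

/-! ### Scopes, parents and messages. -/

section Elimination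

variable (V : ℕ) (S : ℕ → List ℕ) (f : ℕ → ℕ → ℤ → ℤ → ℤ)

/-- The last element of the scope of `r`. -/
def parent (r : ℕ) : ℕ := (S r).foldl max 0

/-- The vertices with parent `r`. -/
def children (r : ℕ) : List ℕ := (List.range V).filter fun c => S c ≠ [] ∧ parent S c = r

/-- The interactions of `r` with its scope. -/
def localTerm (r : ℕ) (s : ℕ → ℤ) : ℤ :=
  f r r (s r) (s r) * ((S r).map fun u => f u r (s u) (s r) * f r u (s r) (s u)).prod

/-- The result of summing out `r` and everything below it. -/
def message (r : ℕ) (s : ℕ → ℤ) : ℤ :=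
  ∑ b ∈ Finset.range 2, localTerm S f r (Function.update s r b) *
    ((children V S r).attach.map fun c =>
      if r < c.1 then message c.1 (Function.update s r b) else 1).prod
termination_by V - r
decreasing_by
  have := c.2
  simp only [children, List.mem_filter, List.mem_range] at this
  omega

variable {V S f}

theorem mem_children {r c : ℕ} : c ∈ children V S r ↔ c < V ∧ S c ≠ [] ∧ parent S c = r := by
  simp [children]

theorem le_foldl_max (l : List ℕ) (a : ℕ) : a ≤ l.foldl max a ∧ ∀ u ∈ l, u ≤ l.foldl max a := by
  induction l generalizing a with
  | nil => simp
  | cons x l ih =>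
    have := ih (max a x)
    simp only [List.foldl_cons, List.mem_cons, forall_eq_or_imp]
    exact ⟨(le_max_left _ _).trans this.1, (le_max_right _ _).trans this.1, this.2⟩

theorem foldl_max_mem (l : List ℕ) (a : ℕ) : l.foldl max a = a ∨ l.foldl max a ∈ l := by
  induction l generalizing a with
  | nil => simp
  | cons x l ih =>
    simp only [List.foldl_cons, List.mem_cons]
    rcases ih (max a x) with h | h
    · rcases max_choice a x with h' | h' <;> rw [h'] at h ⊢ <;> tauto
    · tauto

theorem parent_mem {r : ℕ} (h : S r ≠ []) : parent S r ∈ S r := by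
  rcases foldl_max_mem (S r) 0 with h' | h'
  -- If the maximum is the start value 0 of the fold, then every element is 0, so 0 is an element.
  · obtain ⟨x, l, hx⟩ := List.exists_cons_of_ne_nil h
    have := (le_foldl_max (S r) 0).2 x (by simp [hx])
    have h0 : x = 0 := by omega
    rw [parent, h', hx, h0]
    simp
  · exact h'

theorem le_parent {r u : ℕ} (h : u ∈ S r) : u ≤ parent S r := (le_foldl_max (S r) 0).2 u h

/-- The guard `r < c` in `message` only secures termination: a parent belongs to the scope of its
child, so it has smaller rank. -/
theorem message_eq (hlt : ∀ r < V, ∀ u ∈ S r, u < r) (r : ℕ) (s : ℕ → ℤ) :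
    message V S f r s = ∑ b ∈ Finset.range 2, localTerm S f r (Function.update s r b) *
      ((children V S r).map fun c => message V S f c (Function.update s r b)).prod := by
  rw [message]
  refine Finset.sum_congr rfl fun b _ => ?_
  congr 2
  conv_rhs => rw [← List.attach_map_subtype_val (children V S r), List.map_map]
  refine List.map_congr_left fun c _ => ?_
  obtain ⟨h1, h2, h3⟩ := mem_children.1 c.2
  have := hlt c h1 _ (parent_mem h2)
  rw [if_pos (by omega)]
  rfl

variable (hlt : ∀ r < V, ∀ u ∈ S r, u < r)
  (hchain : ∀ c < V, S c ≠ [] → ∀ w ∈ S c, w = parent S c ∨ w ∈ S (parent S c))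

-- The local term reads only `r` and its scope, and by `hchain` the scope of a child of `r` lies
-- within these as well. The induction runs from large ranks to small ones.
include hlt hchain in
theorem message_congr {r : ℕ} {s s' : ℕ → ℤ} (h : ∀ u ∈ S r, s u = s' u) :
    message V S f r s = message V S f r s' := by
  induction hn : V - r using Nat.strong_induction_on generalizing r s s' with
  | _ n ih =>
    subst hn
    rw [message_eq hlt, message_eq hlt]
    refine Finset.sum_congr rfl fun b _ => ?_
    have hu : ∀ u, u = r ∨ u ∈ S r → Function.update s r (b : ℤ) u = Function.update s' r b u := by
      intro u hu
      by_cases hr : u = r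
      · simp [hr]
      · simp [hr, h u (hu.resolve_left hr)]
    congr 1
    · unfold localTerm
      rw [hu r (Or.inl rfl)]
      congr 2
      refine List.map_congr_left fun u hx => ?_
      rw [hu u (Or.inr hx)]
    · congr 1
      refine List.map_congr_left fun c hc => ?_
      obtain ⟨h1, h2, h3⟩ := mem_children.1 hc
      have : r < c := h3 ▸ hlt c h1 _ (parent_mem h2)
      refine ih (V - c) (by omega) (fun w hw => hu w ?_) rfl
      exact h3 ▸ hchain c h1 h2 w hw

-- Downward induction on `i`. The local term of `i` does not read later coordinates and comes out of
-- the inner sum. Among the messages left by the later coordinates, those with parent `i` are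
-- absorbed in the message of `i`; the others do not read coordinate `i`.
include hlt hchain in
theorem sumBits_localTerm (n i : ℕ) (hn : i + n = V) (s : ℕ → ℤ) :
    sumBits n i (fun s => ∏ r ∈ Finset.Ico i V, localTerm S f r s) s =
      ∏ c ∈ (Finset.Ico i V).filter (fun c => S c = [] ∨ parent S c < i),
        message V S f c s := by
  induction n generalizing i s with
  | zero =>
    obtain rfl : i = V := by omega
    simp [sumBits]
  | succ n ih =>
    have hi : i < V := by omega
    have hΦ : (fun s => ∏ r ∈ Finset.Ico i V, localTerm S f r s) = fun s =>
        localTerm S f i s * ∏ r ∈ Finset.Ico (i + 1) V, localTerm S f r s :=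
      funext fun s => Finset.prod_eq_prod_Ico_succ_bot hi _
    have hloc : ∀ s s' : ℕ → ℤ, (∀ p < i + 1, s p = s' p) →
        localTerm S f i s = localTerm S f i s' := by
      intro s s' hs
      unfold localTerm
      rw [hs i (by omega)]
      congr 2
      refine List.map_congr_left fun u hu => ?_
      rw [hs u (by have := hlt i hi u hu; omega)]
    -- The parent of `i`, if any, lies below `i`, so the message of `i` is always a factor.
    have hsplit : (Finset.Ico i V).filter (fun c => S c = [] ∨ parent S c < i) =
        insert i ((Finset.Ico (i + 1) V).filter (fun c => S c = [] ∨ parent S c < i)) := by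
      ext c
      simp only [Finset.mem_filter, Finset.mem_Ico, Finset.mem_insert]
      constructor
      · rintro ⟨h1, h2⟩
        by_cases hc : c = i
        · exact Or.inl hc
        · exact Or.inr ⟨by omega, h2⟩
      · rintro (rfl | ⟨h1, h2⟩)
        · refine ⟨by omega, ?_⟩
          by_cases h : S c = []
          · exact Or.inl h
          · exact Or.inr (hlt c hi _ (parent_mem h))
        · exact ⟨by omega, h2⟩
    -- Raising the threshold from `i` to `i + 1` adds exactly the vertices with parent `i`.
    have hsplit' : (Finset.Ico (i + 1) V).filter (fun c => S c = [] ∨ parent S c < i + 1) =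
        (children V S i).toFinset ∪
          (Finset.Ico (i + 1) V).filter (fun c => S c = [] ∨ parent S c < i) := by
      ext c
      simp only [Finset.mem_filter, Finset.mem_Ico, Finset.mem_union, List.mem_toFinset,
        mem_children]
      constructor
      · rintro ⟨h1, h2⟩
        by_cases h : S c = []
        · exact Or.inr ⟨h1, Or.inl h⟩
        · have := h2.resolve_left h
          by_cases h3 : parent S c = i
          · exact Or.inl ⟨h1.2, h, h3⟩
          · exact Or.inr ⟨h1, Or.inr (by omega)⟩
      · rintro (⟨h1, h2, h3⟩ | ⟨h1, h2⟩)
        · have := hlt c h1 _ (parent_mem h2)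
          exact ⟨by omega, Or.inr (by omega)⟩
        · exact ⟨h1, h2.imp_right fun h => by omega⟩
    have hdisj : Disjoint (children V S i).toFinset
        ((Finset.Ico (i + 1) V).filter (fun c => S c = [] ∨ parent S c < i)) := by
      rw [Finset.disjoint_left]
      intro c hc hc'
      simp only [Finset.mem_filter, List.mem_toFinset, mem_children] at hc hc'
      rcases hc'.2 with h | h
      · exact hc.2.1 h
      · omega
    have hnd : (children V S i).Nodup := List.nodup_range.filter _
    rw [sumBits, hsplit, Finset.prod_insert (by simp), message_eq hlt, Finset.sum_mul]
    refine Finset.sum_congr rfl fun b _ => ?_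
    rw [hΦ, sumBits_mul n (i + 1) _ _ hloc, ih (i + 1) (by omega), hsplit',
      Finset.prod_union hdisj, List.prod_toFinset _ hnd, ← mul_assoc]
    congr 1
    refine Finset.prod_congr rfl fun c hc => message_congr hlt hchain fun u hu => ?_
    refine Function.update_of_ne ?_ _ _
    rintro rfl
    simp only [Finset.mem_filter] at hc
    rcases hc.2 with h | h
    · simp [h] at hu
    · have := le_parent hu
      omega

-- A pair `u < r` is charged, in both orders, to the local term of `r`. Pairs outside the scopes
-- have weight 1, so all pairs may be included.
include hlt in
theorem prod_localTerm (hnd : ∀ r < V, (S r).Nodup)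
    (hf : ∀ r < V, ∀ u < r, u ∉ S r → ∀ a b, f u r a b = 1 ∧ f r u b a = 1) (s : ℕ → ℤ) :
    ∏ r ∈ Finset.range V, localTerm S f r s =
      ∏ p ∈ Finset.range V, ∏ q ∈ Finset.range V, f p q (s p) (s q) := by
  have hloc : ∀ r < V, localTerm S f r s = f r r (s r) (s r) *
      ∏ u ∈ Finset.range r, f u r (s u) (s r) * f r u (s r) (s u) := by
    intro r hr
    unfold localTerm
    rw [← List.prod_toFinset _ (hnd r hr)]
    congr 1
    refine Finset.prod_subset (fun u hu => ?_) (fun u hu hu' => ?_)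
    · exact Finset.mem_range.2 (hlt r hr u (List.mem_toFinset.1 hu))
    · obtain ⟨h1, h2⟩ := hf r hr u (Finset.mem_range.1 hu) (fun h => hu' (List.mem_toFinset.2 h))
        (s u) (s r)
      rw [h1, h2, one_mul]
  rw [Finset.prod_congr rfl fun r hr => hloc r (Finset.mem_range.1 hr)]
  clear hloc hf hnd hlt
  induction V with
  | zero => simp
  | succ V ih =>
    rw [Finset.prod_range_succ, ih, Finset.prod_range_succ]
    simp_rw [Finset.prod_range_succ _ V]
    rw [Finset.prod_mul_distrib, Finset.prod_mul_distrib]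
    ring

end Elimination

end ModelCounting

namespace ModelCounting

/-! ### The elimination phase of the algorithm -/

namespace Expr

variable (e f : Expr)

@[simp] theorem cost_add : (e + f).cost = e.cost + f.cost + 1 := rfl
@[simp] theorem cost_sub : (e - f).cost = e.cost + f.cost + 1 := rfl
@[simp] theorem cost_mul : (e * f).cost = e.cost + f.cost + 1 := rfl
@[simp] theorem cost_reg (x : ℕ) : (Expr.reg x).cost = 1 := rfl
@[simp] theorem cost_read (a : ℕ) : (Expr.read a e).cost = e.cost + 1 := rfl
@[simp] theorem cost_one : (1 : Expr).cost = 1 := rfl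
@[simp] theorem cost_ofNat (n : ℕ) [n.AtLeastTwo] : (ofNat(n) : Expr).cost = 1 := rfl

end Expr

@[simp] theorem toNat_address (u v w : ℕ) : ((u : ℤ) * v + w).toNat = u * v + w := by
  omega

theorem Frame.apply {p : Program} (hp : p.loopFree = true) (σ : Store) :
    Frame p σ (p.apply σ) := by
  obtain ⟨τ, t, h, -, rfl⟩ := Runs.loopFree hp σ
  exact h.frame

theorem List.prod_map_take_succ {l : List ℕ} {m : ℕ} (hm : m < l.length) (g : ℕ → ℤ) :
    ((l.take (m + 1)).map g).prod = ((l.take m).map g).prod * g l[m] := by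
  rw [← List.take_append_getElem hm, List.map_append, List.prod_append]
  simp

/-- The interaction of two vertices, given by their ranks. -/
def interaction (A B : ℕ → ℕ → ℤ) (ord : ℕ → ℕ) (u v : ℕ) (a b : ℤ) : ℤ :=
  1 + b * (a * A (ord u) (ord v) + (1 - a) * B (ord u) (ord v))

/-- The index of an assignment, restricted to `l`, in a table. -/
def horner (s : ℕ → ℤ) (l : List ℕ) : ℤ := l.foldl (fun acc u => 2 * acc + s u) 0

theorem horner_append_singleton (s : ℕ → ℤ) (l : List ℕ) (u : ℕ) :
    horner s (l ++ [u]) = 2 * horner s l + s u := by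
  simp [horner]

theorem horner_congr {s s' : ℕ → ℤ} {l : List ℕ} (h : ∀ u ∈ l, s u = s' u) :
    horner s l = horner s' l := by
  induction l using List.reverseRecOn with
  | nil => rfl
  | append_singleton l u ih =>
    rw [horner_append_singleton, horner_append_singleton, ih fun v hv => h v (by simp [hv]),
      h u (by simp)]

theorem horner_bounds {s : ℕ → ℤ} {l : List ℕ} (h : ∀ u ∈ l, s u = 0 ∨ s u = 1) :
    0 ≤ horner s l ∧ horner s l < 2 ^ l.length := by
  induction l using List.reverseRecOn with
  | nil => simp [horner]
  | append_singleton l u ih =>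
    obtain ⟨h1, h2⟩ := ih fun v hv => h v (by simp [hv])
    rw [horner_append_singleton, List.length_append, List.length_singleton, pow_succ]
    rcases h u (by simp) with h | h <;> rw [h] <;> omega

/-- The last bit is the parity of the index, so bits can be peeled off from the right. -/
theorem horner_injective {s s' : ℕ → ℤ} {l : List ℕ} (h : ∀ u ∈ l, s u = 0 ∨ s u = 1)
    (h' : ∀ u ∈ l, s' u = 0 ∨ s' u = 1) (he : horner s l = horner s' l) :
    ∀ u ∈ l, s u = s' u := by
  induction l using List.reverseRecOn with
  | nil => simp
  | append_singleton l u ih =>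
    rw [horner_append_singleton, horner_append_singleton] at he
    have h1 := h u (by simp)
    have h2 := h' u (by simp)
    have h3 := ih (fun v hv => h v (by simp [hv])) (fun v hv => h' v (by simp [hv])) (by omega)
    intro v hv
    rcases List.mem_append.1 hv with hv | hv
    · exact h3 v hv
    · obtain rfl := List.mem_singleton.1 hv
      omega

/-- The data that the elimination phase works on. -/
structure EliminationData where
  V : ℕ
  S : ℕ → List ℕ
  ord : ℕ → ℕ
  A : ℕ → ℕ → ℤ
  B : ℕ → ℕ → ℤ
  ord_lt : ∀ r < V, ord r < V
  scope_lt : ∀ r < V, ∀ u ∈ S r, u < r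
  scope_nodup : ∀ r < V, (S r).Nodup
  chain : ∀ c < V, S c ≠ [] → ∀ w ∈ S c, w = parent S c ∨ w ∈ S (parent S c)

/-! ### One table entry: decoding the index, interactions and tables of the children. -/

namespace EliminationData

variable (D : EliminationData)

/-- The interactions of the vertices, given by their ranks. -/
def f : ℕ → ℕ → ℤ → ℤ → ℤ := interaction D.A D.B D.ord

/-- The message of the vertex of rank `r`. -/
def msg (r : ℕ) (s : ℕ → ℤ) : ℤ := message D.V D.S D.f r s

/-- The memory holds the elimination data. -/
structure Holds (σ : Store) : Prop where
  reg : σ.reg 3 = D.V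
  A : ∀ p q, p < D.V → q < D.V → σ.arr 1 (p * D.V + q) = D.A p q
  B : ∀ p q, p < D.V → q < D.V → σ.arr 2 (p * D.V + q) = D.B p q
  ord : ∀ r < D.V, σ.arr 8 r = D.ord r
  len : ∀ r < D.V, σ.arr 11 r = (D.S r).length
  scope : ∀ r < D.V, ∀ i (h : i < (D.S r).length), σ.arr 10 (r * D.V + i) = (D.S r)[i]
  numChildren : ∀ r < D.V, σ.arr 13 r = (children D.V D.S r).length
  child : ∀ r < D.V, ∀ i (h : i < (children D.V D.S r).length),
    σ.arr 12 (r * D.V + i) = (children D.V D.S r)[i]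
  pow : ∀ i ≤ D.V, σ.arr 16 i = 2 ^ i

variable {D}

theorem Holds.frame {σ τ : Store} {p : Program} (h : D.Holds σ) (hF : Frame p σ τ)
    (h3 : 3 ∉ p.regs) (ha : ∀ a ∈ [1, 2, 8, 10, 11, 12, 13, 16], a ∉ p.arrs) : D.Holds τ := by
  simp only [List.mem_cons, List.not_mem_nil, or_false, forall_eq_or_imp, forall_eq] at ha
  obtain ⟨h1, h2, h8, h10, h11, h12, h13, h16⟩ := ha
  constructor
  · exact (hF.reg 3 h3).trans h.reg
  · exact hF.arr 1 h1 ▸ h.A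
  · exact hF.arr 2 h2 ▸ h.B
  · exact hF.arr 8 h8 ▸ h.ord
  · exact hF.arr 11 h11 ▸ h.len
  · exact hF.arr 10 h10 ▸ h.scope
  · exact hF.arr 13 h13 ▸ h.numChildren
  · exact hF.arr 12 h12 ▸ h.child
  · exact hF.arr 16 h16 ▸ h.pow

open Algo

/-- Greedy binary expansion, most significant bit first. The invariant writes `j` as the index of
the decoded prefix, shifted by the number of missing bits, plus a remainder smaller than the
corresponding power of two; at the end the remainder is 0. -/
theorem runs_decode {σ : Store} (h : D.Holds σ) {r j : ℕ} (hr : r < D.V)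
    (h29 : σ.reg 29 = r) (h30 : σ.reg 30 = (D.S r).length) (h32 : σ.reg 32 = j)
    (hj : j < 2 ^ (D.S r).length) :
    Runs decode σ (fun τ => (∀ u ∈ D.S r, τ.arr 14 u = 0 ∨ τ.arr 14 u = 1) ∧
      horner (τ.arr 14) (D.S r) = j) (60 * ((D.S r).length + 1)) := by
  set l := D.S r with hl
  have hlen : l.length ≤ D.V := by
    have h1 : l.toFinset ⊆ Finset.range r := fun u hu =>
      Finset.mem_range.2 (D.scope_lt r hr u (List.mem_toFinset.1 hu))
    have := Finset.card_le_card h1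
    rw [List.toFinset_card_of_nodup (D.scope_nodup r hr), Finset.card_range] at this
    exact this.trans hr.le
  unfold decode
  refine Runs.block (c := 56 * l.length + 6) rfl ?_ (by change 2 + _ ≤ _; omega)
  set σ' := (Program.set 33 (.reg 32)).apply σ with hσ'
  have hF' : Frame (.set 33 (.reg 32)) σ σ' := (Exec.set 33 (.reg 32) σ).frame
  refine Runs.conseq (Q := _) (c := 56 * l.length + 6) (Runs.forLoop (n := l.length)
    (fun m τ => ∃ rem : ℕ, τ.reg 33 = rem ∧ rem < 2 ^ (l.length - m) ∧
      (∀ u ∈ l.take m, τ.arr 14 u = 0 ∨ τ.arr 14 u = 1) ∧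
      (j : ℤ) = horner (τ.arr 14) (l.take m) * 2 ^ (l.length - m) + rem) (fun _ => 47)
    (by decide) ?_ ?_ ?_ ?_) ?_ le_rfl
  · intro τ hF
    rw [Expr.eval_reg, hF.reg 30 (by decide), hF'.reg 30 (by decide), h30]
  · exact ⟨j, by simp [hσ', Program.apply, h32], by simpa using hj, by simp, by simp [horner]⟩
  · rintro m τ hm hF h34 ⟨rem, h33, hrem, hb, hj'⟩
    have hH := (h.frame hF' (by decide) (by decide)).frame hF (by decide) (by decide)
    have e29 : τ.reg 29 = r := by rw [hF.reg 29 (by decide), hF'.reg 29 (by decide), h29]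
    have e30 : τ.reg 30 = l.length := by rw [hF.reg 30 (by decide), hF'.reg 30 (by decide), h30]
    refine Runs.block_end rfl ?_ (by decide)
    have e16 : τ.arr 16 (l.length - 1 - m) = 2 ^ (l.length - (m + 1)) := by
      rw [show l.length - 1 - m = l.length - (m + 1) by omega]
      exact hH.pow _ (by omega)
    have e10 : τ.arr 10 (r * D.V + m) = l[m] := hH.scope r hr m hm
    have hpow : (2 : ℕ) ^ (l.length - m) = 2 * 2 ^ (l.length - (m + 1)) := by
      rw [← pow_succ']; congr 1; omega
    have hpow' : (2 : ℤ) ^ (l.length - m) = 2 * 2 ^ (l.length - (m + 1)) := by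
      exact_mod_cast hpow
    have htake : l.take (m + 1) = l.take m ++ [l[m]] := by simp
    -- A scope has no repetitions, so the new bit does not overwrite an earlier one.
    have hnm : l[m] ∉ l.take m := by
      have hnd := (D.scope_nodup r hr).sublist (List.take_sublist (m + 1) (D.S r))
      rw [← hl, htake, List.nodup_append] at hnd
      exact fun hx => hnd.2.2 _ hx _ (by simp) rfl
    have hupd : ∀ z : ℤ, horner (Function.update (τ.arr 14) l[m] z) (l.take m) =
        horner (τ.arr 14) (l.take m) := fun z => horner_congr fun u hu =>
      Function.update_of_ne (ne_of_mem_of_not_mem hu hnm) _ _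
    have hbit : ∀ z : ℤ, z = 0 ∨ z = 1 → ∀ u ∈ l.take (m + 1),
        Function.update (τ.arr 14) l[m] z u = 0 ∨ Function.update (τ.arr 14) l[m] z u = 1 := by
      intro z hz u hu
      rw [htake] at hu
      rcases List.mem_append.1 hu with hu | hu
      · rw [Function.update_of_ne (ne_of_mem_of_not_mem hu hnm)]
        exact hb u hu
      · rw [List.mem_singleton.1 hu, Function.update_self]
        exact hz
    have heq : ∀ z : ℤ, horner (Function.update (τ.arr 14) l[m] z) (l.take (m + 1)) =
        2 * horner (τ.arr 14) (l.take m) + z := by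
      intro z
      rw [htake, horner_append_singleton, hupd, Function.update_self]
    by_cases hc : 2 ^ (l.length - (m + 1)) ≤ rem
    · refine ⟨rem - 2 ^ (l.length - (m + 1)), ?_, by omega, ?_, ?_⟩
      all_goals
        have hc' : (0 : ℤ) < rem - 2 ^ (l.length - (m + 1)) + 1 := by
          have : ((2 ^ (l.length - (m + 1)) : ℕ) : ℤ) ≤ rem := by exact_mod_cast hc
          push_cast at this
          omega
        simp [Program.apply, e30, h34, e16, h33, hc', hH.reg, e29, e10]
      · push_cast [Nat.cast_sub hc]; rfl
      · exact hbit 1 (Or.inr rfl)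
      · rw [heq 1, hj', hpow']
        push_cast [Nat.cast_sub hc]
        ring
    · refine ⟨rem, ?_, by omega, ?_, ?_⟩
      all_goals
        have hc' : ¬ (0 : ℤ) < rem - 2 ^ (l.length - (m + 1)) + 1 := by
          have : (rem : ℤ) < ((2 ^ (l.length - (m + 1)) : ℕ) : ℤ) := by exact_mod_cast not_le.1 hc
          push_cast at this
          omega
        simp [Program.apply, e30, h34, e16, h33, hc', hH.reg, e29, e10]
      · exact hbit 0 (Or.inl rfl)
      · rw [heq 0, hj', hpow']
        ring
  · simp
    omega
  · rintro τ - ⟨rem, -, hrem, hb, hj'⟩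
    rw [List.take_length] at hb hj'
    refine ⟨hb, ?_⟩
    simp at hrem hj'
    subst hrem
    simp [hj']

theorem Holds.eval_pairExpr {σ : Store} (h : D.Holds σ) {u v a b : Expr} {x y : ℕ}
    (hx : x < D.V) (hy : y < D.V) (hu : u.eval σ = D.ord x) (hv : v.eval σ = D.ord y) :
    (pairExpr u v a b).eval σ = D.f x y (a.eval σ) (b.eval σ) := by
  simp [pairExpr, hu, hv, h.reg, f, interaction, h.A _ _ (D.ord_lt x hx) (D.ord_lt y hy),
    h.B _ _ (D.ord_lt x hx) (D.ord_lt y hy)]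

theorem runs_interactions {σ : Store} (h : D.Holds σ) {r : ℕ} (hr : r < D.V) {b z : ℤ}
    (h29 : σ.reg 29 = r) (h30 : σ.reg 30 = (D.S r).length) (h31 : σ.reg 31 = D.ord r)
    (h37 : σ.reg 37 = b) (h38 : σ.reg 38 = z) :
    Runs interactions σ (fun τ => τ.reg 38 = z *
      ((D.S r).map fun u => D.f u r (σ.arr 14 u) b * D.f r u b (σ.arr 14 u)).prod)
      (80 * ((D.S r).length + 1)) := by
  set l := D.S r with hl
  unfold interactions
  refine Runs.conseq (Q := _) (c := 80 * (l.length + 1)) (Runs.forLoop (n := l.length)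
    (fun m τ => τ.reg 38 = z *
      ((l.take m).map fun u => D.f u r (σ.arr 14 u) b * D.f r u b (σ.arr 14 u)).prod)
    (fun _ => 70) (by decide) ?_ ?_ ?_ ?_) ?_ le_rfl
  · intro τ hF
    rw [Expr.eval_reg, hF.reg 30 (by decide), h30]
  · simp [h38]
  · rintro m τ hm hF h39 hI
    have hH := h.frame hF (by decide) (by decide)
    have e29 : τ.reg 29 = r := by rw [hF.reg 29 (by decide), h29]
    have e31 : τ.reg 31 = D.ord r := by rw [hF.reg 31 (by decide), h31]
    have e37 : τ.reg 37 = b := by rw [hF.reg 37 (by decide), h37]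
    have e14 : τ.arr 14 = σ.arr 14 := hF.arr 14 (by decide)
    have e10 : τ.arr 10 (r * D.V + m) = l[m] := hH.scope r hr m hm
    have hmr : l[m] < D.V := (D.scope_lt r hr l[m] (by simp [← hl])).trans hr
    have e8 := hH.ord l[m] hmr
    refine Runs.block (c := 50) rfl ?_ (by decide)
    set τ' := Program.apply _ τ with hτ'
    have hH' : D.Holds τ' := hH.frame (Frame.apply rfl τ) (by decide) (by decide)
    have e18 : τ'.reg 18 = D.ord l[m] := by
      simp [hτ', Program.apply, e29, hH.reg, h39, e10, e8]
    have e41 : τ'.reg 41 = σ.arr 14 l[m] := by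
      simp [hτ', Program.apply, e29, hH.reg, h39, e10, e14]
    have e31' : τ'.reg 31 = D.ord r := by simp [hτ', Program.apply, e31]
    have e37' : τ'.reg 37 = b := by simp [hτ', Program.apply, e37]
    have e38' : τ'.reg 38 = τ.reg 38 := by simp [hτ', Program.apply]
    refine Runs.block_end rfl ?_ (by decide)
    have p1 := hH'.eval_pairExpr (u := .reg 18) (v := .reg 31) (a := .reg 41) (b := .reg 37)
      hmr hr e18 e31'
    have p2 := hH'.eval_pairExpr (u := .reg 31) (v := .reg 18) (a := .reg 37) (b := .reg 41)
      hr hmr e31' e18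
    simp only [List.prod_map_take_succ hm]
    rw [← mul_assoc, ← hI]
    simp [Program.apply, p1, p2, e41, e37', e38']
  · simp
    omega
  · intro τ _ hI
    rwa [List.take_length] at hI

/-- The table of the vertex of rank `c` is complete. -/
def TableDone (D : EliminationData) (c : ℕ) (σ : Store) : Prop :=
  ∀ s : ℕ → ℤ, (∀ u ∈ D.S c, s u = 0 ∨ s u = 1) →
    σ.arr 15 (horner s (D.S c) * D.V + c).toNat = D.msg c s

theorem runs_tableIndex {σ : Store} (h : D.Holds σ) {c : ℕ} (hc : c < D.V)
    (h43 : σ.reg 43 = c) :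
    Runs tableIndex σ (fun τ => τ.reg 44 = horner (σ.arr 14) (D.S c))
      (30 * ((D.S c).length + 1)) := by
  set l := D.S c with hl
  unfold tableIndex
  refine Runs.block (c := 30 * l.length + 10) rfl ?_ (by change 2 + _ ≤ _; omega)
  set σ' := (Program.set 44 0).apply σ with hσ'
  have hF' : Frame (.set 44 0) σ σ' := (Exec.set 44 0 σ).frame
  refine Runs.conseq (Q := _) (c := 30 * l.length + 10) (Runs.forLoop (n := l.length)
    (fun m τ => τ.reg 44 = horner (σ.arr 14) (l.take m)) (fun _ => 20) (by decide)
    ?_ ?_ ?_ ?_) ?_ le_rfl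
  · intro τ hF
    rw [Expr.eval_read, Expr.eval_reg, hF.reg 43 (by decide), hF.arr 11 (by decide),
      hF'.reg 43 (by decide), hF'.arr 11 (by decide), h43, Int.toNat_natCast, h.len c hc]
  · simp [hσ', Program.apply, horner]
  · rintro m τ hm hF h45 hI
    have hH := (h.frame hF' (by decide) (by decide)).frame hF (by decide) (by decide)
    have e43 : τ.reg 43 = c := by rw [hF.reg 43 (by decide), hF'.reg 43 (by decide), h43]
    have e14 : τ.arr 14 = σ.arr 14 := by rw [hF.arr 14 (by decide), hF'.arr 14 (by decide)]
    have e10 : τ.arr 10 (c * D.V + m) = l[m] := hH.scope c hc m hm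
    have htake : l.take (m + 1) = l.take m ++ [l[m]] := by simp
    refine Runs.block_end rfl ?_ (by decide)
    simp only [Program.apply, Expr.eval_read, Expr.eval_reg, Expr.eval_add, Expr.eval_mul, e43,
      hH.reg, h45, toNat_address, e10, e14, Store.setReg_reg, reduceIte,
      Int.toNat_natCast, htake, horner_append_singleton, hI, Expr.eval_ofNat]
    simp
  · simp
    omega
  · intro τ _ hI
    rwa [List.take_length] at hI

/-- By `chain`, the scope of a child consists of `r` and elements of the scope of `r`. Hence the
current assignment determines the entry to look up, and computing its index takes time linear in
`(D.S r).length + 1`. -/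
theorem runs_childTables {σ : Store} (h : D.Holds σ) {r : ℕ} (hr : r < D.V) {z : ℤ}
    (h29 : σ.reg 29 = r) (h38 : σ.reg 38 = z)
    (hbit : ∀ u, u = r ∨ u ∈ D.S r → σ.arr 14 u = 0 ∨ σ.arr 14 u = 1)
    (htab : ∀ c, r < c → c < D.V → D.TableDone c σ) :
    Runs childTables σ (fun τ => τ.reg 38 = z *
      ((children D.V D.S r).map fun c => D.msg c (σ.arr 14)).prod)
      (100 * ((D.S r).length + 1) * ((children D.V D.S r).length + 1)) := by
  set l := children D.V D.S r with hl
  have hsub : ∀ c ∈ l, r < c ∧ c < D.V ∧ (∀ u ∈ D.S c, u = r ∨ u ∈ D.S r) := by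
    intro c hc
    obtain ⟨h1, h2, h3⟩ := mem_children.1 hc
    exact ⟨h3 ▸ D.scope_lt c h1 _ (parent_mem h2), h1, fun u hu => h3 ▸ D.chain c h1 h2 u hu⟩
  have hlen : ∀ c ∈ l, (D.S c).length ≤ (D.S r).length + 1 := by
    intro c hc
    have h1 : (D.S c).toFinset ⊆ insert r (D.S r).toFinset := fun u hu => by
      simpa using (hsub c hc).2.2 u (List.mem_toFinset.1 hu)
    have h2 := (Finset.card_le_card h1).trans (Finset.card_insert_le _ _)
    rw [List.toFinset_card_of_nodup (D.scope_nodup c (hsub c hc).2.1)] at h2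
    exact h2.trans (Nat.succ_le_succ (List.toFinset_card_le _))
  unfold childTables
  refine Runs.conseq (Q := _) (c := 100 * ((D.S r).length + 1) * (l.length + 1))
    (Runs.forLoop (n := l.length)
    (fun m τ => τ.reg 38 = z * ((l.take m).map fun c => D.msg c (σ.arr 14)).prod)
    (fun _ => 30 * ((D.S r).length + 2) + 20) (by decide) ?_ ?_ ?_ ?_) ?_ le_rfl
  · intro τ hF
    rw [Expr.eval_read, Expr.eval_reg, hF.reg 29 (by decide), hF.arr 13 (by decide), h29,
      Int.toNat_natCast, h.numChildren r hr]
  · simp [h38]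
  · rintro m τ hm hF h42 hI
    have hH := h.frame hF (by decide) (by decide)
    have e29 : τ.reg 29 = r := by rw [hF.reg 29 (by decide), h29]
    have e14 : τ.arr 14 = σ.arr 14 := hF.arr 14 (by decide)
    have e15 : τ.arr 15 = σ.arr 15 := hF.arr 15 (by decide)
    have e12 : τ.arr 12 (r * D.V + m) = l[m] := hH.child r hr m hm
    have hmem : l[m] ∈ l := List.getElem_mem hm
    obtain ⟨h1, h2, h3⟩ := hsub _ hmem
    have h4 := hlen _ hmem
    refine Runs.block (c := 30 * ((D.S r).length + 2) + 10) rfl ?_ (by change 7 + _ ≤ _; omega)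
    set τ' := (Program.set 43 _).apply τ with hτ'
    have hF' : Frame (.set 43 (.read 12 (.reg 29 * .reg 3 + .reg 42))) τ τ' :=
      (Exec.set 43 _ τ).frame
    have hH' := hH.frame hF' (by decide) (by decide)
    have e43 : τ'.reg 43 = l[m] := by
      simp [hτ', Program.apply, e29, hH.reg, h42, e12]
    refine (runs_tableIndex hH' h2 e43).seq (d := 10) (fun ρ hFρ h44 => ?_) (by omega)
    refine Runs.block_end rfl ?_ (by decide)
    have f43 : ρ.reg 43 = l[m] := (hFρ.reg 43 (by decide)).trans e43
    have f38 : ρ.reg 38 = τ.reg 38 :=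
      (hFρ.reg 38 (by decide)).trans (hF'.reg 38 (by decide))
    have f15 : ρ.arr 15 = σ.arr 15 :=
      (hFρ.arr 15 (by decide)).trans ((hF'.arr 15 (by decide)).trans e15)
    have f3 : ρ.reg 3 = D.V := (hFρ.reg 3 (by decide)).trans hH'.reg
    have f14 : τ'.arr 14 = σ.arr 14 := (hF'.arr 14 (by decide)).trans e14
    have f := htab l[m] h1 h2 (σ.arr 14) fun u hu => hbit u (h3 u hu)
    rw [f14] at h44
    simp only [List.prod_map_take_succ hm]
    rw [← mul_assoc, ← hI]
    simp [Program.apply, f38, f15, h44, f43, f3, f]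
  · simp only [Finset.sum_const, Finset.card_range, smul_eq_mul, Expr.cost_read, Expr.cost_reg]
    nlinarith
  · intro τ _ hI
    rwa [List.take_length] at hI

end EliminationData
end ModelCounting

namespace ModelCounting

/-- Uniqueness of division with remainder. It keeps matrix columns, rows of scopes and children, and
interleaved tables apart. -/
theorem address_injective {u u' V w w' : ℕ} (hw : w < V) (hw' : w' < V)
    (h : u * V + w = u' * V + w') : u = u' ∧ w = w' := by
  have h1 := congrArg (· / V) h
  have h2 := congrArg (· % V) h
  have hV : 0 < V := by omega
  simp only [Nat.mul_add_mod_self_right, Nat.mod_eq_of_lt hw,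
    Nat.mod_eq_of_lt hw'] at h2
  simp only [Nat.add_div_of_dvd_right (Dvd.intro_left _ rfl), Nat.mul_div_cancel _ hV,
    Nat.div_eq_of_lt hw, Nat.div_eq_of_lt hw'] at h1
  omega

/-! ### Whole tables and the product over the roots. -/

namespace EliminationData

variable {D : EliminationData}

open Algo

theorem TableDone.congr {c : ℕ} {σ τ : Store} (h : D.TableDone c σ)
    (he : τ.arr 15 = σ.arr 15) : D.TableDone c τ := fun s hs => he ▸ h s hs

/-- The summand of a message. -/
def term (D : EliminationData) (r : ℕ) (s : ℕ → ℤ) : ℤ :=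
  localTerm D.S D.f r s * ((children D.V D.S r).map fun c => D.msg c s).prod

theorem msg_eq (r : ℕ) (s : ℕ → ℤ) :
    D.msg r s = ∑ b ∈ Finset.range 2, D.term r (Function.update s r b) :=
  message_eq D.scope_lt r s

theorem msg_congr {r : ℕ} {s s' : ℕ → ℤ} (h : ∀ u ∈ D.S r, s u = s' u) :
    D.msg r s = D.msg r s' := message_congr D.scope_lt D.chain h

theorem runs_summand {σ : Store} (h : D.Holds σ) {r b : ℕ} (hr : r < D.V) {z : ℤ} (hb : b < 2)
    (h29 : σ.reg 29 = r) (h30 : σ.reg 30 = (D.S r).length) (h31 : σ.reg 31 = D.ord r)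
    (h37 : σ.reg 37 = b) (h36 : σ.reg 36 = z)
    (hbit : ∀ u ∈ D.S r, σ.arr 14 u = 0 ∨ σ.arr 14 u = 1)
    (htab : ∀ c, r < c → c < D.V → D.TableDone c σ) :
    Runs summand σ (fun τ => τ.reg 36 = z + D.term r (Function.update (σ.arr 14) r b) ∧
      τ.arr 14 = Function.update (σ.arr 14) r b)
      (250 * ((D.S r).length + 1) * ((children D.V D.S r).length + 1)) := by
  set n := (D.S r).length with hn
  set m := (children D.V D.S r).length with hm
  set s := Function.update (σ.arr 14) r (b : ℤ) with hs
  have hnm : n + 1 ≤ (n + 1) * (m + 1) := Nat.le_mul_of_pos_right _ (by omega)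
  unfold summand
  refine Runs.block (c := 80 * (n + 1) + (100 * (n + 1) * (m + 1) + 10)) rfl ?_
    ((Nat.add_le_add_right (by decide : _ ≤ 50) _).trans (by linarith))
  set σ' := Program.apply _ σ with hσ'
  have hF' : Frame _ σ σ' := Frame.apply rfl σ
  have hH' := h.frame hF' (by decide) (by decide)
  have e14 : σ'.arr 14 = s := by simp [hσ', Program.apply, h29, h37, hs]
  have e31 : σ'.reg 31 = D.ord r := (hF'.reg 31 (by decide)).trans h31
  have e37 : σ'.reg 37 = b := (hF'.reg 37 (by decide)).trans h37
  have e38 : σ'.reg 38 = D.f r r b b := by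
    have := h.frame (Frame.apply (p := .write 14 (.reg 29) (.reg 37)) rfl σ) (by decide)
      (by decide)
    have := this.eval_pairExpr (u := .reg 31) (v := .reg 31) (a := .reg 37) (b := .reg 37)
      hr hr (by simp [Program.apply, h31]) (by simp [Program.apply, h31])
    simp only [Program.apply, Expr.eval_reg, Store.setCell_reg, h37] at this
    simp [hσ', Program.apply, h37, this]
  have hsr : s r = b := by simp [hs]
  have hsb : ∀ u, u = r ∨ u ∈ D.S r → s u = 0 ∨ s u = 1 := by
    rintro u hu
    by_cases hur : u = r
    · rw [hur, hsr]
      have : b = 0 ∨ b = 1 := by omega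
      exact this.imp (by simp +contextual) (by simp +contextual)
    · rw [hs, Function.update_of_ne hur]
      exact hbit u (hu.resolve_left hur)
  refine (runs_interactions hH' hr ((hF'.reg 29 (by decide)).trans h29)
    ((hF'.reg 30 (by decide)).trans h30) e31 e37 e38).seq (fun τ hF hτ => ?_) le_rfl
  have hH := hH'.frame hF (by decide) (by decide)
  have f14 : τ.arr 14 = s := (hF.arr 14 (by decide)).trans e14
  have f15 : τ.arr 15 = σ.arr 15 := (hF.arr 15 (by decide)).trans (hF'.arr 15 (by decide))
  refine (runs_childTables hH hr
    (((hF.reg 29 (by decide)).trans (hF'.reg 29 (by decide))).trans h29) hτ (by rwa [f14])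
    (fun c h1 h2 => (htab c h1 h2).congr f15)).seq (fun ρ hFρ hρ => ?_) le_rfl
  refine Runs.block_end rfl ?_ (by decide)
  have g14 : ρ.arr 14 = s := (hFρ.arr 14 (by decide)).trans f14
  have g36 : ρ.reg 36 = z := by
    rw [hFρ.reg 36 (by decide), hF.reg 36 (by decide), hF'.reg 36 (by decide), h36]
  refine ⟨?_, by simp [Program.apply, g14]⟩
  rw [f14, e14] at hρ
  simp [Program.apply, g36, hρ, term, localTerm, hsr]

/-- The witness `s` is the content of the assignment array after decoding. It may hold leftovers
outside the scope; these do not affect the message. -/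
theorem runs_tableEntry {σ : Store} (h : D.Holds σ) {r j : ℕ} (hr : r < D.V)
    (h29 : σ.reg 29 = r) (h30 : σ.reg 30 = (D.S r).length) (h31 : σ.reg 31 = D.ord r)
    (h32 : σ.reg 32 = j) (hj : j < 2 ^ (D.S r).length)
    (htab : ∀ c, r < c → c < D.V → D.TableDone c σ) :
    Runs tableEntry σ (fun τ => ∃ s : ℕ → ℤ, (∀ u ∈ D.S r, s u = 0 ∨ s u = 1) ∧
      horner s (D.S r) = j ∧ τ.arr 15 = Function.update (σ.arr 15) (j * D.V + r) (D.msg r s))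
      (700 * ((D.S r).length + 1) * ((children D.V D.S r).length + 1)) := by
  set n := (D.S r).length with hn
  set m := (children D.V D.S r).length with hm
  have hnm : n + 1 ≤ (n + 1) * (m + 1) := Nat.le_mul_of_pos_right _ (by omega)
  have hrS : r ∉ D.S r := fun hx => lt_irrefl _ (D.scope_lt r hr r hx)
  unfold tableEntry
  refine (runs_decode h hr h29 h30 h32 hj).seq
    (d := 500 * (n + 1) * (m + 1) + 60) (fun τ hF hτ => ?_) (by linarith)
  refine Runs.block (c := 500 * (n + 1) * (m + 1) + 50) rfl ?_ (by change 2 + _ ≤ _; omega)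
  set σ' := Program.apply _ τ with hσ'
  have hF' : Frame _ τ σ' := Frame.apply rfl τ
  set s := τ.arr 14 with hs
  have hH' := (h.frame hF (by decide) (by decide)).frame hF' (by decide) (by decide)
  have e15 : σ'.arr 15 = σ.arr 15 := (hF'.arr 15 (by decide)).trans (hF.arr 15 (by decide))
  refine (Runs.forLoop (n := 2) (fun b ρ =>
    ρ.reg 36 = ∑ b' ∈ Finset.range b, D.term r (Function.update s r b') ∧
      ∀ u, u ≠ r → ρ.arr 14 u = s u) (fun _ => 250 * (n + 1) * (m + 1)) (by decide)
    (fun _ _ => rfl) ?_ ?_ le_rfl).seq (d := 15) ?_ ?_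
  · simp [hσ', Program.apply, hs]
  · rintro b ρ hb hFρ h37 ⟨h36, h14⟩
    have hH := hH'.frame hFρ (by decide) (by decide)
    have f15 : ρ.arr 15 = σ.arr 15 := (hFρ.arr 15 (by decide)).trans e15
    have hupd : Function.update (ρ.arr 14) r (b : ℤ) = Function.update s r b := by
      ext u
      by_cases hu : u = r
      · simp [hu]
      · simp [hu, h14 u hu]
    refine (runs_summand hH hr hb
      (by rw [hFρ.reg 29 (by decide), hF'.reg 29 (by decide), hF.reg 29 (by decide), h29])
      (by rw [hFρ.reg 30 (by decide), hF'.reg 30 (by decide), hF.reg 30 (by decide), h30])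
      (by rw [hFρ.reg 31 (by decide), hF'.reg 31 (by decide), hF.reg 31 (by decide), h31])
      h37 h36 (fun u hu => ?_) (fun c h1 h2 => (htab c h1 h2).congr f15)).conseq ?_ le_rfl
    · rw [h14 u (ne_of_mem_of_not_mem hu hrS)]
      exact hτ.1 u hu
    · rintro υ - ⟨k1, k2⟩
      refine ⟨?_, fun u hu => ?_⟩
      · simp [k1, hupd, Finset.sum_range_succ]
      · simp [k2, hu, h14 u hu]
  · rintro ρ hFρ ⟨h36, -⟩
    refine Runs.block_end rfl ⟨s, hτ.1, hτ.2, ?_⟩ (by decide)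
    have f15 : ρ.arr 15 = σ.arr 15 := (hFρ.arr 15 (by decide)).trans e15
    have f3 : ρ.reg 3 = D.V := (hFρ.reg 3 (by decide)).trans hH'.reg
    have f29 : ρ.reg 29 = r := by
      rw [hFρ.reg 29 (by decide), hF'.reg 29 (by decide), hF.reg 29 (by decide), h29]
    have f32 : ρ.reg 32 = j := by
      rw [hFρ.reg 32 (by decide), hF'.reg 32 (by decide), hF.reg 32 (by decide), h32]
    rw [← msg_eq] at h36
    simp [Program.apply, f15, f3, f29, f32, h36]
  · simp only [Finset.sum_const, Finset.card_range, smul_eq_mul, Expr.cost_ofNat]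
    linarith

/-- The address of an entry determines the vertex and the index, so finished entries survive. As
Horner indices are injective on bits, the entry computed from one assignment serves every assignment
with the same index. -/
theorem runs_eliminate {σ : Store} (h : D.Holds σ) {i r : ℕ} (hr : r < D.V)
    (hi : i + r + 1 = D.V) (h28 : σ.reg 28 = i) {z : ℤ} (h27 : σ.reg 27 = z)
    (htab : ∀ c, r < c → c < D.V → D.TableDone c σ) :
    Runs eliminate σ (fun τ => (∀ c, r ≤ c → c < D.V → D.TableDone c τ) ∧
      τ.reg 27 = if D.S r = [] then z * D.msg r 0 else z)
      (800 * 2 ^ (D.S r).length * ((D.S r).length + 1) *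
        ((children D.V D.S r).length + 1)) := by
  set n := (D.S r).length with hn
  set m := (children D.V D.S r).length with hm
  set N := 2 ^ n with hN
  have hN1 : 1 ≤ N := Nat.one_le_two_pow
  have hnm : 1 ≤ (n + 1) * (m + 1) := Nat.mul_pos (by omega) (by omega)
  have hcost : N ≤ N * ((n + 1) * (m + 1)) := Nat.le_mul_of_pos_right _ hnm
  have hnV : n ≤ D.V := by
    have h1 : (D.S r).toFinset ⊆ Finset.range r := fun u hu =>
      Finset.mem_range.2 (D.scope_lt r hr u (List.mem_toFinset.1 hu))
    have := Finset.card_le_card h1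
    rw [List.toFinset_card_of_nodup (D.scope_nodup r hr), Finset.card_range] at this
    exact this.trans hr.le
  unfold eliminate
  refine Runs.block (c := 700 * N * (n + 1) * (m + 1) + 10 * N + 30) rfl ?_
    ((Nat.add_le_add_right (by decide : _ ≤ 30) _).trans (by linarith))
  set σ' := Program.apply _ σ with hσ'
  have hF' : Frame _ σ σ' := Frame.apply rfl σ
  have hH' := h.frame hF' (by decide) (by decide)
  have hsub : ((D.V : ℤ) - 1 - i) = r := by omega
  have e29 : σ'.reg 29 = r := by simp [hσ', Program.apply, h.reg, h28, hsub]
  have e30 : σ'.reg 30 = n := by simp [hσ', Program.apply, h.reg, h28, hsub, h.len r hr, hn]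
  have e31 : σ'.reg 31 = D.ord r := by simp [hσ', Program.apply, h.reg, h28, hsub, h.ord r hr]
  have e15 : σ'.arr 15 = σ.arr 15 := hF'.arr 15 (by decide)
  refine (Runs.forLoop (n := N) (fun j τ => (∀ c, r < c → c < D.V → D.TableDone c τ) ∧
    ∀ s : ℕ → ℤ, (∀ u ∈ D.S r, s u = 0 ∨ s u = 1) → horner s (D.S r) < j →
      τ.arr 15 (horner s (D.S r) * D.V + r).toNat = D.msg r s)
    (fun _ => 700 * (n + 1) * (m + 1)) (by decide) ?_ ?_ ?_ le_rfl).seq (d := 15) ?_ ?_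
  · intro τ hF
    rw [Expr.eval_read, Expr.eval_reg, hF.arr 16 (by decide), hF.reg 30 (by decide), e30,
      Int.toNat_natCast, hH'.pow n hnV, hN]
    push_cast
    rfl
  · refine ⟨fun c h1 h2 => (htab c h1 h2).congr e15, fun s hs h0 => ?_⟩
    exact absurd (horner_bounds hs).1 (not_le.2 (by exact_mod_cast h0))
  · rintro j τ hj hF h32 ⟨h1, h2⟩
    refine (runs_tableEntry (hH'.frame hF (by decide) (by decide)) hr
      ((hF.reg 29 (by decide)).trans e29) ((hF.reg 30 (by decide)).trans e30)
      ((hF.reg 31 (by decide)).trans e31) h32 hj h1).conseq ?_ le_rfl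
    rintro ρ - ⟨s', hs', hj', h15⟩
    refine ⟨fun c hc hcV s hs => ?_, fun s hs hlt => ?_⟩
    · obtain ⟨y, hy⟩ := Int.eq_ofNat_of_zero_le (horner_bounds hs).1
      have := h1 c hc hcV s hs
      rw [hy, toNat_address] at this ⊢
      rw [Store.setReg_arr, h15, Function.update_of_ne, this]
      intro he
      have := (address_injective hcV hr he).2
      omega
    · obtain ⟨y, hy⟩ := Int.eq_ofNat_of_zero_le (horner_bounds hs).1
      have h3 := h2 s hs
      rw [hy, toNat_address] at h3 ⊢
      rw [Store.setReg_arr, h15]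
      by_cases hyj : y = j
      · rw [hyj, Function.update_self]
        exact msg_congr (horner_injective hs' hs (by rw [hj', hy, hyj]))
      · rw [Function.update_of_ne]
        · exact h3 (by rw [hy] at hlt; push_cast at hlt; omega)
        · exact fun he => hyj (address_injective hr hr he).1
  · rintro τ hF ⟨h1, h2⟩
    have f30 : τ.reg 30 = n := (hF.reg 30 (by decide)).trans e30
    have f29 : τ.reg 29 = r := (hF.reg 29 (by decide)).trans e29
    have f27 : τ.reg 27 = z :=
      (hF.reg 27 (by decide)).trans ((hF'.reg 27 (by decide)).trans h27)
    have hdone : ∀ c, r ≤ c → c < D.V → D.TableDone c τ := by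
      intro c hc hcV
      rcases hc.eq_or_lt with rfl | hc
      · intro s hs
        refine h2 s hs ?_
        rw [hN]
        exact_mod_cast (horner_bounds hs).2
      · exact h1 c hc hcV
    refine Runs.block_end rfl ⟨fun c hc hcV => (hdone c hc hcV).congr ?_, ?_⟩ (by decide)
    · exact (Frame.apply (p := .ite (.reg 30) .skip (.set 27 (.reg 27 * .read 15 (.reg 29)))) rfl
        τ).arr 15 (by decide)
    · by_cases hS : D.S r = []
      · have h0 : n = 0 := by simp [hn, hS]
        have h3 := hdone r le_rfl hr 0 (by simp [hS])
        simp [horner, hS] at h3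
        simp [Program.apply, f30, h0, hS, f27, f29, h3]
      · have h0 : 0 < n := List.length_pos_iff.2 hS
        simp [Program.apply, f30, h0, hS, f27]
  · simp only [Finset.sum_const, Finset.card_range, smul_eq_mul, Expr.cost_read, Expr.cost_reg]
    linarith

theorem runs_eliminateAll {σ : Store} (h : D.Holds σ) :
    Runs eliminateAll σ (fun τ => τ.reg 27 =
      ∏ c ∈ (Finset.range D.V).filter (fun c => D.S c = []), D.msg c 0)
      (∑ r ∈ Finset.range D.V, 820 * 2 ^ (D.S r).length * ((D.S r).length + 1) *
        ((children D.V D.S r).length + 1) + 10) := by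
  unfold eliminateAll
  set k : ℕ → ℕ := fun r => 800 * 2 ^ (D.S r).length * ((D.S r).length + 1) *
    ((children D.V D.S r).length + 1) with hk
  refine Runs.block (c := ∑ j ∈ Finset.range D.V, (k (D.V - 1 - j) + 8) + 6) rfl ?_ ?_
  · set σ' := Program.apply _ σ with hσ'
    have hF' : Frame _ σ σ' := Frame.apply rfl σ
    have hH' := h.frame hF' (by decide) (by decide)
    refine (Runs.forLoop (n := D.V) (fun i τ =>
      (∀ c, D.V - i ≤ c → c < D.V → D.TableDone c τ) ∧ τ.reg 27 =
        ∏ c ∈ (Finset.Ico (D.V - i) D.V).filter (fun c => D.S c = []), D.msg c 0)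
      (fun i => k (D.V - 1 - i)) (by decide) ?_ ?_ ?_ le_rfl).conseq ?_ ?_
    · intro τ hF
      rw [Expr.eval_reg, hF.reg 3 (by decide), hH'.reg]
    · refine ⟨fun c h1 h2 => by omega, by simp [hσ', Program.apply]⟩
    · rintro i τ hi hF h28 ⟨h1, h2⟩
      refine (runs_eliminate (r := D.V - 1 - i) (hH'.frame hF (by decide) (by decide))
        (by omega) (by omega) h28 h2 (fun c hc hcV => h1 c (by omega) hcV)).conseq ?_ le_rfl
      rintro ρ - ⟨h3, h4⟩
      refine ⟨fun c hc hcV => (h3 c (by omega) hcV).congr (by simp), ?_⟩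
      have hIco : Finset.Ico (D.V - (i + 1)) D.V =
          insert (D.V - 1 - i) (Finset.Ico (D.V - i) D.V) := by
        ext c
        simp only [Finset.mem_Ico, Finset.mem_insert]
        omega
      rw [hIco, Finset.filter_insert]
      have hreg : (ρ.setReg 28 ((i : ℤ) + 1)).reg 27 = ρ.reg 27 := by simp
      rw [hreg, h4]
      split_ifs with hS
      · rw [Finset.prod_insert, mul_comm]
        simp only [Finset.mem_filter, Finset.mem_Ico]
        omega
      · rfl
    · rintro τ - ⟨-, h2⟩
      rw [h2, Nat.sub_self, Finset.range_eq_Ico]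
    · simp
  -- The loop visits the ranks downwards; reflection indexes the cost by rank. Raising 800 to 820
  -- pays for the 8 steps of loop control per round.
  · rw [Finset.sum_range_reflect (fun r => k r + 8) D.V]
    have : ∑ r ∈ Finset.range D.V, (k r + 8) ≤ ∑ r ∈ Finset.range D.V,
        820 * 2 ^ (D.S r).length * ((D.S r).length + 1) *
        ((children D.V D.S r).length + 1) := by
      refine Finset.sum_le_sum fun r _ => ?_
      have : 1 ≤ 2 ^ (D.S r).length * ((D.S r).length + 1) *
        ((children D.V D.S r).length + 1) :=
        Nat.mul_pos (Nat.mul_pos (by positivity) (by omega)) (by omega)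
      simp only [hk]
      linarith
    change 2 + _ ≤ _
    omega

end EliminationData
end ModelCounting

namespace ModelCounting

open Algo

/-! ### Powers of two and the final division -/

theorem runs_powers {σ : Store} {V : ℕ} (h3 : σ.reg 3 = V) (h0 : σ.arr 16 0 = 1) :
    Runs powers σ (fun τ => ∀ i ≤ V, τ.arr 16 i = 2 ^ i) (20 * (V + 1)) := by
  refine (Runs.forLoop (n := V) (fun j τ => ∀ i ≤ j, τ.arr 16 i = 2 ^ i) (fun _ => 10)
    (by decide) ?_ ?_ ?_ ?_).conseq (fun _ _ h => h) le_rfl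
  · intro τ hF
    rw [Expr.eval_reg, hF.reg 3 (by decide), h3]
  · intro i hi
    obtain rfl : i = 0 := by omega
    simpa using h0
  · intro j τ hj hF h6 hI
    refine Runs.block_end rfl (fun i hi => ?_) (by decide)
    have hj1 : ((j : ℤ) + 1).toNat = j + 1 := by omega
    by_cases hij : i = j + 1
    · simp [Program.apply, h6, hj1, hI j le_rfl, hij, pow_succ, mul_comm]
    · simp [Program.apply, h6, hj1, hij, hI i (by omega)]
  · simp
    omega

/-- The binary digits of `N` are read off from `2^x * N` by comparison with `2^(e + x)` for `e = n,
..., 0`. The invariant has a remainder `m`: `N - m` is already output and `2^x * m` is left. Since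
`N = 2^n` is possible, `n + 1` digits are needed. -/
theorem runs_divide {σ : Store} {V n x N : ℕ} (h1 : σ.reg 1 = n) (h11 : σ.reg 11 = x)
    (hV : n + x ≤ V) (h16 : ∀ i ≤ V, σ.arr 16 i = 2 ^ i) (h27 : σ.reg 27 = 2 ^ x * N)
    (h0 : σ.reg 0 = 0) (hN : N ≤ 2 ^ n) :
    Runs divide σ (fun τ => τ.reg 0 = N) (60 * (n + 2)) := by
  refine (Runs.forLoop (n := n + 1) (fun i τ => ∃ m : ℕ, m < 2 ^ (n + 1 - i) ∧
    τ.reg 0 = N - m ∧ τ.reg 27 = 2 ^ x * m) (fun _ => 40)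
    (by decide) ?_ ?_ ?_ ?_).conseq ?_ le_rfl
  · intro τ hF
    simp [hF.reg 1 (by decide), h1]
  · refine ⟨N, ?_, by simp [h0], by simp [h27]⟩
    rw [Nat.sub_zero, pow_succ]
    have : 0 < 2 ^ n := by positivity
    omega
  · rintro i τ hi hF h46 ⟨m, hm, hm0, hm27⟩
    have e1 : τ.reg 1 = n := (hF.reg 1 (by decide)).trans h1
    have e11 : τ.reg 11 = x := (hF.reg 11 (by decide)).trans h11
    have e16 := hF.arr 16 (by decide)
    obtain ⟨e, he⟩ : ∃ e, e + i = n := ⟨n - i, by omega⟩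
    have hne : (n : ℤ) - i = e := by omega
    have p1 : τ.arr 16 e = 2 ^ e := by rw [e16]; exact h16 e (by omega)
    have p2 : τ.arr 16 (e + x) = 2 ^ x * 2 ^ e := by
      rw [e16, h16 (e + x) (by omega), pow_add, mul_comm]
    have hpow : n + 1 - i = e + 1 := by omega
    have hpow' : n + 1 - (i + 1) = e := by omega
    have hx : (0 : ℤ) < 2 ^ x := by positivity
    have hcast : ((e : ℤ) + x).toNat = e + x := by omega
    rw [hpow, pow_succ] at hm
    refine Runs.block (c := 30) rfl ?_ (by decide) (p := .set 47 _)
    refine Runs.block_end rfl ?_ (by decide)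
    by_cases hc : 2 ^ e ≤ m
    · have hc' : (0 : ℤ) < 2 ^ x * m - 2 ^ x * 2 ^ e + 1 := by
        have : (2 : ℤ) ^ e ≤ m := by exact_mod_cast hc
        nlinarith
      refine ⟨m - 2 ^ e, by rw [hpow']; omega, ?_, ?_⟩
      · simp [Program.apply, e1, h46, e11, hne, hcast, p1, p2, hm27, hm0, -Int.sub_pos, hc']
        rw [Nat.cast_sub hc]
        push_cast
        ring
      · simp [Program.apply, e1, h46, e11, hne, hcast, p1, p2, hm27, hm0, -Int.sub_pos, hc']
        rw [Nat.cast_sub hc]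
        push_cast
        ring
    · have hc' : ¬ (0 : ℤ) < 2 ^ x * m - 2 ^ x * 2 ^ e + 1 := by
        have : (m : ℤ) + 1 ≤ 2 ^ e := by exact_mod_cast not_le.1 hc
        nlinarith
      refine ⟨m, by rw [hpow']; omega, ?_, ?_⟩
      · simp [Program.apply, e1, h46, e11, hne, hcast, p2, hm27, hm0, hc']
      · simp [Program.apply, e1, h46, e11, hne, hcast, p2, hm27, hc']
  · simp
    omega
  · rintro τ - ⟨m, hm, hm0, -⟩
    simp at hm
    simp [hm0, hm]

/-! ### Reading the input -/

/-- The array `0` holds the input word `w`. -/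
def HasInput (w : List ℕ) (σ : Store) : Prop := ∀ i, σ.arr 0 i = (w.getD i 0 : ℕ)

theorem HasInput.frame {w : List ℕ} {σ τ : Store} {p : Program} (h : HasInput w σ)
    (hF : Frame p σ τ) (h0 : 0 ∉ p.arrs) : HasInput w τ := fun i => by rw [hF.arr 0 h0, h i]

theorem HasInput.read {w l r : List ℕ} {σ : Store} (h : HasInput w σ) {p : ℕ}
    (hp : w.drop p = l ++ r) {i : ℕ} (hi : i < l.length) : σ.arr 0 (p + i) = l[i] := by
  have h1 : (w.drop p)[i]? = l[i]? := by rw [hp, List.getElem?_append_left hi]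
  rw [List.getElem?_drop, List.getElem?_eq_getElem hi] at h1
  rw [h, List.getD_eq_getElem?_getD, h1, Option.getD_some]

theorem drop_of_drop_eq_append {w l r : List ℕ} {p : ℕ} (hp : w.drop p = l ++ r) :
    w.drop (p + l.length) = r := by
  rw [← List.drop_drop, hp, List.drop_left]

theorem runs_markLoop {w l r : List ℕ} {σ : Store} {a len p V c : ℕ} {z : ℤ} (ha : a ≠ 0)
    (hlen : len ∉ [10, 4, 10]) (h : HasInput w σ) (hp : w.drop p = l ++ r) (h4 : σ.reg 4 = p)
    (hl : σ.reg len = l.length) (h3 : σ.reg 3 = V) (h8 : σ.reg 8 = c) (hc : c < V) :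
    Runs (markLoop a len z) σ (fun τ => τ.reg 4 = (p + l.length : ℕ) ∧ ∀ x y, y < V →
      τ.arr a (x * V + y) = if y = c ∧ x ∈ l then z else σ.arr a (x * V + y))
      (30 * (l.length + 1)) := by
  refine (Runs.forLoop (n := l.length) (fun i τ => τ.reg 4 = (p + i : ℕ) ∧ ∀ x y, y < V →
      τ.arr a (x * V + y) = if y = c ∧ x ∈ l.take i then z else σ.arr a (x * V + y))
      (fun _ => 15) (by decide : 10 ∉ [4]) ?_ ?_ ?_ ?_).conseq ?_ le_rfl
  · intro τ hF
    rw [Expr.eval_reg, hF.reg len hlen, hl]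
  · simp [h4]
  · rintro i τ hi hF h10 ⟨hI4, hI⟩
    have e3 : τ.reg 3 = V := (hF.reg 3 (by change 3 ∉ [10, 4, 10]; decide)).trans h3
    have e8 : τ.reg 8 = c := (hF.reg 8 (by change 8 ∉ [10, 4, 10]; decide)).trans h8
    have h0 := (h.frame hF (by change 0 ∉ [a]; simpa using ha.symm)).read hp hi
    refine Runs.block_end rfl ⟨?_, fun x y hy => ?_⟩ (Nat.le_of_ble_eq_true rfl)
    · simp [Program.apply, hI4]
      omega
    · have htake : x ∈ l.take (i + 1) ↔ x ∈ l.take i ∨ x = l[i] := by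
        rw [← List.take_append_getElem hi, List.mem_append, List.mem_singleton]
      simp only [Program.apply, hI4, e3, e8, htake, Store.setReg_arr, Store.setCell_arr,
        Expr.eval_add, Expr.eval_mul, Expr.eval_reg, Expr.eval_read, Expr.eval_const,
        Int.toNat_natCast, h0, toNat_address, if_true, Function.update_apply]
      by_cases he : x * V + y = l[i] * V + c
      · obtain ⟨h1, h2⟩ := address_injective hy hc he
        simp [h1, h2]
      · have : ¬ (y = c ∧ x = l[i]) := fun hh => he (by rw [hh.1, hh.2])
        rw [if_neg he, hI x y hy]
        congr 1
        simp only [eq_iff_iff]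
        tauto
  · simp
    omega
  · rintro τ - ⟨k1, k2⟩
    rw [List.take_length] at k2
    exact ⟨k1, k2⟩

end ModelCounting

namespace ModelCounting

open Algo

/-! ### Reading the system -/

theorem mem_encodeFinset {n : ℕ} {s : Finset (Fin n)} {v : ℕ} :
    v ∈ encodeFinset s ↔ ∃ h : v < n, (⟨v, h⟩ : Fin n) ∈ s := by
  simp only [encodeFinset, List.mem_map, Finset.mem_sort]
  constructor
  · rintro ⟨x, hx, rfl⟩
    exact ⟨x.2, hx⟩
  · rintro ⟨h, hx⟩
    exact ⟨_, hx, rfl⟩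

theorem length_encodeFinset {n : ℕ} (s : Finset (Fin n)) : (encodeFinset s).length = s.card := by
  simp [encodeFinset]

theorem nodup_encodeFinset {n : ℕ} (s : Finset (Fin n)) : (encodeFinset s).Nodup :=
  (Finset.sort_nodup _ _).map Fin.val_injective

/-! ### Interaction coefficients of a single constraint. -/

namespace Constraint

variable {n : ℕ}

/-- The coefficient of a constraint and the value `true` of the variable `x`. -/
def coefA : Constraint n → ℕ → ℤ
  | .clause pos _, x => if x ∈ encodeFinset pos then -1 else 0
  | .xor vars _, x => if x ∈ encodeFinset vars then -2 else 0

/-- The coefficient of a constraint and the value `false` of the variable `x`. -/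
def coefB : Constraint n → ℕ → ℤ
  | .clause _ neg, x => if x ∈ encodeFinset neg then -1 else 0
  | .xor _ _, _ => 0

/-- The coefficient of a constraint itself. -/
def coefSelf : Constraint n → ℤ
  | .clause _ _ => -2
  | .xor _ rhs => -2 * rhs.toNat

/-- Whether a constraint is an XOR constraint. -/
def isXor : Constraint n → Bool
  | .clause _ _ => false
  | .xor _ _ => true

end Constraint

/-- Only cells of the column `n + j` are written, and that column is still zero. So the time is
linear in the encoding of the constraint, not in the number of matrix cells. -/
theorem runs_parseConstraint {w r : List ℕ} {σ : Store} {n p V j X : ℕ} (c : Constraint n)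
    (h : HasInput w σ) (hp : w.drop p = c.encode ++ r) (h1 : σ.reg 1 = n) (h3 : σ.reg 3 = V)
    (h4 : σ.reg 4 = p) (h7 : σ.reg 7 = j) (h11 : σ.reg 11 = X) (hj : n + j < V)
    (hA : ∀ x, σ.arr 1 (x * V + (n + j)) = 0) (hB : ∀ x, σ.arr 2 (x * V + (n + j)) = 0) :
    Runs parseConstraint σ (fun τ => τ.reg 4 = (p + c.encode.length : ℕ) ∧
      τ.reg 11 = (X + c.isXor.toNat : ℕ) ∧
      (∀ x y, y < V → τ.arr 1 (x * V + y) = if y = n + j then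
        (if x = n + j then c.coefSelf else c.coefA x) else σ.arr 1 (x * V + y)) ∧
      (∀ x y, y < V → τ.arr 2 (x * V + y) = if y = n + j then c.coefB x
        else σ.arr 2 (x * V + y))) (60 * (c.encode.length + 1)) := by
  -- The number of a constraint vertex is not that of a variable, so marking the variables leaves
  -- the diagonal entry alone.
  have hC : ∀ (l : List ℕ), (∀ x ∈ l, x < n) → n + j ∉ l := fun l hl hx => by
    have := hl _ hx
    omega
  have hlt : ∀ (s : Finset (Fin n)), ∀ x ∈ encodeFinset s, x < n := fun s x hx =>
    (mem_encodeFinset.1 hx).1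
  refine Runs.block (c := 60 * c.encode.length + 30) rfl ?_ (by change 4 + _ ≤ _; omega)
  set σ₁ := Program.apply _ σ with hσ₁
  have hF₁ : Frame _ σ σ₁ := Frame.apply rfl σ
  have hI₁ := h.frame hF₁ (by decide)
  have a8 : σ₁.reg 8 = (n + j : ℕ) := by simp [hσ₁, Program.apply, h1, h7]
  have a3 : σ₁.reg 3 = V := (hF₁.reg 3 (by decide)).trans h3
  have a4 : σ₁.reg 4 = p := (hF₁.reg 4 (by decide)).trans h4
  have a11 : σ₁.reg 11 = X := (hF₁.reg 11 (by decide)).trans h11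
  have aA : σ₁.arr 1 = σ.arr 1 := hF₁.arr 1 (by decide)
  have aB : σ₁.arr 2 = σ.arr 2 := hF₁.arr 2 (by decide)
  have t1 : ((p : ℤ) + 1).toNat = p + 1 := by omega
  have t2 : ((p : ℤ) + 2).toNat = p + 2 := by omega
  cases c with
  | xor vars rhs =>
    have hlen : (Constraint.xor vars rhs).encode.length = 3 + (encodeFinset vars).length := by
      simp [Constraint.encode]
      omega
    have i0 : σ₁.arr 0 p = 1 := by
      simpa [Constraint.encode] using hI₁.read hp (i := 0) (by simp [Constraint.encode])
    have i1 : σ₁.arr 0 (p + 1) = rhs.toNat := by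
      simpa [Constraint.encode] using hI₁.read hp (i := 1) (by simp [Constraint.encode])
    have i2 : σ₁.arr 0 (p + 2) = (encodeFinset vars).length := by
      simpa [Constraint.encode, length_encodeFinset] using
        hI₁.read hp (i := 2) (by simp [Constraint.encode])
    refine Runs.ite (c := 60 * (encodeFinset vars).length + 100) (fun _ => ?_)
      (fun hb => absurd hb (by simp [a4, i0])) (by rw [hlen]; change 3 + _ ≤ _; omega)
    refine Runs.block (c := 30 * (encodeFinset vars).length + 30) rfl ?_
      ((Nat.add_le_add_right (by decide : _ ≤ 40) _).trans (by omega))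
    set σ₂ := Program.apply _ σ₁ with hσ₂
    have hF₂ : Frame _ σ₁ σ₂ := Frame.apply rfl σ₁
    have b4 : σ₂.reg 4 = (p + 3 : ℕ) := by simp [hσ₂, Program.apply, a4]
    have b9 : σ₂.reg 9 = (encodeFinset vars).length := by
      simp [hσ₂, Program.apply, a4, t2, i2]
    have b11 : σ₂.reg 11 = (X + 1 : ℕ) := by simp [hσ₂, Program.apply, a11]
    have b1 : σ₂.arr 1 = Function.update (σ.arr 1) ((n + j) * V + (n + j)) (-(2 * rhs.toNat)) := by
      simp only [hσ₂, Program.apply, a8, a3, a4, t1, i1, aA, Expr.eval_add, Expr.eval_mul,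
        Expr.eval_reg, toNat_address, Store.setReg_arr, Store.setCell_arr, if_true,
        Expr.eval_read, Expr.eval_sub, Expr.eval_one, Expr.eval_zero, Expr.eval_ofNat, zero_sub]
    have hp' : w.drop (p + 3) = encodeFinset vars ++ r := by
      rw [← List.drop_drop, hp]
      simp [Constraint.encode]
    refine (runs_markLoop (by decide) (by decide) (hI₁.frame hF₂ (by decide)) hp' b4 b9
      ((hF₂.reg 3 (by decide)).trans a3) ((hF₂.reg 8 (by decide)).trans a8) hj).conseq ?_
      (by omega)
    rintro τ hF ⟨k1, k2⟩
    refine ⟨?_, ?_, fun x y hy => ?_, fun x y hy => ?_⟩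
    · rw [k1, hlen]; congr 1; omega
    · rw [hF.reg 11 (by decide), b11]; rfl
    · rw [k2 x y hy, b1]
      by_cases hyj : y = n + j
      · subst hyj
        by_cases hx : x = n + j
        · subst hx
          simp [hC _ (hlt vars), Constraint.coefSelf]
        · rw [Function.update_of_ne (fun he => hx (address_injective hj hj he).1), hA]
          simp [hx, Constraint.coefA]
      · rw [Function.update_of_ne (fun he => hyj (address_injective hy hj he).2)]
        simp [hyj]
    · rw [hF.arr 2 (by decide), hF₂.arr 2 (by decide), aB]
      split_ifs with hyj
      · rw [hyj, hB]; rfl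
      · rfl
  | clause pos neg =>
    have hlen : (Constraint.clause pos neg).encode.length =
        3 + (encodeFinset pos).length + (encodeFinset neg).length := by
      simp [Constraint.encode]
      omega
    have i0 : σ₁.arr 0 p = 0 := by
      simpa [Constraint.encode] using hI₁.read hp (i := 0) (by simp [Constraint.encode])
    have i1 : σ₁.arr 0 (p + 1) = (encodeFinset pos).length := by
      simpa [Constraint.encode, length_encodeFinset] using
        hI₁.read hp (i := 1) (by simp [Constraint.encode])
    have i2 : σ₁.arr 0 (p + 2) = (encodeFinset neg).length := by
      simpa [Constraint.encode, length_encodeFinset] using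
        hI₁.read hp (i := 2) (by simp [Constraint.encode])
    refine Runs.ite (c := 60 * (encodeFinset pos).length + 60 * (encodeFinset neg).length + 150)
      (fun hb => absurd hb (by simp [a4, i0])) (fun _ => ?_)
      (by rw [hlen]; change 3 + _ ≤ _; omega)
    refine Runs.block (c := 60 * (encodeFinset pos).length + 60 * (encodeFinset neg).length + 110)
      rfl ?_ ((Nat.add_le_add_right (by decide : _ ≤ 40) _).trans (by omega))
    set σ₂ := Program.apply _ σ₁ with hσ₂
    have hF₂ : Frame _ σ₁ σ₂ := Frame.apply rfl σ₁
    have b4 : σ₂.reg 4 = (p + 3 : ℕ) := by simp [hσ₂, Program.apply, a4]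
    have b9 : σ₂.reg 9 = (encodeFinset pos).length := by
      simp [hσ₂, Program.apply, a4, t1, i1]
    have b12 : σ₂.reg 12 = (encodeFinset neg).length := by
      simp [hσ₂, Program.apply, a4, t2, i2]
    have b1 : σ₂.arr 1 = Function.update (σ.arr 1) ((n + j) * V + (n + j)) (-2) := by
      simp only [hσ₂, Program.apply, a8, a3, aA, Expr.eval_add, Expr.eval_mul,
        Expr.eval_reg, toNat_address, Store.setReg_arr, Store.setCell_arr, if_true,
        Expr.eval_sub, Expr.eval_zero, Expr.eval_ofNat, zero_sub]
    have hp' : w.drop (p + 3) = encodeFinset pos ++ (encodeFinset neg ++ r) := by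
      rw [← List.drop_drop, hp]
      simp [Constraint.encode]
    have hI₂ := hI₁.frame hF₂ (by decide)
    refine (runs_markLoop (by decide) (by decide) hI₂ hp' b4 b9
      ((hF₂.reg 3 (by decide)).trans a3) ((hF₂.reg 8 (by decide)).trans a8) hj).seq
      (d := 30 * (encodeFinset neg).length + 30) ?_ (by omega)
    rintro τ hF ⟨k1, k2⟩
    have hp'' := drop_of_drop_eq_append hp'
    refine (runs_markLoop (by decide) (by decide) (hI₂.frame hF (by decide)) hp'' k1
      ((hF.reg 12 (by decide)).trans b12)
      ((hF.reg 3 (by decide)).trans ((hF₂.reg 3 (by decide)).trans a3))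
      ((hF.reg 8 (by decide)).trans ((hF₂.reg 8 (by decide)).trans a8)) hj).conseq ?_
      (by omega)
    rintro ρ hF' ⟨m1, m2⟩
    refine ⟨?_, ?_, fun x y hy => ?_, fun x y hy => ?_⟩
    · rw [m1, hlen]; congr 1; omega
    · rw [hF'.reg 11 (by decide), hF.reg 11 (by decide), hF₂.reg 11 (by decide), a11]; rfl
    · rw [hF'.arr 1 (by decide), k2 x y hy, b1]
      by_cases hyj : y = n + j
      · subst hyj
        by_cases hx : x = n + j
        · subst hx
          simp [hC _ (hlt pos), Constraint.coefSelf]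
        · rw [Function.update_of_ne (fun he => hx (address_injective hj hj he).1), hA]
          simp [hx, Constraint.coefA]
      · rw [Function.update_of_ne (fun he => hyj (address_injective hy hj he).2)]
        simp [hyj]
    · rw [m2 x y hy, hF.arr 2 (by decide), hF₂.arr 2 (by decide), aB]
      by_cases hyj : y = n + j
      · subst hyj
        simp [hB, Constraint.coefB]
      · simp [hyj]

/-! ### Interaction matrices of a system. -/

namespace ConstraintSystem

variable (F : ConstraintSystem)

/-- The matrix of the interactions between `true` and the constraints. -/
def matA (x y : ℕ) : ℤ :=
  if h : F.numVars ≤ y ∧ y < F.numVars + F.numCons then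
    if x = y then (F.con ⟨y - F.numVars, by omega⟩).coefSelf
    else (F.con ⟨y - F.numVars, by omega⟩).coefA x
  else 0

/-- The matrix of the interactions between `false` and the constraints. -/
def matB (x y : ℕ) : ℤ :=
  if h : F.numVars ≤ y ∧ y < F.numVars + F.numCons then
    (F.con ⟨y - F.numVars, by omega⟩).coefB x
  else 0

/-- The number of XOR constraints. -/
def numXor : ℕ := ∑ j, (F.con j).isXor.toNat

end ConstraintSystem

theorem runs_parseSystem {F : ConstraintSystem} {w r : List ℕ} {σ : Store} {p : ℕ}
    (h : HasInput w σ)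
    (hp : w.drop p = ((List.finRange F.numCons).flatMap fun j => (F.con j).encode) ++ r)
    (h1 : σ.reg 1 = F.numVars) (h2 : σ.reg 2 = F.numCons)
    (h3 : σ.reg 3 = (F.numVars + F.numCons : ℕ)) (h4 : σ.reg 4 = p) (h11 : σ.reg 11 = 0)
    (hA : ∀ i, σ.arr 1 i = 0) (hB : ∀ i, σ.arr 2 i = 0) :
    Runs parseSystem σ (fun τ => (∃ q : ℕ, τ.reg 4 = q ∧ w.drop q = r) ∧ τ.reg 11 = F.numXor ∧
      (∀ x y, y < F.numVars + F.numCons →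
        τ.arr 1 (x * (F.numVars + F.numCons) + y) = F.matA x y) ∧
      (∀ x y, y < F.numVars + F.numCons →
        τ.arr 2 (x * (F.numVars + F.numCons) + y) = F.matB x y))
      (∑ j, 70 * ((F.con j).encode.length + 1) + 10) := by
  set V := F.numVars + F.numCons with hV
  set n := F.numVars with hn
  let X : ℕ → ℕ := fun i => if h : i < F.numCons then (F.con ⟨i, h⟩).isXor.toNat else 0
  let k : ℕ → ℕ := fun i =>
    if h : i < F.numCons then 60 * ((F.con ⟨i, h⟩).encode.length + 1) else 0
  have hX : F.numXor = ∑ i ∈ Finset.range F.numCons, X i := by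
    rw [Finset.sum_range]
    exact Finset.sum_congr rfl fun j _ => by simp [X]
  -- After `i` constraints the columns below `n + i` are final and the later ones are zero; columns
  -- of variables are zero in both matrices.
  refine (Runs.forLoop (n := F.numCons) (fun i τ => (∃ q : ℕ, τ.reg 4 = q ∧
      w.drop q = (((List.finRange F.numCons).drop i).flatMap fun j => (F.con j).encode) ++ r) ∧
      τ.reg 11 = (∑ l ∈ Finset.range i, X l : ℕ) ∧
      (∀ x y, y < V → τ.arr 1 (x * V + y) = if y < n + i then F.matA x y else 0) ∧
      (∀ x y, y < V → τ.arr 2 (x * V + y) = if y < n + i then F.matB x y else 0))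
      k (by decide) ?_ ?_ ?_ le_rfl).conseq ?_ ?_
  · intro τ hF
    rw [Expr.eval_reg, hF.reg 2 (by decide), h2]
  · refine ⟨⟨p, by simpa using h4, by simpa using hp⟩, by simpa using h11, fun x y hy => ?_,
      fun x y hy => ?_⟩
    · simp [hA, ConstraintSystem.matA]
      omega
    · simp [hB, ConstraintSystem.matB]
      omega
  · rintro i τ hi hF h7 ⟨⟨q, hq4, hq⟩, hI11, hIA, hIB⟩
    have hcons : (List.finRange F.numCons).drop i =
        ⟨i, hi⟩ :: (List.finRange F.numCons).drop (i + 1) := by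
      rw [List.drop_eq_getElem_cons (by simpa using hi)]
      simp
    rw [hcons, List.flatMap_cons, List.append_assoc] at hq
    have hk : k i = 60 * ((F.con ⟨i, hi⟩).encode.length + 1) := by simp [k, hi]
    rw [hk]
    have hadd : n + i < V := by omega
    refine (runs_parseConstraint (F.con ⟨i, hi⟩) (h.frame hF (by decide)) hq
      ((hF.reg 1 (by decide)).trans h1) ((hF.reg 3 (by decide)).trans h3) hq4 h7 hI11 hadd
      (fun x => by rw [hIA x _ hadd]; simp) (fun x => by rw [hIB x _ hadd]; simp)).conseq ?_ le_rfl
    rintro ρ - ⟨k1, k2, k3, k4⟩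
    refine ⟨⟨_, by simpa using k1, drop_of_drop_eq_append hq⟩, ?_, fun x y hy => ?_,
      fun x y hy => ?_⟩
    · simp only [Store.setReg_reg, Finset.sum_range_succ]
      simp [k2, X, hi]
    · rw [Store.setReg_arr, k3 x y hy]
      by_cases hyi : y = n + i
      · subst hyi
        simp [ConstraintSystem.matA, ← hn, hi]
      · rw [if_neg hyi, hIA x y hy]
        have : y < n + i ↔ y < n + (i + 1) := by omega
        simp only [this]
    · rw [Store.setReg_arr, k4 x y hy]
      by_cases hyi : y = n + i
      · subst hyi
        simp [ConstraintSystem.matB, ← hn, hi]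
      · rw [if_neg hyi, hIB x y hy]
        have : y < n + i ↔ y < n + (i + 1) := by omega
        simp only [this]
  · rintro τ - ⟨⟨q, hq4, hq⟩, hI11, hIA, hIB⟩
    refine ⟨⟨q, hq4, ?_⟩, by rw [hI11, hX], fun x y hy => ?_, fun x y hy => ?_⟩
    · rw [hq, List.drop_of_length_le (by simp)]
      rfl
    · rw [hIA x y hy, if_pos hy]
    · rw [hIB x y hy, if_pos hy]
  · rw [Finset.sum_range]
    have : ∑ j : Fin F.numCons, (k j + (Expr.cost (.reg 2) + 7)) ≤
        ∑ j, 70 * ((F.con j).encode.length + 1) := by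
      refine Finset.sum_le_sum fun j _ => ?_
      simp [k]
      omega
    simp only [Expr.cost_reg] at this ⊢
    omega

end ModelCounting

namespace ModelCounting

open Algo

/-! ### Search orders -/

/-- Append `u` unless it is already there. -/
def visit (o : List ℕ) (u : ℕ) : List ℕ := if u ∈ o then o else o ++ [u]

/-- Append the new elements of `l`. -/
def visitAll (o l : List ℕ) : List ℕ := l.foldl visit o

theorem prefix_visit (o : List ℕ) (u : ℕ) : o <+: visit o u := by
  unfold visit
  split_ifs
  · exact List.prefix_rfl
  · exact List.prefix_append _ _

theorem prefix_visitAll (o l : List ℕ) : o <+: visitAll o l := by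
  induction l generalizing o with
  | nil => exact List.prefix_rfl
  | cons u l ih => exact (prefix_visit o u).trans (ih _)

theorem mem_visitAll {o l : List ℕ} {x : ℕ} : x ∈ visitAll o l ↔ x ∈ o ∨ x ∈ l := by
  induction l generalizing o with
  | nil => simp [visitAll]
  | cons u l ih =>
    change x ∈ visitAll (visit o u) l ↔ _
    rw [ih]
    unfold visit
    split_ifs with h
    · simp only [List.mem_cons]
      constructor
      · tauto
      · rintro (h' | rfl | h') <;> tauto
    · simp only [List.mem_append, List.mem_cons, List.not_mem_nil, or_false]
      tauto

theorem nodup_visitAll {o : List ℕ} (l : List ℕ) (h : o.Nodup) : (visitAll o l).Nodup := by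
  induction l generalizing o with
  | nil => exact h
  | cons u l ih =>
    refine ih ?_
    unfold visit
    split_ifs with hu
    · exact h
    · exact List.nodup_append.2 ⟨h, by simp, fun a ha b hb => by
        rw [List.mem_singleton.1 hb]
        exact ne_of_mem_of_not_mem ha hu⟩

theorem visitAll_take_succ {o l : List ℕ} {i : ℕ} (h : i < l.length) :
    visitAll o (l.take (i + 1)) = visit (visitAll o (l.take i)) l[i] := by
  rw [← List.take_append_getElem h, visitAll, List.foldl_append]
  rfl

theorem _root_.List.IsPrefix.getD_eq {l l' : List ℕ} (h : l <+: l') {i : ℕ} (hi : i < l.length) :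
    l'.getD i 0 = l.getD i 0 := by
  obtain ⟨r, rfl⟩ := h
  rw [List.getD_append _ _ _ _ hi]

/-! ### Breadth-first search as a growing list. -/

section SearchOrder

variable (nbr : ℕ → List ℕ)

/-- The nodes found after `h` steps of a breadth-first search. -/
def found : ℕ → List ℕ
  | 0 => [0]
  | h + 1 => visitAll (found h) (nbr ((found h).getD h 0))

variable {nbr} {N : ℕ} (hN : 0 < N) (hnbr : ∀ t < N, ∀ u ∈ nbr t, u < N)

theorem found_prefix {i j : ℕ} (h : i ≤ j) : found nbr i <+: found nbr j := by
  induction j, h using Nat.le_induction with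
  | base => exact List.prefix_rfl
  | succ j _ ih => exact ih.trans (prefix_visitAll _ _)

theorem found_nodup (h : ℕ) : (found nbr h).Nodup := by
  induction h with
  | zero => simp [found]
  | succ h ih => exact nodup_visitAll _ ih

theorem zero_mem_found (h : ℕ) : 0 ∈ found nbr h :=
  (found_prefix (Nat.zero_le h)).subset (by simp [found])

theorem getD_mem_or (l : List ℕ) (i : ℕ) : l.getD i 0 ∈ l ∨ l.getD i 0 = 0 := by
  by_cases h : i < l.length
  · exact Or.inl (by rw [List.getD_eq_getElem _ _ h]; exact List.getElem_mem h)
  · exact Or.inr (List.getD_eq_default _ _ (by omega))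

include hN hnbr in
theorem found_lt (h : ℕ) : ∀ t ∈ found nbr h, t < N := by
  induction h with
  | zero => simpa [found] using hN
  | succ h ih =>
    intro t ht
    rcases mem_visitAll.1 ht with ht | ht
    · exact ih t ht
    · refine hnbr _ ?_ t ht
      rcases getD_mem_or (found nbr h) h with h' | h'
      · exact ih _ h'
      · omega

include hN hnbr in
theorem found_length_le (h : ℕ) : (found nbr h).length ≤ N := by
  have h1 : (found nbr h).toFinset ⊆ Finset.range N := fun t ht =>
    Finset.mem_range.2 (found_lt hN hnbr h t (List.mem_toFinset.1 ht))
  have h2 := Finset.card_le_card h1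
  rwa [List.toFinset_card_of_nodup (found_nodup h), Finset.card_range] at h2

variable (hconn : ∀ C : ℕ → Prop, C 0 → (∀ t < N, C t → ∀ u ∈ nbr t, C u) → ∀ t < N, C t)

-- The queue does not run dry early. If the head reached its end, all nodes found would be expanded,
-- so the found nodes would contain 0 and be closed under neighbours; by `hconn` they would be all
-- `N` nodes, although fewer than `N` steps were made.
include hconn in
theorem found_closed {h : ℕ} (hh : h ≤ N) : h ≤ (found nbr h).length ∧
    ∀ i < h, ∀ u ∈ nbr ((found nbr h).getD i 0), u ∈ found nbr h := by
  induction h with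
  | zero => simp
  | succ h ih =>
    obtain ⟨h1, h2⟩ := ih (by omega)
    have hlt : h < (found nbr h).length := by
      by_contra hcon
      have hall : ∀ t < N, t ∈ found nbr h := by
        refine hconn _ (zero_mem_found h) fun t _ ht u hu => ?_
        obtain ⟨i, hi, rfl⟩ := List.getElem_of_mem ht
        refine h2 i (by omega) u ?_
        rwa [List.getD_eq_getElem _ _ hi]
      have h3 : Finset.range N ⊆ (found nbr h).toFinset := fun t ht =>
        List.mem_toFinset.2 (hall t (Finset.mem_range.1 ht))
      have h4 := Finset.card_le_card h3
      rw [List.toFinset_card_of_nodup (found_nodup h), Finset.card_range] at h4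
      omega
    have hpre : found nbr h <+: found nbr (h + 1) := found_prefix (Nat.le_succ h)
    refine ⟨hlt.trans_le hpre.length_le, fun i hi u hu => ?_⟩
    rw [hpre.getD_eq (by omega)] at hu
    rcases Nat.lt_succ_iff_lt_or_eq.1 hi with hi | rfl
    · exact hpre.subset (h2 i hi u hu)
    · exact mem_visitAll.2 (Or.inr hu)

include hconn in
theorem lt_length_found {h : ℕ} (hh : h < N) : h < (found nbr h).length := by
  obtain ⟨h1, h2⟩ := found_closed hconn hh.le
  by_contra hcon
  have hall : ∀ t < N, t ∈ found nbr h := by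
    refine hconn _ (zero_mem_found h) fun t _ ht u hu => ?_
    obtain ⟨i, hi, rfl⟩ := List.getElem_of_mem ht
    refine h2 i (by omega) u ?_
    rwa [List.getD_eq_getElem _ _ hi]
  have h3 : Finset.range N ⊆ (found nbr h).toFinset := fun t ht =>
    List.mem_toFinset.2 (hall t (Finset.mem_range.1 ht))
  have h4 := Finset.card_le_card h3
  rw [List.toFinset_card_of_nodup (found_nodup h), Finset.card_range] at h4
  omega

variable (nbr N) in
/-- The search order of the nodes. -/
def searchOrder (i : ℕ) : ℕ := (found nbr N).getD i 0

include hN hnbr hconn in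
theorem length_found : (found nbr N).length = N :=
  le_antisymm (found_length_le hN hnbr N) (found_closed hconn le_rfl).1

theorem searchOrder_eq {h i : ℕ} (hh : h ≤ N) (hi : i < (found nbr h).length) :
    (found nbr h)[i] = searchOrder nbr N i := by
  rw [searchOrder, (found_prefix hh).getD_eq hi, List.getD_eq_getElem _ _ hi]

include hN hnbr hconn in
theorem searchOrder_lt {i : ℕ} (hi : i < N) : searchOrder nbr N i < N := by
  have hi' : i < (found nbr N).length := (length_found hN hnbr hconn).symm ▸ hi
  rw [← searchOrder_eq le_rfl hi']
  exact found_lt hN hnbr N _ (List.getElem_mem hi')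

include hN hnbr hconn in
theorem searchOrder_injOn : Set.InjOn (searchOrder nbr N) (Set.Iio N) := by
  intro i hi j hj h
  have hl := length_found hN hnbr hconn
  have hi' : i < (found nbr N).length := hl.symm ▸ hi
  have hj' : j < (found nbr N).length := hl.symm ▸ hj
  rw [← searchOrder_eq le_rfl hi', ← searchOrder_eq le_rfl hj'] at h
  exact (found_nodup N).getElem_inj_iff.1 h

include hN hnbr hconn in
theorem searchOrder_surj {t : ℕ} (ht : t < N) : ∃ i < N, searchOrder nbr N i = t := by
  have h := Finset.surj_on_of_inj_on_of_card_le (s := Finset.range N) (t := Finset.range N)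
    (fun i _ => searchOrder nbr N i)
    (fun i hi => Finset.mem_range.2 (searchOrder_lt hN hnbr hconn (Finset.mem_range.1 hi)))
    (fun i j hi hj => searchOrder_injOn hN hnbr hconn (Finset.mem_range.1 hi)
      (Finset.mem_range.1 hj)) le_rfl t (Finset.mem_range.2 ht)
  obtain ⟨i, hi, he⟩ := h
  exact ⟨i, Finset.mem_range.1 hi, he.symm⟩

include hN hnbr hconn in
theorem sum_searchOrder (g : ℕ → ℕ) :
    ∑ i ∈ Finset.range N, g (searchOrder nbr N i) = ∑ t ∈ Finset.range N, g t := by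
  refine Finset.sum_nbij (searchOrder nbr N) (fun i hi => Finset.mem_range.2
    (searchOrder_lt hN hnbr hconn (Finset.mem_range.1 hi))) (fun i hi j hj =>
    searchOrder_injOn hN hnbr hconn (by simpa using hi) (by simpa using hj)) (fun t ht => ?_)
    (fun _ _ => rfl)
  obtain ⟨i, hi, he⟩ := searchOrder_surj hN hnbr hconn (t := t) (by simpa using ht)
  exact ⟨i, by simpa using hi, he⟩

-- A node that enters the queue in step `h` is a neighbour of the node at position `h`, which
-- entered before. This later yields walks to the root along decreasing positions.
include hN hnbr hconn in
theorem searchOrder_parent {i : ℕ} (h0 : 0 < i) (hi : i < N) :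
    ∃ i' < i, searchOrder nbr N i ∈ nbr (searchOrder nbr N i') := by
  have key : ∀ h ≤ N, ∀ i, 0 < i → i < (found nbr h).length →
      ∃ i' < i, searchOrder nbr N i ∈ nbr (searchOrder nbr N i') := by
    intro h
    induction h with
    | zero =>
      intro _ i h0 hi
      simp [found] at hi
      omega
    | succ h ih =>
      intro hh i h0 hi
      by_cases hi' : i < (found nbr h).length
      · exact ih (by omega) i h0 hi'
      · have hlt := lt_length_found hconn (h := h) (by omega)
        refine ⟨h, by omega, ?_⟩
        rw [← searchOrder_eq hh hi]
        have hm : (found nbr (h + 1))[i] ∈ visitAll (found nbr h)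
            (nbr ((found nbr h).getD h 0)) := List.getElem_mem hi
        rcases mem_visitAll.1 hm with hm | hm
        · obtain ⟨j, hj, he⟩ := List.getElem_of_mem hm
          have hpre : found nbr h <+: found nbr (h + 1) := found_prefix (Nat.le_succ h)
          rw [hpre.getElem hj] at he
          have := (found_nodup (h + 1)).getElem_inj_iff.1 he
          omega
        · rwa [List.getD_eq_getElem _ _ hlt, searchOrder_eq (N := N) (by omega) hlt] at hm
  exact key N le_rfl i h0 ((length_found hN hnbr hconn).symm ▸ hi)

end SearchOrder

/-! ### Reading the tree decomposition -/

/-- The list `l`, preceded by its length, is stored in the array `0` at position `p`. -/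
def ListAt (σ : Store) (p : ℕ) (l : List ℕ) : Prop :=
  σ.arr 0 p = l.length ∧ ∀ i (h : i < l.length), σ.arr 0 (p + 1 + i) = l[i]

theorem ListAt.congr {σ τ : Store} {p : ℕ} {l : List ℕ} (h : ListAt σ p l)
    (h0 : τ.arr 0 = σ.arr 0) : ListAt τ p l := by
  unfold ListAt
  rw [h0]
  exact h

/-- A list, preceded by its length. -/
def withLength (l : List ℕ) : List ℕ := l.length :: l

theorem HasInput.listAt {w l r : List ℕ} {σ : Store} (h : HasInput w σ) {p : ℕ}
    (hp : w.drop p = withLength l ++ r) : ListAt σ p l := by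
  refine ⟨?_, fun i hi => ?_⟩
  · simpa [withLength] using h.read hp (i := 0) (by simp [withLength])
  · have h1 := h.read hp (i := i + 1) (by simpa [withLength] using hi)
    rw [show p + 1 + i = p + (i + 1) by omega, h1]
    simp [withLength]

/-- The array `a` holds the positions of the lists `g t`. -/
def ListsAt (a N : ℕ) (g : ℕ → List ℕ) (σ : Store) : Prop :=
  ∀ t < N, ∃ p : ℕ, σ.arr a t = p ∧ ListAt σ p (g t)

theorem ListsAt.frame {a N : ℕ} {g : ℕ → List ℕ} {σ τ : Store} {p : Program}
    (h : ListsAt a N g σ) (hF : Frame p σ τ) (h0 : 0 ∉ p.arrs) (ha : a ∉ p.arrs) :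
    ListsAt a N g τ := by
  intro t ht
  obtain ⟨q, h1, h2⟩ := h t ht
  exact ⟨q, by rw [hF.arr a ha, h1], h2.congr (hF.arr 0 h0)⟩

theorem runs_parseTree {w : List ℕ} {σ : Store} {p N : ℕ} {nbr bag : ℕ → List ℕ}
    (h : HasInput w σ) (h4 : σ.reg 4 = p) (hp : w.drop p = N :: (List.range N).flatMap fun t =>
      withLength (nbr t) ++ withLength (bag t)) :
    Runs parseTree σ (fun τ => τ.reg 5 = N ∧ ListsAt 4 N nbr τ ∧ ListsAt 17 N bag τ)
      (50 * (N + 1)) := by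
  refine Runs.block (c := 40 * N + 30) rfl ?_
    ((Nat.add_le_add_right (by decide : _ ≤ 10) _).trans (by omega))
  set σ₁ := Program.apply _ σ with hσ₁
  have hF₁ : Frame _ σ σ₁ := Frame.apply rfl σ
  have hI₁ := h.frame hF₁ (by decide)
  have hp1 : w.drop (p + 1) = ((List.range N).drop 0).flatMap fun t =>
      withLength (nbr t) ++ withLength (bag t) := by
    rw [← List.drop_drop, hp]
    simp
  have i0 : σ.arr 0 p = N := by
    simpa using h.read (l := [N]) hp (i := 0) (by simp)
  have b5 : σ₁.reg 5 = N := by simp [hσ₁, Program.apply, h4, i0]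
  have b4 : σ₁.reg 4 = (p + 1 : ℕ) := by simp [hσ₁, Program.apply, h4]
  refine (Runs.forLoop (n := N) (fun t τ => (∃ q : ℕ, τ.reg 4 = q ∧ w.drop q =
    ((List.range N).drop t).flatMap fun t => withLength (nbr t) ++ withLength (bag t)) ∧
    ListsAt 4 t nbr τ ∧ ListsAt 17 t bag τ) (fun _ => 30) (by decide) ?_ ?_ ?_ ?_).conseq ?_ le_rfl
  · intro τ hF
    rw [Expr.eval_reg, hF.reg 5 (by decide), b5]
  · exact ⟨⟨p + 1, by simp [b4], hp1⟩, fun t ht => by omega, fun t ht => by omega⟩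
  · rintro t τ ht hF h13 ⟨⟨q, hq4, hq⟩, hN, hB⟩
    have hI := hI₁.frame hF (by decide)
    have hdrop : (List.range N).drop t = t :: (List.range N).drop (t + 1) := by
      rw [List.drop_eq_getElem_cons (by simpa using ht)]
      simp
    rw [hdrop, List.flatMap_cons, List.append_assoc] at hq
    have hq' := drop_of_drop_eq_append hq
    have hq'' := drop_of_drop_eq_append hq'
    have l1 := hI.listAt hq
    have l2 := hI.listAt hq'
    have e1 : (q : ℤ) + (nbr t).length + 1 = (q + (withLength (nbr t)).length : ℕ) := by
      simp [withLength]; ring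
    generalize q + (withLength (nbr t)).length = q₁ at hq' hq'' l2 e1
    have e2 : (q₁ : ℤ) + (bag t).length + 1 = (q₁ + (withLength (bag t)).length : ℕ) := by
      simp [withLength]; ring
    generalize q₁ + (withLength (bag t)).length = q₂ at hq'' e2
    refine Runs.conseq (Runs.block_end rfl rfl (by decide) : Runs _ τ (fun ρ => ρ = _) 30)
      (Q := fun ρ => ρ = parseNode.apply τ) ?_ le_rfl
    rintro ρ hFρ rfl
    have r4 : (parseNode.apply τ).reg 4 = q₂ := by
      simp [parseNode, Program.apply, hq4, l1.1, l2.1, e1, e2]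
    have ra4 : (parseNode.apply τ).arr 4 = Function.update (τ.arr 4) t (q : ℤ) := by
      simp [parseNode, Program.apply, hq4, h13]
    have ra17 : (parseNode.apply τ).arr 17 = Function.update (τ.arr 17) t
        (q₁ : ℤ) := by
      simp [parseNode, Program.apply, hq4, h13, l1.1, e1]
    have r0 : (parseNode.apply τ).arr 0 = τ.arr 0 := by simp [parseNode, Program.apply]
    refine ⟨⟨_, by simpa using r4, hq''⟩, fun u hu => ?_, fun u hu => ?_⟩
    · by_cases hut : u = t
      · subst hut
        exact ⟨q, by simp [ra4], l1.congr r0⟩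
      · obtain ⟨q', k1, k2⟩ := hN u (by omega)
        exact ⟨q', by simp [ra4, hut, k1], k2.congr r0⟩
    · by_cases hut : u = t
      · subst hut
        exact ⟨_, by rw [Store.setReg_arr, ra17, Function.update_self], l2.congr r0⟩
      · obtain ⟨q', k1, k2⟩ := hB u (by omega)
        exact ⟨q', by simp [ra17, hut, k1], k2.congr r0⟩
  · simp
    omega
  · rintro τ hF ⟨-, k1, k2⟩
    exact ⟨(hF.reg 5 (by decide)).trans b5, k1, k2⟩

/-- The list `o` of visited nodes. -/
structure QueueIs (o : List ℕ) (σ : Store) : Prop where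
  length : σ.reg 14 = o.length
  get : ∀ i (h : i < o.length), σ.arr 6 i = o[i]
  mark : ∀ t, σ.arr 5 t = if t ∈ o then 1 else 0

theorem QueueIs.congr {o : List ℕ} {σ τ : Store} (h : QueueIs o σ) (h14 : τ.reg 14 = σ.reg 14)
    (h6 : τ.arr 6 = σ.arr 6) (h5 : τ.arr 5 = σ.arr 5) : QueueIs o τ :=
  ⟨by rw [h14, h.length], fun i hi => by rw [h6, h.get i hi], fun t => by rw [h5, h.mark t]⟩

theorem runs_search {σ : Store} {N : ℕ} {nbr : ℕ → List ℕ} (hN : 0 < N)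
    (hnbr : ∀ t < N, ∀ u ∈ nbr t, u < N)
    (hconn : ∀ C : ℕ → Prop, C 0 → (∀ t < N, C t → ∀ u ∈ nbr t, C u) → ∀ t < N, C t)
    (h5 : σ.reg 5 = N) (hL : ListsAt 4 N nbr σ) (ha5 : ∀ i, σ.arr 5 i = 0)
    (ha6 : ∀ i, σ.arr 6 i = 0) :
    Runs search σ (fun τ => ∀ i < N, τ.arr 6 i = searchOrder nbr N i)
      (70 * (∑ t ∈ Finset.range N, ((nbr t).length + 1)) + 20) := by
  refine Runs.block (c := 70 * (∑ t ∈ Finset.range N, ((nbr t).length + 1)) + 10) rfl ?_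
    ((Nat.add_le_add_right (by decide : _ ≤ 10) _).trans (by omega))
  set σ₁ := Program.apply _ σ with hσ₁
  have hF₁ : Frame _ σ σ₁ := Frame.apply rfl σ
  have hL₁ := hL.frame hF₁ (by decide) (by decide)
  have b5 : σ₁.reg 5 = N := (hF₁.reg 5 (by decide)).trans h5
  refine (Runs.forLoop (n := N) (fun h τ => QueueIs (found nbr h) τ)
    (fun h => 60 * (nbr (searchOrder nbr N h)).length + 60) (by decide) ?_ ?_ ?_ le_rfl).conseq
    ?_ ?_
  · intro τ hF
    rw [Expr.eval_reg, hF.reg 5 (by decide), b5]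
  · refine ⟨by simp [hσ₁, Program.apply, found], fun i hi => ?_, fun t => ?_⟩
    · simp [found] at hi
      simp [hσ₁, Program.apply, found, ha6]
    · simp [hσ₁, Program.apply, found, Function.update_apply, ha5]
  · rintro h τ hh hF h15 hQ
    have hlt := lt_length_found hconn hh
    have hLτ := hL₁.frame hF (by decide) (by decide)
    have hoh := searchOrder_eq hh.le hlt
    have hmem := found_lt hN hnbr h _ (List.getElem_mem hlt)
    set t := (found nbr h)[h] with ht
    rw [← hoh]
    obtain ⟨q, hq, hqL⟩ := hLτ t hmem
    refine Runs.block (c := 60 * (nbr t).length + 40) rfl ?_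
      ((Nat.add_le_add_right (by decide : _ ≤ 10) _).trans (by omega))
    set τ₁ := Program.apply _ τ with hτ₁
    have hFτ₁ : Frame _ τ τ₁ := Frame.apply rfl τ
    have c16 : τ₁.reg 16 = t := by simp [hτ₁, Program.apply, h15, hQ.get h hlt, ht]
    have c4 : τ₁.arr 4 t = q := by rw [hFτ₁.arr 4 (by decide), hq]
    have c0 := hqL.congr (hFτ₁.arr 0 (by decide))
    have hfound : found nbr (h + 1) = visitAll (found nbr h) (nbr t) := by
      rw [found, List.getD_eq_getElem _ _ hlt]
    refine (Runs.forLoop (n := (nbr t).length)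
      (fun i ρ => QueueIs (visitAll (found nbr h) ((nbr t).take i)) ρ)
      (fun _ => 40) (by decide) ?_ ?_ ?_ le_rfl).conseq ?_ ?_
    · intro ρ hFρ
      rw [Expr.eval_read, Expr.eval_read, Expr.eval_reg, hFρ.reg 16 (by decide),
        hFρ.arr 4 (by decide), hFρ.arr 0 (by decide), c16, Int.toNat_natCast, c4,
        Int.toNat_natCast, c0.1]
    · exact hQ.congr (by simp [hτ₁, Program.apply]) rfl rfl
    · rintro i ρ hi hFρ h17 hQi
      have d16 : ρ.reg 16 = t := (hFρ.reg 16 (by decide)).trans c16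
      have d4 : ρ.arr 4 t = q := by rw [hFρ.arr 4 (by decide), c4]
      have d0 : ρ.arr 0 (q + 1 + i) = (nbr t)[i] := by
        rw [hFρ.arr 0 (by decide)]
        exact c0.2 i hi
      have dpos : ((q : ℤ) + 1 + i).toNat = q + 1 + i := by omega
      rw [visitAll_take_succ hi]
      set o := visitAll (found nbr h) ((nbr t).take i)
      refine Runs.block_end rfl ?_ (by decide)
      by_cases hu : (nbr t)[i] ∈ o
      · have dm := hQi.mark (nbr t)[i]
        rw [if_pos hu] at dm
        rw [visit, if_pos hu]
        refine ⟨?_, fun j hj => ?_, fun v => ?_⟩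
        · simp [visitNode, Program.apply, d16, d4, h17, dpos, d0, dm, hQi.length]
        · simpa [visitNode, Program.apply, d16, d4, h17, dpos, d0, dm] using hQi.get j hj
        · simpa [visitNode, Program.apply, d16, d4, h17, dpos, d0, dm] using hQi.mark v
      · have dm := hQi.mark (nbr t)[i]
        rw [if_neg hu] at dm
        rw [visit, if_neg hu]
        refine ⟨?_, fun j hj => ?_, fun v => ?_⟩
        · simp [visitNode, Program.apply, d16, d4, h17, dpos, d0, dm, hQi.length]
        · simp only [List.length_append, List.length_singleton] at hj
          by_cases hjo : j = o.length
          · subst hjo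
            simp [visitNode, Program.apply, d16, d4, h17, dpos, d0, dm, hQi.length]
          · have hj' : j < o.length := by omega
            rw [List.getElem_append_left hj']
            simpa [visitNode, Program.apply, d16, d4, h17, dpos, d0, dm, hQi.length, hjo] using hQi.get j hj'
        · by_cases hv : v = (nbr t)[i]
          · simp [visitNode, Program.apply, d16, d4, h17, dpos, d0, dm, hv]
          · have := hQi.mark v
            simpa [visitNode, Program.apply, d16, d4, h17, dpos, d0, dm, hv] using this
    · rintro ρ - hQ'
      rw [List.take_length, ← hfound] at hQ'
      exact hQ'.congr (by simp) rfl rfl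
    · simp
      omega
  · rintro τ - hQ i hi
    have hi' : i < (found nbr N).length := (length_found hN hnbr hconn).symm ▸ hi
    rw [hQ.get i hi', searchOrder_eq le_rfl hi']
  -- Each node is expanded exactly once, so the cost can be summed over nodes instead of positions.
  · have h1 := sum_searchOrder hN hnbr hconn fun t => 70 * ((nbr t).length + 1)
    rw [← Finset.mul_sum, ← Finset.mul_sum] at h1
    rw [← h1, Finset.mul_sum]
    simp only [Expr.cost_reg]
    refine Nat.add_le_add (Finset.sum_le_sum fun i _ => ?_) (by omega)
    omega

end ModelCounting

namespace ModelCounting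

open Algo

/-! ### Ranking the vertices -/

section Discovered

variable (bag : ℕ → List ℕ) (o : ℕ → ℕ)

/-- The vertices in the first `i` bags, in the order of their first occurrence. -/
def discovered : ℕ → List ℕ
  | 0 => []
  | i + 1 => visitAll (discovered i) (bag (o i))

/-- The index of the first bag with the vertex of rank `r`. -/
noncomputable def top (r : ℕ) : ℕ := sInf {i | r < (discovered bag o (i + 1)).length}

variable {bag o}

theorem discovered_prefix {i j : ℕ} (h : i ≤ j) : discovered bag o i <+: discovered bag o j := by
  induction j, h using Nat.le_induction with
  | base => exact List.prefix_rfl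
  | succ j _ ih => exact ih.trans (prefix_visitAll _ _)

theorem discovered_nodup (i : ℕ) : (discovered bag o i).Nodup := by
  induction i with
  | zero => simp [discovered]
  | succ i ih => exact nodup_visitAll _ ih

theorem mem_discovered {n v : ℕ} : v ∈ discovered bag o n ↔ ∃ i < n, v ∈ bag (o i) := by
  induction n with
  | zero => simp [discovered]
  | succ n ih =>
    rw [discovered, mem_visitAll, ih]
    constructor
    · rintro (⟨i, hi, h⟩ | h)
      · exact ⟨i, by omega, h⟩
      · exact ⟨n, by omega, h⟩
    · rintro ⟨i, hi, h⟩
      rcases Nat.lt_succ_iff_lt_or_eq.1 hi with hi | rfl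
      · exact Or.inl ⟨i, hi, h⟩
      · exact Or.inr h

theorem top_eq {i r : ℕ} (h1 : (discovered bag o i).length ≤ r)
    (h2 : r < (discovered bag o (i + 1)).length) : top bag o r = i := by
  refine le_antisymm (Nat.sInf_le h2) ?_
  by_contra hlt
  have hm : r < (discovered bag o (top bag o r + 1)).length :=
    Nat.sInf_mem (s := {i | r < (discovered bag o (i + 1)).length}) ⟨i, h2⟩
  have := (discovered_prefix (bag := bag) (o := o)
    (show top bag o r + 1 ≤ i by omega)).length_le
  omega

variable {N r : ℕ} (hr : r < (discovered bag o N).length)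

include hr in
theorem top_lt : top bag o r < N := by
  obtain ⟨n, rfl⟩ : ∃ n, N = n + 1 := by
    cases N with
    | zero => simp [discovered] at hr
    | succ n => exact ⟨n, rfl⟩
  exact Nat.lt_succ_of_le (Nat.sInf_le hr)

include hr in
theorem lt_length_top : r < (discovered bag o (top bag o r + 1)).length := by
  obtain ⟨n, rfl⟩ : ∃ n, N = n + 1 := by
    cases N with
    | zero => simp [discovered] at hr
    | succ n => exact ⟨n, rfl⟩
  exact Nat.sInf_mem (s := {i | r < (discovered bag o (i + 1)).length}) ⟨n, hr⟩

theorem length_le_of_le_top {i : ℕ} (hi : i ≤ top bag o r) :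
    (discovered bag o i).length ≤ r := by
  cases i with
  | zero => simp [discovered]
  | succ i =>
    by_contra h
    have : top bag o r ≤ i := Nat.sInf_le (not_le.1 h)
    omega

theorem top_mono {r' : ℕ} (h : r ≤ r') (hr' : r' < (discovered bag o N).length) :
    top bag o r ≤ top bag o r' :=
  Nat.sInf_le (h.trans_lt (lt_length_top hr'))

/-- Otherwise the vertex would occur in the prefix discovered by the first `i + 1` bags, hence at a
position below `r` as well, contradicting the absence of repetitions. -/
theorem not_mem_bag_of_lt_top {i : ℕ} (hi : i < top bag o r) :
    (discovered bag o N)[r] ∉ bag (o i) := by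
  intro hm
  have h1 : (discovered bag o N)[r] ∈ discovered bag o (i + 1) :=
    mem_discovered.2 ⟨i, by omega, hm⟩
  obtain ⟨j, hj, he⟩ := List.getElem_of_mem h1
  have hjr : j < r := hj.trans_le (length_le_of_le_top hi)
  have hpre : discovered bag o (i + 1) <+: discovered bag o N :=
    discovered_prefix (by have := top_lt hr; omega)
  rw [hpre.getElem hj] at he
  have := (discovered_nodup N).getElem_inj_iff.1 he
  omega

theorem mem_bag_top : (discovered bag o N)[r] ∈ bag (o (top bag o r)) := by
  have h1 := lt_length_top hr
  have hpre : discovered bag o (top bag o r + 1) <+: discovered bag o N :=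
    discovered_prefix (top_lt hr)
  obtain ⟨i, hi, hm⟩ := mem_discovered.1 (List.getElem_mem h1)
  rw [hpre.getElem h1] at hm
  rcases Nat.lt_succ_iff_lt_or_eq.1 hi with hi | rfl
  · exact absurd hm (not_mem_bag_of_lt_top hr hi)
  · exact hm

end Discovered

/-- The list `l` of ranked vertices. -/
structure RankedIs (l : List ℕ) (σ : Store) : Prop where
  length : σ.reg 19 = l.length
  get : ∀ i (h : i < l.length), σ.arr 8 i = l[i]
  mark : ∀ v, σ.arr 7 v = if v ∈ l then (l.idxOf v + 1 : ℤ) else 0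

theorem RankedIs.congr {l : List ℕ} {σ τ : Store} (h : RankedIs l σ)
    (h19 : τ.reg 19 = σ.reg 19) (h8 : τ.arr 8 = σ.arr 8) (h7 : τ.arr 7 = σ.arr 7) :
    RankedIs l τ :=
  ⟨by rw [h19, h.length], fun i hi => by rw [h8, h.get i hi], fun t => by rw [h7, h.mark t]⟩

/-- A newly ranked vertex remembers the input position of the bag being read, which by `top_eq` is
its first bag. Scopes can then be computed without returning to the tree. -/
theorem runs_rankVertices {σ : Store} {N : ℕ} {bag : ℕ → List ℕ} {o : ℕ → ℕ}
    (ho : ∀ i < N, o i < N) (h5 : σ.reg 5 = N) (h19 : σ.reg 19 = 0)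
    (h6 : ∀ i < N, σ.arr 6 i = o i) (hL : ListsAt 17 N bag σ) (h7 : ∀ i, σ.arr 7 i = 0) :
    Runs rankVertices σ (fun τ => RankedIs (discovered bag o N) τ ∧
      ∀ r < (discovered bag o N).length, ∃ p : ℕ, τ.arr 9 r = p ∧
        ListAt τ p (bag (o (top bag o r))))
      (80 * (∑ i ∈ Finset.range N, ((bag (o i)).length + 1)) + 20) := by
  refine (Runs.forLoop (n := N) (fun i τ => RankedIs (discovered bag o i) τ ∧
      ∀ r < (discovered bag o i).length, ∃ p : ℕ, τ.arr 9 r = p ∧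
        ListAt σ p (bag (o (top bag o r))))
    (fun i => 70 * (bag (o i)).length + 60) (by decide) ?_ ?_ ?_ le_rfl).conseq
    ?_ ?_
  · intro τ hF
    rw [Expr.eval_reg, hF.reg 5 (by decide), h5]
  · exact ⟨⟨by simp [discovered, h19], by simp [discovered], by simp [discovered, h7]⟩,
      by simp [discovered]⟩
  · rintro i τ hi hF h20 ⟨hR, hH⟩
    obtain ⟨q, hq, hqL⟩ := hL (o i) (ho i hi)
    refine Runs.block (c := 70 * (bag (o i)).length + 40) rfl ?_
      ((Nat.add_le_add_right (by decide : _ ≤ 10) _).trans (by omega))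
    set τ₁ := Program.apply _ τ with hτ₁
    have hFτ₁ : Frame _ τ τ₁ := Frame.apply rfl τ
    have e6 : τ.arr 6 i = o i := by rw [hF.arr 6 (by decide), h6 i hi]
    have e17 : τ.arr 17 (o i) = q := by rw [hF.arr 17 (by decide), hq]
    have c21 : τ₁.reg 21 = q := by simp [hτ₁, Program.apply, h20, e6, e17]
    have c0 : τ₁.arr 0 = σ.arr 0 := (hFτ₁.arr 0 (by decide)).trans (hF.arr 0 (by decide))
    refine (Runs.forLoop (n := (bag (o i)).length)
      (fun j ρ => RankedIs (visitAll (discovered bag o i) ((bag (o i)).take j)) ρ ∧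
        ∀ r < (visitAll (discovered bag o i) ((bag (o i)).take j)).length, ∃ p : ℕ,
          ρ.arr 9 r = p ∧ ListAt σ p (bag (o (top bag o r))))
      (fun _ => 50) (by decide) ?_ ?_ ?_ le_rfl).conseq ?_ ?_
    · intro ρ hFρ
      rw [Expr.eval_read, Expr.eval_reg, hFρ.reg 21 (by decide),
        hFρ.arr 0 (by decide), c21, c0, Int.toNat_natCast, hqL.1]
    · exact ⟨hR.congr (by simp [hτ₁, Program.apply]) rfl rfl, hH⟩
    · rintro j ρ hj hFρ h22 ⟨hRj, hHj⟩
      have d21 : ρ.reg 21 = q := (hFρ.reg 21 (by decide)).trans c21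
      have d0 : ρ.arr 0 (q + 1 + j) = (bag (o i))[j] := by
        rw [hFρ.arr 0 (by decide), c0]
        exact hqL.2 j hj
      have dpos : ((q : ℤ) + 1 + j).toNat = q + 1 + j := by omega
      have hpre : visitAll (discovered bag o i) ((bag (o i)).take (j + 1)) <+:
          discovered bag o (i + 1) := by
        have : visitAll (discovered bag o i) (bag (o i)) = visitAll
            (visitAll (discovered bag o i) ((bag (o i)).take (j + 1)))
            ((bag (o i)).drop (j + 1)) := by
          rw [visitAll, visitAll, visitAll, ← List.foldl_append, List.take_append_drop]
        rw [discovered, this]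
        exact prefix_visitAll _ _
      have hpre' : discovered bag o i <+: visitAll (discovered bag o i) ((bag (o i)).take j) :=
        prefix_visitAll _ _
      rw [visitAll_take_succ hj] at hpre ⊢
      set l := visitAll (discovered bag o i) ((bag (o i)).take j) with hl
      refine Runs.block_end rfl ?_ (by decide)
      by_cases hu : (bag (o i))[j] ∈ l
      · have dm := hRj.mark (bag (o i))[j]
        rw [if_pos hu] at dm
        rw [visit, if_pos hu]
        have happ : rankVertex.apply ρ = ρ.setReg 18 ((bag (o i))[j] : ℤ) := by
          simp [rankVertex, Program.apply, d21, h22, dpos, d0, dm]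
        rw [happ]
        exact ⟨hRj.congr (by simp) rfl rfl, hHj⟩
      · have dm := hRj.mark (bag (o i))[j]
        rw [if_neg hu] at dm
        rw [visit, if_neg hu] at hpre ⊢
        refine ⟨⟨?_, fun r hr => ?_, fun v => ?_⟩, fun r hr => ?_⟩
        · simp [rankVertex, Program.apply, d21, h22, dpos, d0, dm, hRj.length]
        · simp only [List.length_append, List.length_singleton] at hr
          by_cases hrl : r = l.length
          · subst hrl
            simp [rankVertex, Program.apply, d21, h22, dpos, d0, dm, hRj.length]
          · have hr' : r < l.length := by omega
            rw [List.getElem_append_left hr']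
            simpa [rankVertex, Program.apply, d21, h22, dpos, d0, dm, hRj.length, hrl] using
              hRj.get r hr'
        · by_cases hv : v = (bag (o i))[j]
          · simp [rankVertex, Program.apply, d21, h22, dpos, d0, dm, hRj.length, hv,
              List.idxOf_append_of_notMem hu]
          · have hm : v ∈ l ++ [(bag (o i))[j]] ↔ v ∈ l := by simp [hv]
            have := hRj.mark v
            have hx : (rankVertex.apply ρ).arr 7 v = ρ.arr 7 v := by
              simp [rankVertex, Program.apply, d21, h22, dpos, d0, dm, hRj.length, hv]
            simp only [Store.setReg_arr, hx, this, hm]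
            split_ifs with hvl
            · rw [List.idxOf_append_of_mem hvl]
            · rfl
        · simp only [List.length_append, List.length_singleton] at hr
          by_cases hrl : r = l.length
          · have htop : top bag o r = i := by
              refine top_eq (hrl ▸ hpre'.length_le) ?_
              have := hpre.length_le
              simp only [List.length_append, List.length_singleton] at this
              omega
            rw [htop]
            refine ⟨q, ?_, hqL⟩
            subst hrl
            simp [rankVertex, Program.apply, d21, h22, dpos, d0, dm, hRj.length]
          · obtain ⟨p, hp, hpL⟩ := hHj r (by omega)
            refine ⟨p, ?_, hpL⟩
            simpa [rankVertex, Program.apply, d21, h22, dpos, d0, dm, hRj.length, hrl] using hp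
    · rintro ρ - ⟨k1, k2⟩
      rw [List.take_length] at k1 k2
      exact ⟨k1.congr (by simp) rfl rfl, k2⟩
    · simp
      omega
  · rintro τ hF ⟨k1, k2⟩
    refine ⟨k1, fun r hr => ?_⟩
    obtain ⟨p, hp, hpL⟩ := k2 r hr
    exact ⟨p, hp, hpL.congr (hF.arr 0 (by decide))⟩
  · rw [Finset.mul_sum]
    refine Nat.add_le_add (Finset.sum_le_sum fun i _ => ?_) (by simp)
    simp
    omega

/-! ### Computing the scopes -/

/-- The ranks below `r` in a list of vertices. -/
def ranksBelow (rk : ℕ → ℕ) (l : List ℕ) (r : ℕ) : List ℕ := (l.map rk).filter (· < r)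

theorem children_succ (S : ℕ → List ℕ) (r p : ℕ) : children (r + 1) S p =
    children r S p ++ if S r ≠ [] ∧ parent S r = p then [r] else [] := by
  rw [children, List.range_succ, List.filter_append, children]
  congr 1
  simp [List.filter_cons]

theorem length_children_le (S : ℕ → List ℕ) (r p : ℕ) : (children r S p).length ≤ r := by
  unfold children
  exact (List.length_filter_le _ _).trans (by simp)

/-- Round `r` appends `r` to the row of its parent, so the invariant speaks of `children r S p`, the
children of rank below `r`. Rows of width `V` do not overflow: a scope has at most `r` elements, and
before round `r` a row has at most `r` children. -/
theorem runs_scopes {σ : Store} {V : ℕ} {bag : ℕ → List ℕ} {rk : ℕ → ℕ} (h3 : σ.reg 3 = V)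
    (h9 : ∀ r < V, ∃ p : ℕ, σ.arr 9 r = p ∧ ListAt σ p (bag r))
    (h7 : ∀ r < V, ∀ v ∈ bag r, σ.arr 7 v = (rk v + 1 : ℤ))
    (h13 : ∀ i, σ.arr 13 i = 0)
    (hnd : ∀ r < V, (ranksBelow rk (bag r) r).Nodup) :
    Runs scopes σ (fun τ =>
      (∀ r < V, τ.arr 11 r = (ranksBelow rk (bag r) r).length) ∧
      (∀ r < V, ∀ i (h : i < (ranksBelow rk (bag r) r).length),
        τ.arr 10 (r * V + i) = (ranksBelow rk (bag r) r)[i]) ∧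
      ∀ p < V, τ.arr 13 p = (children V (fun r => ranksBelow rk (bag r) r) p).length ∧
        ∀ i (h : i < (children V (fun r => ranksBelow rk (bag r) r) p).length),
          τ.arr 12 (p * V + i) = (children V (fun r => ranksBelow rk (bag r) r) p)[i])
      (100 * (∑ r ∈ Finset.range V, ((bag r).length + 1)) + 20) := by
  set S : ℕ → List ℕ := fun r => ranksBelow rk (bag r) r with hS
  have hlen : ∀ r < V, (S r).length ≤ r := by
    intro r hr
    have h1 : (S r).toFinset ⊆ Finset.range r := fun u hu => by
      simpa [hS, ranksBelow] using (List.mem_filter.1 (List.mem_toFinset.1 hu)).2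
    have := Finset.card_le_card h1
    rwa [List.toFinset_card_of_nodup (hnd r hr), Finset.card_range] at this
  have hpar : ∀ r, S r ≠ [] → parent S r < r := by
    intro r hr
    simpa using (List.mem_filter.1 (parent_mem hr)).2
  refine (Runs.forLoop (n := V) (fun r τ =>
      (∀ c < r, τ.arr 11 c = (S c).length) ∧
      (∀ c < r, ∀ i (h : i < (S c).length), τ.arr 10 (c * V + i) = (S c)[i]) ∧
      ∀ p < V, τ.arr 13 p = (children r S p).length ∧
        ∀ i (h : i < (children r S p).length), τ.arr 12 (p * V + i) = (children r S p)[i])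
    (fun r => 80 * (bag r).length + 80) (by decide) ?_ ?_ ?_ le_rfl).conseq
    (fun τ _ h => h) ?_
  · intro τ hF
    rw [Expr.eval_reg, hF.reg 3 (by decide), h3]
  · exact ⟨fun c hc => by omega, fun c hc => by omega, fun p hp => by simp [children, h13]⟩
  · rintro r τ hr hF h23 ⟨hI11, hI10, hIch⟩
    obtain ⟨q, hq, hqL⟩ := h9 r hr
    refine Runs.block (c := 80 * (bag r).length + 60) rfl ?_
      ((Nat.add_le_add_right (by decide : _ ≤ 20) _).trans (by omega))
    set τ₁ := Program.apply _ τ with hτ₁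
    have hFτ₁ : Frame _ τ τ₁ := Frame.apply rfl τ
    have e9 : τ.arr 9 r = q := by rw [hF.arr 9 (by decide), hq]
    have c21 : τ₁.reg 21 = q := by simp [hτ₁, Program.apply, h23, e9]
    have c0 : τ₁.arr 0 = σ.arr 0 := (hFτ₁.arr 0 (by decide)).trans (hF.arr 0 (by decide))
    have c7 : τ₁.arr 7 = σ.arr 7 := (hFτ₁.arr 7 (by decide)).trans (hF.arr 7 (by decide))
    have c3 : τ₁.reg 3 = V :=
      ((hFτ₁.reg 3 (by decide)).trans (hF.reg 3 (by decide))).trans h3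
    have c23 : τ₁.reg 23 = r := (hFτ₁.reg 23 (by decide)).trans h23
    have c10 : τ₁.arr 10 = τ.arr 10 := hFτ₁.arr 10 (by decide)
    refine (Runs.forLoop (n := (bag r).length)
      (fun j ρ => ρ.reg 24 = (ranksBelow rk ((bag r).take j) r).length ∧
        ρ.reg 25 = (ranksBelow rk ((bag r).take j) r).foldl max 0 ∧
        (∀ c < r, ∀ i (h : i < (S c).length), ρ.arr 10 (c * V + i) = (S c)[i]) ∧
        ∀ i (h : i < (ranksBelow rk ((bag r).take j) r).length),
          ρ.arr 10 (r * V + i) = (ranksBelow rk ((bag r).take j) r)[i])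
      (fun _ => 60) (by decide) ?_ ?_ ?_ le_rfl).seq (d := 40) ?_ ?_
    · intro ρ hFρ
      rw [Expr.eval_read, Expr.eval_reg, hFρ.reg 21 (by decide),
        hFρ.arr 0 (by decide), c21, c0, Int.toNat_natCast, hqL.1]
    · refine ⟨by simp [hτ₁, Program.apply, ranksBelow], by simp [hτ₁, Program.apply, ranksBelow],
        fun c hc i hi => ?_, by simp [ranksBelow]⟩
      rw [Store.setReg_arr, c10]
      exact hI10 c hc i hi
    · rintro j ρ hj hFρ h26 ⟨k24, k25, kold, knew⟩
      have d21 : ρ.reg 21 = q := (hFρ.reg 21 (by decide)).trans c21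
      have d3 : ρ.reg 3 = V := (hFρ.reg 3 (by decide)).trans c3
      have d23 : ρ.reg 23 = r := (hFρ.reg 23 (by decide)).trans c23
      have d0 : ρ.arr 0 (q + 1 + j) = (bag r)[j] := by
        rw [hFρ.arr 0 (by decide), c0]
        exact hqL.2 j hj
      have d7 : ρ.arr 7 (bag r)[j] = (rk (bag r)[j] + 1 : ℤ) := by
        rw [hFρ.arr 7 (by decide), c7]
        exact h7 r hr _ (List.getElem_mem hj)
      have dpos : ((q : ℤ) + 1 + j).toNat = q + 1 + j := by omega
      have hsucc : ranksBelow rk ((bag r).take (j + 1)) r = ranksBelow rk ((bag r).take j) r ++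
          if rk (bag r)[j] < r then [rk (bag r)[j]] else [] := by
        rw [← List.take_append_getElem hj, ranksBelow, List.map_append, List.filter_append,
          ranksBelow]
        congr 1
        simp [List.filter_cons]
      have hpre : ranksBelow rk ((bag r).take (j + 1)) r <+: S r :=
        ((List.take_prefix _ _).map rk).filter _
      have hle := hpre.length_le.trans (hlen r hr)
      rw [hsucc] at hle ⊢
      set l := ranksBelow rk ((bag r).take j) r with hl
      set u := rk (bag r)[j] with hu
      refine Runs.block_end rfl ?_ (by decide)
      by_cases hur : u < r
      · have hur' : (u : ℤ) < r := by exact_mod_cast hur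
        rw [if_pos hur] at hle ⊢
        simp only [List.length_append, List.length_singleton] at hle
        have happ : ∃ z : ℤ, z = max ((l.foldl max 0 : ℕ) : ℤ) (u : ℤ) ∧ scopeEntry.apply ρ =
            ((((ρ.setReg 18 (u : ℤ)).setCell 10 (r * V + l.length) (u : ℤ)).setReg 24
              (l.length + 1)).setReg 25 z) := by
          by_cases hmax : ((l.foldl max 0 : ℕ) : ℤ) < u
          · refine ⟨u, (max_eq_right hmax.le).symm, ?_⟩
            simp [scopeEntry, Program.apply, d21, h26, dpos, d0, d7, d23, d3, hur', k24, k25, hmax]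
          · refine ⟨(l.foldl max 0 : ℕ), (max_eq_left (not_lt.1 hmax)).symm, ?_⟩
            -- If the maximum does not change, register 25 is not written; rewriting its own value
            -- brings both cases into one form.
            have hself : ∀ τ : Store, τ.reg 25 = (l.foldl max 0 : ℕ) →
                τ.setReg 25 (l.foldl max 0 : ℕ) = τ := by
              intro τ h
              rw [← h]
              simp [Store.setReg]
            rw [hself _ (by simp [k25])]
            simp [scopeEntry, Program.apply, d21, h26, dpos, d0, d7, d23, d3, hur', k24, k25, hmax]
        obtain ⟨z, hz, happ⟩ := happ
        rw [happ]
        refine ⟨by simp, by simp [hz], fun c hc i hi => ?_, fun i hi => ?_⟩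
        · have hne : c * V + i ≠ r * V + l.length := fun he => by
            have := (address_injective (by have := hlen c (hc.trans hr); omega) (by omega) he).1
            omega
          simp [hne, kold c hc i hi]
        · simp only [List.length_append, List.length_singleton] at hi
          by_cases hil : i = l.length
          · subst hil
            simp
          · have hi' : i < l.length := by omega
            simp [hil, List.getElem_append_left hi', knew i hi']
      · have hur' : ¬ (u : ℤ) < r := by exact_mod_cast hur
        have happ : scopeEntry.apply ρ = ρ.setReg 18 (u : ℤ) := by
          simp [scopeEntry, Program.apply, d21, h26, dpos, d0, d7, d23, hur']
        rw [happ, if_neg hur, List.append_nil]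
        exact ⟨by simp [k24], by simp [k25], kold, knew⟩
    · rintro ρ hFρ ⟨k24, k25, kold, knew⟩
      rw [List.take_length] at k24 k25
      simp only [List.take_length] at knew
      have d23 : ρ.reg 23 = r := (hFρ.reg 23 (by decide)).trans c23
      have d3 : ρ.reg 3 = V := (hFρ.reg 3 (by decide)).trans c3
      have d11 : ρ.arr 11 = τ.arr 11 :=
        (hFρ.arr 11 (by decide)).trans (hFτ₁.arr 11 (by decide))
      have d12 : ρ.arr 12 = τ.arr 12 :=
        (hFρ.arr 12 (by decide)).trans (hFτ₁.arr 12 (by decide))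
      have d13 : ρ.arr 13 = τ.arr 13 :=
        (hFρ.arr 13 (by decide)).trans (hFτ₁.arr 13 (by decide))
      change ρ.reg 24 = (S r).length at k24
      change ρ.reg 25 = parent S r at k25
      change ∀ i (h : i < (S r).length), ρ.arr 10 (r * V + i) = (S r)[i] at knew
      refine Runs.block_end rfl ?_ (by decide)
      have f11 : (addChild.apply ρ).arr 11 = Function.update (τ.arr 11) r ((S r).length : ℤ) := by
        by_cases hSr : S r = [] <;> simp [addChild, Program.apply, d23, k24, hSr, d11,
          apply_ite Store.arr, apply_ite (fun f : ℕ → ℕ → ℤ => f 11)]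
      have f10 : (addChild.apply ρ).arr 10 = ρ.arr 10 :=
        (Frame.apply (p := addChild) rfl ρ).arr 10 (by decide)
      refine ⟨fun c hc => ?_, fun c hc i hi => ?_, fun p hp => ?_⟩
      · rw [Store.setReg_arr, f11]
        by_cases hcr : c = r
        · simp [hcr]
        · rw [Function.update_of_ne hcr]
          exact hI11 c (by omega)
      · rw [Store.setReg_arr, f10]
        by_cases hcr : c = r
        · subst hcr
          exact knew i hi
        · exact kold c (by omega) i hi
      · rw [Store.setReg_arr]
        obtain ⟨g1, g2⟩ := hIch p hp
        by_cases hSr : S r = []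
        · have hch : children (r + 1) S p = children r S p := by simp [children_succ, hSr]
          have f13 : (addChild.apply ρ).arr 13 = τ.arr 13 := by
            simp [addChild, Program.apply, d23, k24, hSr, d13]
          have f12 : (addChild.apply ρ).arr 12 = τ.arr 12 := by
            simp [addChild, Program.apply, d23, k24, hSr, d12]
          rw [f12, f13]
          simp only [hch]
          exact ⟨g1, g2⟩
        · have hpos : 0 < (S r).length := List.length_pos_iff.2 hSr
          have hpr := hpar r hSr
          have g1' := (hIch (parent S r) (hpr.trans hr)).1
          have f13 : (addChild.apply ρ).arr 13 = Function.update (τ.arr 13) (parent S r)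
              ((children r S (parent S r)).length + 1 : ℤ) := by
            simp [addChild, Program.apply, d23, k24, k25, hpos, d13, g1']
          have f12 : (addChild.apply ρ).arr 12 = Function.update (τ.arr 12)
              (parent S r * V + (children r S (parent S r)).length) (r : ℤ) := by
            simp [addChild, Program.apply, d23, d3, k24, k25, hpos, d12, d13, g1']
          rw [f12, f13]
          have hlp := length_children_le S r p
          have hlq := length_children_le S r (parent S r)
          by_cases hpp : parent S r = p
          · have hch : children (r + 1) S p = children r S p ++ [r] := by
              simp [children_succ, hSr, hpp]
            rw [hpp]
            simp only [hch, List.length_append, List.length_singleton, Function.update_self]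
            refine ⟨by push_cast; rfl, fun i hi => ?_⟩
            by_cases hil : i = (children r S p).length
            · subst hil
              simp
            · have hi' : i < (children r S p).length := by omega
              rw [Function.update_of_ne (by omega), List.getElem_append_left hi']
              exact g2 i hi'
          · have hch : children (r + 1) S p = children r S p := by
              simp [children_succ, hpp]
            simp only [hch]
            refine ⟨?_, fun i hi => ?_⟩
            · rw [Function.update_of_ne (Ne.symm hpp)]
              exact g1
            · rw [Function.update_of_ne]
              · exact g2 i hi
              · exact fun he => hpp (address_injective (by omega) (by omega) he).1.symm
    · simp
      omega
  · rw [Finset.mul_sum]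
    refine Nat.add_le_add (Finset.sum_le_sum fun i _ => ?_) (by simp)
    simp
    omega

end ModelCounting

namespace ModelCounting

/-! ### Search orders of trees -/

section Tree

variable {W : Type*} [DecidableEq W] {G : SimpleGraph W} {idx : W → ℕ}

/-- Step to an earlier neighbour until the root is reached; the index decreases all along. -/
theorem exists_walk_to_root {r : W} (hr : ∀ w, w ≠ r → ∃ w', G.Adj w w' ∧ idx w' < idx w)
    (w : W) : ∃ p : G.Walk w r, ∀ v ∈ p.support, idx v ≤ idx w := by
  induction hn : idx w using Nat.strong_induction_on generalizing w with
  | _ n ih =>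
    subst hn
    by_cases hw : w = r
    · subst hw
      exact ⟨.nil, by simp⟩
    · obtain ⟨w', hadj, hlt⟩ := hr w hw
      obtain ⟨p, hp⟩ := ih _ hlt w' rfl
      refine ⟨.cons hadj p, fun v hv => ?_⟩
      rw [SimpleGraph.Walk.support_cons, List.mem_cons] at hv
      rcases hv with rfl | hv
      · exact le_rfl
      · exact (hp v hv).trans hlt.le

theorem exists_path_of_induce_connected {X : Set W} (hX : (G.induce X).Connected) {a c : W}
    (ha : a ∈ X) (hc : c ∈ X) : ∃ p : G.Walk a c, p.IsPath ∧ ∀ v ∈ p.support, v ∈ X := by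
  obtain ⟨p⟩ := hX.preconnected ⟨a, ha⟩ ⟨c, hc⟩
  let q : G.Walk a c := p.map (SimpleGraph.Embedding.induce X).toHom
  refine ⟨q.bypass, q.bypass_isPath, fun v hv => ?_⟩
  have hv' := q.support_bypass_subset_support hv
  rw [show q.support = _ from SimpleGraph.Walk.support_map _ _, List.mem_map] at hv'
  obtain ⟨y, -, rfl⟩ := hv'
  exact y.2

/-- If the subtrees `X` and `Y` meet and `Y` has an element that is not after the first element
`a` of `X`, then `a` is an element of `Y`. -/
theorem first_mem_of_meet (hG : G.IsAcyclic) (hidx : Function.Injective idx) {r : W}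
    (hr : ∀ w, w ≠ r → ∃ w', G.Adj w w' ∧ idx w' < idx w) {X Y : Set W}
    (hX : (G.induce X).Connected) (hY : (G.induce Y).Connected) {a b c : W} (ha : a ∈ X)
    (hmin : ∀ w ∈ X, idx a ≤ idx w) (hb : b ∈ Y) (hba : idx b ≤ idx a) (hcX : c ∈ X)
    (hcY : c ∈ Y) : a ∈ Y := by
  obtain ⟨p, hp⟩ := exists_walk_to_root hr a
  obtain ⟨q, hq⟩ := exists_walk_to_root hr b
  obtain ⟨p₂, hp₂, hsub₂⟩ := exists_path_of_induce_connected hX ha hcX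
  obtain ⟨p₃, hp₃, hsub₃⟩ := exists_path_of_induce_connected hY hb hcY
  -- From `b` to the root and on to `a`: no node on this route comes after `a`.
  set p₁ := (q.append p.reverse).bypass
  have hsub₁ : ∀ v ∈ p₁.support, idx v ≤ idx a := by
    intro v hv
    have hv' := (q.append p.reverse).support_bypass_subset_support hv
    rw [SimpleGraph.Walk.mem_support_append_iff, SimpleGraph.Walk.support_reverse,
      List.mem_reverse] at hv'
    rcases hv' with h | h
    · exact (hq v h).trans hba
    · exact hp v h
  -- The path `p₂` stays in `X`, where no node comes before `a`, so it meets `p₁` only in `a`.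
  have hpath : (p₁.append p₂).IsPath := by
    rw [SimpleGraph.Walk.isPath_def, SimpleGraph.Walk.support_append]
    have h2 := hp₂.support_nodup
    rw [← SimpleGraph.Walk.cons_tail_support, List.nodup_cons] at h2
    refine List.nodup_append.2 ⟨(SimpleGraph.Walk.bypass_isPath _).support_nodup, h2.2, ?_⟩
    rintro v hv v' hv' rfl
    have h3 : v ∈ X := hsub₂ v (List.mem_of_mem_tail hv')
    have h4 : v = a := hidx (le_antisymm (hsub₁ v hv) (hmin v h3))
    exact h2.1 (h4 ▸ hv')
  -- Paths in an acyclic graph are unique, so this path through `a` is the one that stays inside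
  -- `Y`.
  have heq : (⟨_, hpath⟩ : G.Path b c) = ⟨_, hp₃⟩ := (hG.subsingleton_path b c).elim _ _
  have heq' : p₁.append p₂ = p₃ := congrArg Subtype.val heq
  refine hsub₃ a ?_
  rw [← heq', SimpleGraph.Walk.mem_support_append_iff]
  exact Or.inl p₁.end_mem_support

end Tree

/-! ### The partition function -/

namespace ConstraintSystem

variable (F : ConstraintSystem)

/-- The interaction of two vertices, given by their numbers. -/
def pairWeight (x y : ℕ) (a b : ℤ) : ℤ := 1 + b * (a * F.matA x y + (1 - a) * F.matB x y)

/-- The number of a vertex. -/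
def num (v : F.Vertex) : ℕ := (F.vertexNumber v : ℕ)

theorem num_inl (x : Fin F.numVars) : F.num (.inl x) = x := rfl

theorem num_inr (j : Fin F.numCons) : F.num (.inr j) = F.numVars + j := rfl

theorem num_lt (v : F.Vertex) : F.num v < F.numVars + F.numCons := (F.vertexNumber v).2

theorem num_injective : Function.Injective F.num := fun _ _ h =>
  finSumFinEquiv.injective (Fin.ext h)

variable {F}

theorem pairWeight_inl (p : F.Vertex) (y : Fin F.numVars) (a b : ℤ) :
    F.pairWeight (F.num p) (F.num (.inl y)) a b = 1 := by
  have : ¬ F.numVars ≤ (y : ℕ) := not_le.2 y.2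
  simp [pairWeight, matA, matB, num_inl, this]

theorem matA_inr_self (j : Fin F.numCons) :
    F.matA (F.num (.inr j)) (F.num (.inr j)) = (F.con j).coefSelf := by
  simp [matA, num_inr]

theorem matA_inl_inr (x : Fin F.numVars) (j : Fin F.numCons) :
    F.matA (F.num (.inl x)) (F.num (.inr j)) = (F.con j).coefA x := by
  have : (x : ℕ) ≠ F.numVars + j := by have := x.2; omega
  simp [matA, num_inr, num_inl, this]

theorem matB_inr (p : F.Vertex) (j : Fin F.numCons) :
    F.matB (F.num p) (F.num (.inr j)) = (F.con j).coefB (F.num p) := by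
  simp [matB, num_inr]

theorem coef_of_le {n : ℕ} (c : Constraint n) {x : ℕ} (hx : n ≤ x) :
    c.coefA x = 0 ∧ c.coefB x = 0 := by
  have : ∀ s : Finset (Fin n), x ∉ encodeFinset s := fun s h => by
    have := (mem_encodeFinset.1 h).1
    omega
  cases c <;> simp [Constraint.coefA, Constraint.coefB, this]

theorem coef_of_not_mem {n : ℕ} (c : Constraint n) {x : Fin n} (hx : x ∉ c.vars) :
    c.coefA x = 0 ∧ c.coefB x = 0 := by
  cases c with
  | clause pos neg =>
    simp only [Constraint.vars, Finset.mem_union, not_or] at hx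
    simp [Constraint.coefA, Constraint.coefB, mem_encodeFinset, hx]
  | xor vars rhs =>
    simp only [Constraint.vars] at hx
    simp [Constraint.coefA, Constraint.coefB, mem_encodeFinset, hx]

/-- Vertices that are not adjacent do not interact. -/
theorem pairWeight_of_not_adj {u v : F.Vertex} (hne : u ≠ v) (h : ¬ F.incidenceGraph.Adj u v)
    (a b : ℤ) : F.pairWeight (F.num u) (F.num v) a b = 1 := by
  cases v with
  | inl y => exact pairWeight_inl u y a b
  | inr j =>
    cases u with
    | inl x =>
      have hx : x ∉ (F.con j).vars := h
      have := coef_of_not_mem _ hx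
      simp only [pairWeight, matA_inl_inr, matB_inr]
      simp [num_inl, this]
    | inr l =>
      have hlj : F.num (.inr l) ≠ F.num (.inr j) := fun he => hne (F.num_injective he)
      have hle : F.numVars ≤ F.num (.inr l) := by rw [num_inr]; omega
      have := coef_of_le (F.con j) hle
      simp only [pairWeight, matB_inr, this.2]
      have : F.matA (F.num (.inr l)) (F.num (.inr j)) = 0 := by
        unfold matA
        split_ifs with h1
        · exact (coef_of_le _ hle).1
        · rfl
      simp [this]

/-- A constraint is a signed sum of two products over its variables. -/
theorem constraint_sum {n : ℕ} (c : Constraint n) (α : Fin n → Bool) :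
    1 + (1 + c.coefSelf) * ∏ x, (1 + ((α x).toNat * c.coefA x +
      (1 - (α x).toNat) * c.coefB x)) =
    2 ^ c.isXor.toNat * if c.eval α then 1 else 0 := by
  cases c with
  | clause pos neg =>
    -- A factor vanishes exactly when its variable makes a literal true, so the product indicates
    -- that the clause is falsified.
    have hfac : ∀ x : Fin n, (1 : ℤ) + ((α x).toNat * (Constraint.clause pos neg).coefA x +
        (1 - (α x).toNat) * (Constraint.clause pos neg).coefB x) =
        if (x ∈ pos ∧ α x = true) ∨ (x ∈ neg ∧ α x = false) then 0 else 1 := by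
      intro x
      cases hα : α x <;> by_cases h1 : x ∈ pos <;> by_cases h2 : x ∈ neg <;>
        simp [Constraint.coefA, Constraint.coefB, mem_encodeFinset, h1, h2]
    simp only [hfac, Constraint.coefSelf, Constraint.isXor, Bool.toNat_false, pow_zero, one_mul]
    by_cases hsat : ∃ x, (x ∈ pos ∧ α x = true) ∨ (x ∈ neg ∧ α x = false)
    · obtain ⟨x, hx⟩ := hsat
      have hzero : ∏ x, (if (x ∈ pos ∧ α x = true) ∨ (x ∈ neg ∧ α x = false) then (0 : ℤ)
          else 1) = 0 := Finset.prod_eq_zero (i := x) (Finset.mem_univ x) (if_pos hx)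
      rw [hzero]
      have : (Constraint.clause pos neg).eval α = true := by
        simp only [Constraint.eval, decide_eq_true_eq]
        rcases hx with hx | hx
        · exact Or.inl ⟨x, hx⟩
        · exact Or.inr ⟨x, hx⟩
      simp [this]
    · have hall : ∀ x, ¬ ((x ∈ pos ∧ α x = true) ∨ (x ∈ neg ∧ α x = false)) :=
        fun x hx => hsat ⟨x, hx⟩
      rw [Finset.prod_congr rfl fun x _ => if_neg (hall x)]
      have : (Constraint.clause pos neg).eval α = false := by
        simp only [Constraint.eval, decide_eq_false_iff_not]
        rintro (⟨x, hx⟩ | ⟨x, hx⟩)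
        · exact hall x (Or.inl hx)
        · exact hall x (Or.inr hx)
      simp [this]
  | xor vars rhs =>
    have hfac : ∀ x : Fin n, (1 : ℤ) + ((α x).toNat * (Constraint.xor vars rhs).coefA x +
        (1 - (α x).toNat) * (Constraint.xor vars rhs).coefB x) =
        if x ∈ vars then (-1) ^ (α x).toNat else 1 := by
      intro x
      cases hα : α x <;> by_cases h1 : x ∈ vars <;>
        simp [Constraint.coefA, Constraint.coefB, mem_encodeFinset, h1]
    -- The signs multiply to `(-1)` to the number of true variables; together with the self-factor
    -- `1 - 2 * rhs`, the left side is 2 if the parity is right and 0 otherwise.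
    rw [Finset.prod_congr rfl fun x _ => hfac x, Finset.prod_ite_mem, Finset.univ_inter,
      Finset.prod_pow_eq_pow_sum]
    simp only [Constraint.coefSelf, Constraint.isXor, Bool.toNat_true, pow_one, Constraint.eval,
      decide_eq_true_eq]
    rcases Nat.mod_two_eq_zero_or_one (∑ x ∈ vars, (α x).toNat) with h | h
    · rw [Even.neg_one_pow (Nat.even_iff.2 h), h]
      cases rhs <;> simp
    · rw [Odd.neg_one_pow (Nat.odd_iff.2 h), h]
      cases rhs <;> simp

/-- The sum over all assignments to the vertices of the product of all interactions. -/
theorem sum_prod_pairWeight : ∑ s : F.Vertex → Bool, ∏ p, ∏ q,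
    F.pairWeight (F.num p) (F.num q) (s p).toNat (s q).toNat = 2 ^ F.numXor * F.modelCount := by
  have h1 : ∀ s : F.Vertex → Bool, ∏ p, ∏ q,
      F.pairWeight (F.num p) (F.num q) (s p).toNat (s q).toNat = ∏ j : Fin F.numCons,
      if s (.inr j) then (1 + (F.con j).coefSelf) * ∏ x, (1 + ((s (.inl x)).toNat *
        (F.con j).coefA x + (1 - (s (.inl x)).toNat) * (F.con j).coefB x)) else 1 := by
    intro s
    -- Group by the second vertex of the pair: a variable in that position contributes 1.
    rw [Finset.prod_comm, Fintype.prod_sum_type,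
      Finset.prod_eq_one fun y _ => Finset.prod_eq_one fun p _ => pairWeight_inl p y _ _, one_mul]
    refine Finset.prod_congr rfl fun j _ => ?_
    rw [Fintype.prod_sum_type]
    have h2 : ∏ l : Fin F.numCons, F.pairWeight (F.num (.inr l)) (F.num (.inr j))
        (s (.inr l)).toNat (s (.inr j)).toNat = F.pairWeight (F.num (.inr j)) (F.num (.inr j))
        (s (.inr j)).toNat (s (.inr j)).toNat := by
      refine Finset.prod_eq_single j (fun l _ hl => ?_) (by simp)
      exact pairWeight_of_not_adj (by simpa using hl)
        (show ¬ F.incidenceGraph.Adj (.inr l) (.inr j) from fun h => h) _ _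
    rw [h2]
    have h3 := (coef_of_le (F.con j) (x := F.num (.inr j)) (by rw [num_inr]; omega)).2
    cases hs : s (.inr j)
    · simp [pairWeight]
    · simp only [pairWeight, matA_inr_self, matB_inr, matA_inl_inr, h3]
      simp [num_inl]
      ring
  rw [Finset.sum_congr rfl fun s _ => h1 s,
    ← (Equiv.sumArrowEquivProdArrow _ _ Bool).symm.sum_comp, Fintype.sum_prod_type]
  have h4 : ∀ α : Fin F.numVars → Bool, ∑ h : Fin F.numCons → Bool, ∏ j,
      (if h j then (1 + (F.con j).coefSelf) * ∏ x, (1 + ((α x).toNat *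
        (F.con j).coefA x + (1 - (α x).toNat) * (F.con j).coefB x)) else 1) =
      2 ^ F.numXor * if ∀ j, (F.con j).eval α = true then 1 else 0 := by
    intro α
    -- Once the variables are fixed, the constraint bits are independent: the sum of products is a
    -- product of two-term sums.
    have h5 := Finset.prod_univ_sum (fun _ : Fin F.numCons => (Finset.univ : Finset Bool))
      (fun j b => if b then (1 + (F.con j).coefSelf) * ∏ x, (1 + ((α x).toNat *
        (F.con j).coefA x + (1 - (α x).toNat) * (F.con j).coefB x)) else 1)
    rw [Fintype.piFinset_univ] at h5
    rw [← h5]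
    have h6 : ∀ j : Fin F.numCons, ∑ b : Bool, (if b then (1 + (F.con j).coefSelf) * ∏ x,
        (1 + ((α x).toNat * (F.con j).coefA x + (1 - (α x).toNat) * (F.con j).coefB x)) else 1) =
        2 ^ (F.con j).isXor.toNat * if (F.con j).eval α then 1 else 0 := by
      intro j
      rw [← constraint_sum, Fintype.sum_bool]
      simp
      ring
    rw [Finset.prod_congr rfl fun j _ => h6 j, Finset.prod_mul_distrib,
      Finset.prod_pow_eq_pow_sum, numXor]
    congr 1
    split_ifs with hall
    · exact Finset.prod_eq_one fun j _ => by simp [hall j]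
    · push Not at hall
      obtain ⟨j, hj⟩ := hall
      exact Finset.prod_eq_zero (Finset.mem_univ j) (by simp [hj])
  refine (Finset.sum_congr rfl fun α _ => h4 α).trans ?_
  rw [← Finset.mul_sum, modelCount, Finset.sum_ite, Finset.sum_const_zero, add_zero,
    Finset.sum_const, nsmul_eq_mul, mul_one]

end ConstraintSystem

end ModelCounting

namespace ModelCounting

/-! ### From tree decompositions to scopes -/

section Decomposition

variable {F : ConstraintSystem} (T : TreeDecomposition F.incidenceGraph)

open Classical in
/-- The numbers of the neighbours of a node. -/
noncomputable def nbrList (t : ℕ) : List ℕ :=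
  if h : t < T.numNodes then encodeFinset (Finset.univ.filter (T.tree.Adj ⟨t, h⟩)) else []

/-- The numbers of the vertices in the bag of a node. -/
def bagList (t : ℕ) : List ℕ :=
  if h : t < T.numNodes then encodeFinset ((T.bag ⟨t, h⟩).image F.vertexNumber) else []

theorem mem_nbrList {t u : ℕ} : u ∈ nbrList T t ↔
    ∃ (ht : t < T.numNodes) (hu : u < T.numNodes), T.tree.Adj ⟨t, ht⟩ ⟨u, hu⟩ := by
  unfold nbrList
  split_ifs with h
  · simp [mem_encodeFinset, h]
  · simp [h]

theorem mem_bagList {t v : ℕ} : v ∈ bagList T t ↔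
    ∃ (ht : t < T.numNodes), ∃ w ∈ T.bag ⟨t, ht⟩, F.num w = v := by
  unfold bagList
  split_ifs with h
  · simp only [mem_encodeFinset, Finset.mem_image]
    constructor
    · rintro ⟨hv, w, hw, he⟩
      exact ⟨h, w, hw, by rw [ConstraintSystem.num, he]⟩
    · rintro ⟨_, w, hw, he⟩
      exact ⟨he ▸ F.num_lt w, w, hw, Fin.ext he⟩
  · simp [h]

theorem num_mem_bagList {t : Fin T.numNodes} {w : F.Vertex} :
    F.num w ∈ bagList T t ↔ w ∈ T.bag t := by
  rw [mem_bagList]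
  constructor
  · rintro ⟨_, w', hw', he⟩
    rwa [F.num_injective he] at hw'
  · exact fun h => ⟨t.2, w, h, rfl⟩

theorem length_bagList (t : Fin T.numNodes) : (bagList T t).length = (T.bag t).card := by
  rw [bagList, dif_pos t.2, length_encodeFinset, Finset.card_image_of_injective]
  exact finSumFinEquiv.injective

theorem nodup_bagList (t : ℕ) : (bagList T t).Nodup := by
  unfold bagList
  split_ifs
  · exact nodup_encodeFinset _
  · simp

theorem encodeDecomposition_eq : encodeDecomposition F T =
    T.numNodes :: (List.range T.numNodes).flatMap fun t =>
      withLength (nbrList T t) ++ withLength (bagList T t) := by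
  unfold encodeDecomposition
  rw [List.singleton_append, ← List.map_coe_finRange_eq_range, List.flatMap_map]
  congr 2
  funext t
  have h2 := length_bagList T t
  have h3 : bagList T t = encodeFinset ((T.bag t).image F.vertexNumber) := by
    rw [bagList, dif_pos t.2]
  rw [withLength, withLength, h2, h3, nbrList, dif_pos t.2, length_encodeFinset]
  simp

theorem numNodes_pos : 0 < T.numNodes := by
  obtain ⟨t⟩ := T.isTree.connected.nonempty
  exact t.pos

theorem nbrList_lt {t u : ℕ} (h : u ∈ nbrList T t) : u < T.numNodes :=
  ((mem_nbrList T).1 h).2.1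

theorem nbrList_connected (C : ℕ → Prop) (h0 : C 0)
    (hC : ∀ t < T.numNodes, C t → ∀ u ∈ nbrList T t, C u) : ∀ t < T.numNodes, C t := by
  intro t ht
  obtain ⟨p⟩ := T.isTree.connected.preconnected ⟨0, numNodes_pos T⟩ ⟨t, ht⟩
  have key : ∀ (u v : Fin T.numNodes), T.tree.Walk u v → C u → C v := by
    intro u v p
    induction p with
    | nil => exact id
    | cons h _ ih => exact fun hu => ih (hC _ (Fin.is_lt _) hu _ ((mem_nbrList T).2 ⟨_, Fin.is_lt _, h⟩))
  exact key _ _ p h0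

/-- The search order of the nodes. -/
noncomputable def nodeOrder : ℕ → ℕ := searchOrder (nbrList T) T.numNodes

theorem nodeOrder_lt {i : ℕ} (hi : i < T.numNodes) : nodeOrder T i < T.numNodes :=
  searchOrder_lt (numNodes_pos T) (fun _ _ _ => nbrList_lt T) (nbrList_connected T) hi

theorem nodeOrder_surj {t : ℕ} (ht : t < T.numNodes) : ∃ i < T.numNodes, nodeOrder T i = t :=
  searchOrder_surj (numNodes_pos T) (fun _ _ _ => nbrList_lt T) (nbrList_connected T) ht

theorem nodeOrder_inj {i j : ℕ} (hi : i < T.numNodes) (hj : j < T.numNodes)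
    (h : nodeOrder T i = nodeOrder T j) : i = j :=
  searchOrder_injOn (numNodes_pos T) (fun _ _ _ => nbrList_lt T) (nbrList_connected T) hi hj h

theorem sum_nodeOrder (g : ℕ → ℕ) :
    ∑ i ∈ Finset.range T.numNodes, g (nodeOrder T i) = ∑ t ∈ Finset.range T.numNodes, g t :=
  sum_searchOrder (numNodes_pos T) (fun _ _ _ => nbrList_lt T) (nbrList_connected T) g

theorem nodeOrder_parent {i : ℕ} (h0 : 0 < i) (hi : i < T.numNodes) :
    ∃ i' < i, nodeOrder T i ∈ nbrList T (nodeOrder T i') :=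
  searchOrder_parent (numNodes_pos T) (fun _ _ _ => nbrList_lt T) (nbrList_connected T) h0 hi

/-- The numbers of the vertices, in the order of their discovery. -/
noncomputable def vertexList : List ℕ := discovered (bagList T) (nodeOrder T) T.numNodes

theorem vertexList_nodup : (vertexList T).Nodup := discovered_nodup _

theorem mem_vertexList {v : ℕ} : v ∈ vertexList T ↔ v < F.numVars + F.numCons := by
  rw [vertexList, mem_discovered]
  constructor
  · rintro ⟨i, -, h⟩
    obtain ⟨_, w, -, rfl⟩ := (mem_bagList T).1 h
    exact F.num_lt w
  · intro hv
    obtain ⟨w, hw⟩ := finSumFinEquiv.surjective (⟨v, hv⟩ : Fin (F.numVars + F.numCons))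
    obtain ⟨t, ht⟩ := T.cover w
    obtain ⟨i, hi, he⟩ := nodeOrder_surj T t.2
    refine ⟨i, hi, ?_⟩
    rw [he, show v = F.num w from (congrArg Fin.val hw).symm, num_mem_bagList]
    exact ht

theorem length_vertexList : (vertexList T).length = F.numVars + F.numCons := by
  have h : (vertexList T).toFinset = Finset.range (F.numVars + F.numCons) := by
    ext v
    rw [List.mem_toFinset, mem_vertexList, Finset.mem_range]
  rw [← List.toFinset_card_of_nodup (vertexList_nodup T), h, Finset.card_range]

/-- The vertex of a given rank. -/
noncomputable def vertexOf (r : Fin (F.numVars + F.numCons)) : F.Vertex :=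
  finSumFinEquiv.symm ⟨(vertexList T)[r]'(by rw [length_vertexList]; exact r.2),
    (mem_vertexList T).1 (List.getElem_mem _)⟩

/-- The number of the vertex of a given rank. -/
noncomputable def ordOf (r : ℕ) : ℕ := (vertexList T).getD r 0

/-- The rank of the vertex with a given number. -/
noncomputable def rankOf (v : ℕ) : ℕ := (vertexList T).idxOf v

/-- The first node whose bag contains the vertex of a given rank. -/
noncomputable def topOf (r : ℕ) : ℕ := top (bagList T) (nodeOrder T) r

theorem ordOf_eq {r : ℕ} (hr : r < (vertexList T).length) : ordOf T r = (vertexList T)[r] :=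
  List.getD_eq_getElem _ _ hr

theorem num_vertexOf (r : Fin (F.numVars + F.numCons)) : F.num (vertexOf T r) = ordOf T r := by
  rw [ordOf_eq T (by rw [length_vertexList]; exact r.2)]
  exact congrArg Fin.val (finSumFinEquiv.apply_symm_apply _)

theorem ordOf_lt {r : ℕ} (hr : r < F.numVars + F.numCons) :
    ordOf T r < F.numVars + F.numCons := num_vertexOf T ⟨r, hr⟩ ▸ F.num_lt _

theorem rankOf_ordOf {r : ℕ} (hr : r < F.numVars + F.numCons) : rankOf T (ordOf T r) = r := by
  rw [← length_vertexList T] at hr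
  rw [ordOf_eq T hr, rankOf, (vertexList_nodup T).idxOf_getElem]

theorem rankOf_lt {v : ℕ} (hv : v < F.numVars + F.numCons) :
    rankOf T v < F.numVars + F.numCons := by
  rw [← length_vertexList T]
  exact List.idxOf_lt_length_iff.2 ((mem_vertexList T).2 hv)

theorem ordOf_rankOf {v : ℕ} (hv : v < F.numVars + F.numCons) : ordOf T (rankOf T v) = v := by
  rw [ordOf_eq T (by rw [length_vertexList]; exact rankOf_lt T hv)]
  exact List.getElem_idxOf _

theorem vertexOf_bijective : Function.Bijective (vertexOf T) := by
  rw [Fintype.bijective_iff_injective_and_card]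
  refine ⟨fun r r' h => ?_, by simp⟩
  have h' := congrArg (fun v => rankOf T (F.num v)) h
  simp only [num_vertexOf, rankOf_ordOf T r.2, rankOf_ordOf T r'.2] at h'
  exact Fin.ext h'

theorem topOf_lt {r : ℕ} (hr : r < F.numVars + F.numCons) : topOf T r < T.numNodes :=
  top_lt (by rw [← length_vertexList T] at hr; exact hr)

theorem ordOf_mem_top {r : ℕ} (hr : r < F.numVars + F.numCons) :
    ordOf T r ∈ bagList T (nodeOrder T (topOf T r)) := by
  rw [← length_vertexList T] at hr
  rw [ordOf_eq T hr]
  exact mem_bag_top hr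

theorem topOf_le {r i : ℕ} (hr : r < F.numVars + F.numCons)
    (h : ordOf T r ∈ bagList T (nodeOrder T i)) : topOf T r ≤ i := by
  rw [← length_vertexList T] at hr
  rw [ordOf_eq T hr] at h
  by_contra hlt
  exact not_mem_bag_of_lt_top hr (not_le.1 hlt) h

theorem topOf_mono {r r' : ℕ} (h : r ≤ r') (hr' : r' < F.numVars + F.numCons) :
    topOf T r ≤ topOf T r' := by
  rw [← length_vertexList T] at hr'
  exact top_mono h hr'

/-- The vertices of rank at most `u` that share a bag with the vertex of rank `u` are in the
first bag of that vertex. -/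
theorem ordOf_mem_top_of_le {w u i : ℕ} (hwu : w ≤ u) (hu : u < F.numVars + F.numCons)
    (hi : i < T.numNodes) (h1 : ordOf T u ∈ bagList T (nodeOrder T i))
    (h2 : ordOf T w ∈ bagList T (nodeOrder T i)) :
    ordOf T w ∈ bagList T (nodeOrder T (topOf T u)) := by
  have hw : w < F.numVars + F.numCons := hwu.trans_lt hu
  -- The position of a node in the search order is the index for the tree argument.
  choose! pos hpos hord using fun t (ht : t < T.numNodes) => nodeOrder_surj T ht
  have hpos' : ∀ j < T.numNodes, pos (nodeOrder T j) = j := fun j hj =>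
    nodeOrder_inj T (hpos _ (nodeOrder_lt T hj)) hj (hord _ (nodeOrder_lt T hj))
  let idx : Fin T.numNodes → ℕ := fun t => pos t
  have hidx : Function.Injective idx := fun t t' h => by
    have := congrArg (nodeOrder T) h
    simp only [idx, hord _ t.2, hord _ t'.2] at this
    exact Fin.ext this
  have hparent : ∀ t, t ≠ (⟨nodeOrder T 0, nodeOrder_lt T (numNodes_pos T)⟩ : Fin T.numNodes) →
      ∃ t', T.tree.Adj t t' ∧ idx t' < idx t := by
    intro t ht
    have h0 : 0 < pos t := by
      by_contra h
      refine ht (Fin.ext ?_)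
      have := hord t t.2
      rw [show pos t = 0 by omega] at this
      exact this.symm
    obtain ⟨j, hj, hadj⟩ := nodeOrder_parent T h0 (hpos t t.2)
    rw [hord t t.2] at hadj
    obtain ⟨k1, k2, k3⟩ := (mem_nbrList T).1 hadj
    refine ⟨⟨_, k1⟩, k3.symm, ?_⟩
    have := hpos' j (hj.trans (hpos t t.2))
    simp only [idx, this, hj]
  have hmem : ∀ {r j : ℕ} (hr : r < F.numVars + F.numCons) (hj : j < T.numNodes),
      ordOf T r ∈ bagList T (nodeOrder T j) ↔
        vertexOf T ⟨r, hr⟩ ∈ T.bag ⟨nodeOrder T j, nodeOrder_lt T hj⟩ := by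
    intro r j hr hj
    rw [← num_mem_bagList, num_vertexOf]
  have htu := topOf_lt T hu
  have htw := topOf_lt T hw
  rw [hmem hw htu]
  -- The subtrees are those of the vertices of ranks `u` and `w`. They meet in the node at position
  -- `i`, and since `w ≤ u` the second does not start later than the first.
  refine first_mem_of_meet (G := T.tree) T.isTree.isAcyclic hidx hparent
    (T.connected (vertexOf T ⟨u, hu⟩)) (T.connected (vertexOf T ⟨w, hw⟩))
    ((hmem hu htu).1 (ordOf_mem_top T hu)) ?_ ((hmem hw htw).1 (ordOf_mem_top T hw)) ?_
    ((hmem hu hi).1 h1) ((hmem hw hi).1 h2)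
  · intro t ht
    simp only [idx, hpos' _ htu]
    refine topOf_le T hu ?_
    rw [hmem hu (hpos t t.2)]
    have : (⟨nodeOrder T (pos t), nodeOrder_lt T (hpos t t.2)⟩ : Fin T.numNodes) = t :=
      Fin.ext (hord t t.2)
    rw [this]
    exact ht
  · simp only [idx, hpos' _ htu, hpos' _ htw]
    exact topOf_mono T hwu hu

/-- The ranks of the scope of the vertex of rank `r`. -/
noncomputable def scopeOf (r : ℕ) : List ℕ :=
  ranksBelow (rankOf T) (bagList T (nodeOrder T (topOf T r))) r

theorem bagList_lt {t v : ℕ} (h : v ∈ bagList T t) : v < F.numVars + F.numCons := by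
  obtain ⟨_, w, -, rfl⟩ := (mem_bagList T).1 h
  exact F.num_lt w

theorem mem_scopeOf {r u : ℕ} (hr : r < F.numVars + F.numCons) : u ∈ scopeOf T r ↔
    u < r ∧ ordOf T u ∈ bagList T (nodeOrder T (topOf T r)) := by
  simp only [scopeOf, ranksBelow, List.mem_filter, List.mem_map, decide_eq_true_eq]
  constructor
  · rintro ⟨⟨v, hv, rfl⟩, hlt⟩
    exact ⟨hlt, by rwa [ordOf_rankOf T (bagList_lt T hv)]⟩
  · rintro ⟨hlt, h⟩
    exact ⟨⟨_, h, rankOf_ordOf T (hlt.trans hr)⟩, hlt⟩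

theorem nodup_scopeOf (r : ℕ) : (scopeOf T r).Nodup := by
  refine List.Nodup.filter _ (List.Nodup.map_on (fun v hv v' hv' h => ?_) (nodup_bagList T _))
  have := congrArg (ordOf T) h
  rwa [ordOf_rankOf T (bagList_lt T hv), ordOf_rankOf T (bagList_lt T hv')] at this

/-- The vertex of rank `r` belongs to its own first bag but not to its scope. The strict inequality
lets `|S r| + 1` be bounded by the width. -/
theorem length_scopeOf_lt {r : ℕ} (hr : r < F.numVars + F.numCons) :
    (scopeOf T r).length < T.width := by
  have h1 : (scopeOf T r).length < (bagList T (nodeOrder T (topOf T r))).length := by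
    rw [scopeOf, ranksBelow, ← List.length_map (rankOf T) (as := bagList T _)]
    refine (List.length_filter_lt_length_iff_exists (p := fun u => decide (u < r))).2
      ⟨r, List.mem_map.2 ⟨_, ordOf_mem_top T hr, rankOf_ordOf T hr⟩, by simp⟩
  refine h1.trans_le ?_
  have := length_bagList T ⟨_, nodeOrder_lt T (topOf_lt T hr)⟩
  simp only at this
  rw [this]
  exact Finset.le_sup (f := fun t => (T.bag t).card) (Finset.mem_univ _)

/-- The elimination data of a tree decomposition. -/
noncomputable def eliminationData : EliminationData where
  V := F.numVars + F.numCons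
  S := scopeOf T
  ord := ordOf T
  A := F.matA
  B := F.matB
  ord_lt _ hr := ordOf_lt T hr
  scope_lt _ hr _ hu := ((mem_scopeOf T hr).1 hu).1
  scope_nodup r _ := nodup_scopeOf T r
  -- Both `w` and the parent lie in the first bag of `c`; if `w` has smaller rank, it therefore lies
  -- in the first bag of the parent.
  chain c hc hne w hw := by
    have hp := parent_mem hne
    have hle := le_parent hw
    obtain ⟨h1, h2⟩ := (mem_scopeOf T hc).1 hp
    obtain ⟨h3, h4⟩ := (mem_scopeOf T hc).1 hw
    rcases hle.eq_or_lt with he | hlt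
    · exact Or.inl he
    · refine Or.inr ((mem_scopeOf T (h1.trans hc)).2 ⟨hlt, ?_⟩)
      exact ordOf_mem_top_of_le T hle (h1.trans hc) (topOf_lt T hc) h2 h4

/-- The ends of an edge share a bag, and `ordOf_mem_top_of_le` moves the earlier end to the first
bag of the later one. -/
theorem mem_scopeOf_of_adj {u r : ℕ} (hur : u < r) (hr : r < F.numVars + F.numCons)
    (h : F.incidenceGraph.Adj (vertexOf T ⟨u, hur.trans hr⟩) (vertexOf T ⟨r, hr⟩)) :
    u ∈ scopeOf T r := by
  obtain ⟨t, h1, h2⟩ := T.cover_edge _ _ h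
  obtain ⟨i, hi, he⟩ := nodeOrder_surj T t.2
  rw [← num_mem_bagList, num_vertexOf, ← he] at h1 h2
  exact (mem_scopeOf T hr).2 ⟨hur, ordOf_mem_top_of_le T hur.le hr hi h2 h1⟩

/-- With threshold 0 in `sumBits_localTerm`, only the roots remain on one side, while the other side
is the sum over all bit vectors, indexed by rank. The bijection `vertexOf` relabels it as the sum in
`sum_prod_pairWeight`. -/
theorem prod_msg : ∏ c ∈ (Finset.range (F.numVars + F.numCons)).filter
    (fun c => (eliminationData T).S c = []), (eliminationData T).msg c 0 =
    2 ^ F.numXor * F.modelCount := by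
  set D := eliminationData T
  have h1 := sumBits_localTerm D.scope_lt D.chain (f := D.f) D.V 0 (by simp) 0
  have h2 : (fun s => ∏ r ∈ Finset.Ico 0 D.V, localTerm D.S D.f r s) = fun s =>
      ∏ p ∈ Finset.range D.V, ∏ q ∈ Finset.range D.V, D.f p q (s p) (s q) := by
    funext s
    rw [← Finset.range_eq_Ico]
    refine prod_localTerm D.scope_lt D.scope_nodup (fun r hr u hur hu a b => ?_) s
    have hn : ¬ F.incidenceGraph.Adj (vertexOf T ⟨u, hur.trans hr⟩) (vertexOf T ⟨r, hr⟩) :=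
      fun h => hu (mem_scopeOf_of_adj T hur hr h)
    have hne : vertexOf T ⟨u, hur.trans hr⟩ ≠ vertexOf T ⟨r, hr⟩ := fun h => by
      exact hur.ne (congrArg Fin.val ((vertexOf_bijective T).1 h))
    have k1 := ConstraintSystem.pairWeight_of_not_adj hne hn a b
    have k2 := ConstraintSystem.pairWeight_of_not_adj hne.symm (fun h => hn h.symm) b a
    rw [num_vertexOf, num_vertexOf] at k1 k2
    exact ⟨k1, k2⟩
  let e : Fin (F.numVars + F.numCons) ≃ F.Vertex := Equiv.ofBijective _ (vertexOf_bijective T)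
  have he : ∀ r, F.num (e r) = ordOf T r := num_vertexOf T
  rw [h2, sumBits_eq_sum] at h1
  simp only [← Finset.range_eq_Ico, Nat.not_lt_zero, or_false] at h1
  refine h1.symm.trans ?_
  rw [← ConstraintSystem.sum_prod_pairWeight]
  refine Fintype.sum_equiv (e.arrowCongr (Equiv.refl Bool)) _ _ fun x => ?_
  have hx : ∀ r, e.arrowCongr (Equiv.refl Bool) x (e r) = x r := by simp
  rw [Finset.prod_range, ← e.prod_comp]
  refine Finset.prod_congr rfl fun p _ => ?_
  rw [Finset.prod_range, ← e.prod_comp]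
  refine Finset.prod_congr rfl fun q _ => ?_
  rw [hx p, hx q, he p, he q, dif_pos (by simp), dif_pos (by simp)]
  rfl

/-! ### Bounds for the running time -/

theorem sum_length_scopeOf_le : ∑ r ∈ Finset.range (F.numVars + F.numCons),
    (scopeOf T r).length ≤ T.width * (F.numVars + F.numCons) := by
  have := Finset.sum_le_card_nsmul (Finset.range (F.numVars + F.numCons))
    (fun r => (scopeOf T r).length) T.width
    fun r hr => (length_scopeOf_lt T (Finset.mem_range.1 hr)).le
  rwa [Finset.card_range, smul_eq_mul, mul_comm] at this

/-- The number of edges of the incidence graph is at most the width times the number of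
vertices. -/
theorem sum_card_vars_le : ∑ j, (F.con j).vars.card ≤ T.width * (F.numVars + F.numCons) := by
  refine le_trans ?_ (sum_length_scopeOf_le T)
  let rk : F.Vertex → ℕ := fun v => rankOf T (F.num v)
  have hrk : ∀ v, rk v < F.numVars + F.numCons := fun v => rankOf_lt T (F.num_lt v)
  have hinj : Function.Injective rk := fun v w h => by
    have := congrArg (ordOf T) h
    simp only [rk, ordOf_rankOf T (F.num_lt _)] at this
    exact F.num_injective this
  have hvert : ∀ v, vertexOf T ⟨rk v, hrk v⟩ = v := fun v => F.num_injective (by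
    rw [num_vertexOf]
    exact ordOf_rankOf T (F.num_lt v))
  have hadj : ∀ v w, F.incidenceGraph.Adj v w → rk v < rk w → rk v ∈ scopeOf T (rk w) := by
    intro v w h hlt
    refine mem_scopeOf_of_adj T hlt (hrk w) ?_
    rwa [hvert, hvert]
  have hcard : ∑ r ∈ Finset.range (F.numVars + F.numCons), (scopeOf T r).length =
      ((Finset.range (F.numVars + F.numCons)).sigma fun r => (scopeOf T r).toFinset).card := by
    rw [Finset.card_sigma]
    exact Finset.sum_congr rfl fun r _ =>
      (List.toFinset_card_of_nodup (nodup_scopeOf T r)).symm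
  have hcard' : ∑ j, (F.con j).vars.card =
      ((Finset.univ : Finset (Fin F.numCons)).sigma fun j => (F.con j).vars).card := by
    rw [Finset.card_sigma]
  rw [hcard, hcard']
  -- An incidence is charged to the pair formed by the larger and the smaller rank of its ends.
  -- Variables and constraints have different ranks, so the pair determines the incidence.
  refine Finset.card_le_card_of_injOn (fun e => if rk (.inl e.2) < rk (.inr e.1)
    then ⟨rk (.inr e.1), rk (.inl e.2)⟩ else ⟨rk (.inl e.2), rk (.inr e.1)⟩) ?_ ?_
  · rintro ⟨j, x⟩ he
    simp only [Finset.coe_sigma, Set.mem_sigma_iff, Finset.mem_coe, Finset.mem_univ,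
      true_and] at he
    have h1 : F.incidenceGraph.Adj (.inl x) (.inr j) := he
    simp only
    split_ifs with hlt
    · simp [hrk, hadj _ _ h1 hlt]
    · have hne : rk (.inl x) ≠ rk (.inr j) := fun h => by simpa using hinj h
      simp [hrk, hadj _ _ h1.symm (by omega)]
  · rintro ⟨j, x⟩ - ⟨j', x'⟩ - he
    simp only at he
    have hkey : ∀ (a : Fin F.numVars) (b : Fin F.numCons), rk (.inl a) ≠ rk (.inr b) :=
      fun a b h => by simpa using hinj h
    split_ifs at he <;> simp only [Sigma.mk.injEq, heq_eq_eq] at he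
    · obtain ⟨h1, h2⟩ := he
      have k1 := hinj h1
      have k2 := hinj h2
      simp only [Sum.inr.injEq, Sum.inl.injEq] at k1 k2
      rw [k1, k2]
    · exact absurd he.1.symm (hkey _ _)
    · exact absurd he.1 (hkey _ _)
    · obtain ⟨h1, h2⟩ := he
      have k1 := hinj h1
      have k2 := hinj h2
      simp only [Sum.inr.injEq, Sum.inl.injEq] at k1 k2
      rw [k1, k2]

/-- Degrees sum to twice the number of edges, and a tree has fewer edges than nodes. -/
theorem sum_length_nbrList_le :
    ∑ t ∈ Finset.range T.numNodes, (nbrList T t).length ≤ 2 * T.numNodes := by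
  classical
  rw [Finset.sum_range]
  have h1 : ∀ t : Fin T.numNodes, (nbrList T t).length = T.tree.degree t := by
    intro t
    rw [nbrList, dif_pos t.2, length_encodeFinset, SimpleGraph.degree]
    congr 1
    ext u
    simp
  rw [Finset.sum_congr rfl fun t _ => h1 t, SimpleGraph.sum_degrees_eq_twice_card_edges]
  have := T.isTree.card_edgeFinset
  rw [Fintype.card_fin] at this
  omega

theorem sum_length_bagList : ∑ t ∈ Finset.range T.numNodes, (bagList T t).length =
    ∑ t, (T.bag t).card := by
  rw [Finset.sum_range]
  exact Finset.sum_congr rfl fun t _ => length_bagList T t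

/-- Each vertex has at most one parent. Thus the work on child tables adds no factor beyond the
number of vertices. -/
theorem sum_length_children_le (S : ℕ → List ℕ) (V : ℕ) :
    ∑ r ∈ Finset.range V, (children V S r).length ≤ V := by
  have h1 : ∀ r, (children V S r).length =
      (((Finset.range V).filter fun c => S c ≠ []).filter fun c => parent S c = r).card := by
    intro r
    rw [← List.toFinset_card_of_nodup (l := children V S r) (List.nodup_range.filter _)]
    congr 1
    ext c
    simp [mem_children, and_assoc]
  rw [Finset.sum_congr rfl fun r _ => h1 r]
  have h2 : ∀ s : Finset ℕ, ∑ r ∈ Finset.range V, (s.filter fun c => parent S c = r).card ≤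
      s.card := by
    intro s
    rw [← Finset.card_biUnion]
    · exact Finset.card_le_card (Finset.biUnion_subset.2 fun r _ => Finset.filter_subset _ _)
    · intro r _ r' _ hne
      refine Finset.disjoint_filter.2 fun c _ h h' => hne (h.symm.trans h')
  refine (h2 _).trans ((Finset.card_filter_le _ _).trans ?_)
  simp

/-- The factor 2 is for variables that occur in a clause with both signs. -/
theorem length_encode_le {n : ℕ} (c : Constraint n) : c.encode.length ≤ 3 + 2 * c.vars.card := by
  cases c with
  | clause pos neg =>
    have h1 := Finset.card_le_card (Finset.subset_union_left (s₁ := pos) (s₂ := neg))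
    have h2 := Finset.card_le_card (Finset.subset_union_right (s₁ := pos) (s₂ := neg))
    simp [Constraint.encode, Constraint.vars, length_encodeFinset]
    omega
  | xor vars rhs =>
    simp [Constraint.encode, Constraint.vars, length_encodeFinset]
    omega

end Decomposition

end ModelCounting

namespace ModelCounting

/-! ### The whole algorithm -/

section Main

open Algo

variable {F : ConstraintSystem} (T : TreeDecomposition F.incidenceGraph)

theorem runs_header {σ : Store} {n m : ℕ} {r : List ℕ} (h : HasInput (n :: m :: r) σ) :
    Runs header σ (fun τ => τ.reg 1 = n ∧ τ.reg 2 = m ∧ τ.reg 3 = (n + m : ℕ) ∧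
      τ.reg 4 = (2 : ℕ) ∧ τ.arr 16 0 = 1) 30 := by
  have h0 : σ.arr 0 0 = n := by simpa using h 0
  have h1 : σ.arr 0 1 = m := by simpa using h 1
  refine Runs.block_end rfl ?_ (by decide)
  simp [header, Program.apply, h0, h1]

theorem numXor_le : F.numXor ≤ F.numCons := by
  have := Finset.sum_le_card_nsmul (Finset.univ : Finset (Fin F.numCons))
    (fun j => (F.con j).isXor.toNat) 1 fun j _ => Bool.toNat_le _
  simpa [ConstraintSystem.numXor] using this

theorem modelCount_le : F.modelCount ≤ 2 ^ F.numVars := by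
  refine (Finset.card_le_univ _).trans ?_
  simp

/-- A bound for the running time of the algorithm. -/
noncomputable def timeBound : ℕ :=
  30 + (20 * (F.numVars + F.numCons + 1) +
    ((∑ j, 70 * ((F.con j).encode.length + 1) + 10) + (50 * (T.numNodes + 1) +
    ((70 * (∑ t ∈ Finset.range T.numNodes, ((nbrList T t).length + 1)) + 20) +
    ((80 * (∑ i ∈ Finset.range T.numNodes, ((bagList T (nodeOrder T i)).length + 1)) + 20) +
    ((100 * (∑ r ∈ Finset.range (F.numVars + F.numCons),
      ((bagList T (nodeOrder T (topOf T r))).length + 1)) + 20) +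
    ((∑ r ∈ Finset.range (F.numVars + F.numCons), 820 * 2 ^ (scopeOf T r).length *
      ((scopeOf T r).length + 1) *
        ((children (F.numVars + F.numCons) (scopeOf T) r).length + 1) + 10) +
    60 * (F.numVars + 2))))))))

theorem runs_main : Runs main (initialStore (F.encode ++ encodeDecomposition F T))
    (fun τ => τ.reg 0 = F.modelCount) (timeBound T) := by
  set w := F.encode ++ encodeDecomposition F T
  set σ₀ := initialStore w
  have hI₀ : HasInput w σ₀ := fun i => rfl
  have r₀ : ∀ x, σ₀.reg x = 0 := fun _ => rfl
  have a₀ : ∀ a, a ≠ 0 → ∀ i, σ₀.arr a i = 0 := fun a ha i => if_neg ha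
  have hdrop : w.drop 2 = ((List.finRange F.numCons).flatMap fun j => (F.con j).encode) ++
      encodeDecomposition F T := rfl
  have hV : (vertexList T).length = F.numVars + F.numCons := length_vertexList T
  -- The bound is bracketed like the right-associated phases, so each sequencing step closes with
  -- `le_rfl`.
  unfold main timeBound
  refine Runs.seq (runs_header (n := F.numVars) (m := F.numCons) hI₀) (fun σ₁ f₁ h₁ => ?_) le_rfl
  obtain ⟨n₁, m₁, v₁, p₁, z₁⟩ := h₁
  have hI₁ := hI₀.frame f₁ (by decide)
  refine Runs.seq (runs_powers v₁ z₁) (fun σ₂ f₂ pow₂ => ?_) le_rfl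
  have hI₂ := hI₁.frame f₂ (by decide)
  have n₂ := (f₂.reg 1 (by decide)).trans n₁
  have v₂ := (f₂.reg 3 (by decide)).trans v₁
  -- Arrays not written so far are still zero; the later phases rely on this as their
  -- initialisation.
  have arr₂ : ∀ a ∉ 0 :: (header ;; powers).arrs, ∀ i, σ₂.arr a i = 0 := by
    intro a ha i
    simp only [List.mem_cons, Program.arrs, List.mem_append, not_or] at ha
    rw [f₂.arr a ha.2.2, f₁.arr a ha.2.1, a₀ a ha.1]
  have reg₂ : ∀ x ∉ (header ;; powers).regs, σ₂.reg x = 0 := by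
    intro x hx
    simp only [Program.regs, List.mem_append, not_or] at hx
    rw [f₂.reg x hx.2, f₁.reg x hx.1, r₀]
  refine Runs.seq (runs_parseSystem hI₂ hdrop n₂ ((f₂.reg 2 (by decide)).trans m₁) v₂
    ((f₂.reg 4 (by decide)).trans p₁) (reg₂ 11 (by decide)) (arr₂ 1 (by decide))
    (arr₂ 2 (by decide))) (fun σ₃ f₃ h₃ => ?_) le_rfl
  obtain ⟨⟨p, p₃, hp⟩, x₃, A₃, B₃⟩ := h₃
  have hI₃ := hI₂.frame f₃ (by decide)
  refine Runs.seq (runs_parseTree hI₃ p₃ (hp.trans (encodeDecomposition_eq T)))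
    (fun σ₄ f₄ h₄ => ?_) le_rfl
  obtain ⟨N₄, nbr₄, bag₄⟩ := h₄
  have arr₄ : ∀ a ∉ 0 :: (header ;; powers ;; parseSystem ;; parseTree).arrs,
      ∀ i, σ₄.arr a i = 0 := by
    intro a ha i
    simp only [List.mem_cons, Program.arrs, List.mem_append, not_or] at ha
    rw [f₄.arr a ha.2.2.2.2, f₃.arr a ha.2.2.2.1, f₂.arr a ha.2.2.1, f₁.arr a ha.2.1, a₀ a ha.1]
  refine Runs.seq (runs_search (numNodes_pos T) (fun _ _ _ => nbrList_lt T) (nbrList_connected T)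
    N₄ nbr₄ (arr₄ 5 (by decide)) (arr₄ 6 (by decide))) (fun σ₅ f₅ ord₅ => ?_) le_rfl
  have hr19 : σ₅.reg 19 = 0 := by
    rw [f₅.reg 19 (by decide), f₄.reg 19 (by decide), f₃.reg 19 (by decide), reg₂ 19 (by decide)]
  refine Runs.seq (runs_rankVertices (o := nodeOrder T) (fun i hi => nodeOrder_lt T hi)
    ((f₅.reg 5 (by decide)).trans N₄) hr19 ord₅ (bag₄.frame f₅ (by decide) (by decide))
    (fun i => by rw [f₅.arr 7 (by decide), arr₄ 7 (by decide)])) (fun σ₆ f₆ h₆ => ?_) le_rfl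
  obtain ⟨rank₆, top₆⟩ := h₆
  have v₆ : σ₆.reg 3 = (F.numVars + F.numCons : ℕ) := by
    rw [f₆.reg 3 (by decide), f₅.reg 3 (by decide), f₄.reg 3 (by decide), f₃.reg 3 (by decide), v₂]
  refine Runs.seq (runs_scopes (bag := fun r => bagList T (nodeOrder T (topOf T r)))
    (rk := rankOf T) v₆ (fun r hr => top₆ r (hr.trans_eq hV.symm)) (fun r _ v hv => ?_)
    (fun i => ?_) (fun r _ => nodup_scopeOf T r)) (fun σ₇ f₇ h₇ => ?_) le_rfl
  · exact (rank₆.mark v).trans (if_pos ((mem_vertexList T).2 (bagList_lt T hv)))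
  · rw [f₆.arr 13 (by decide), f₅.arr 13 (by decide), arr₄ 13 (by decide)]
  obtain ⟨len₇, scope₇, child₇⟩ := h₇
  have hold₇ : (eliminationData T).Holds σ₇ := by
    refine ⟨(f₇.reg 3 (by decide)).trans v₆, fun p q _ hq => ?_, fun p q _ hq => ?_,
      fun r hr => ?_, len₇, scope₇, fun r hr => (child₇ r hr).1, fun r hr => (child₇ r hr).2,
      fun i hi => ?_⟩
    · rw [f₇.arr 1 (by decide), f₆.arr 1 (by decide), f₅.arr 1 (by decide), f₄.arr 1 (by decide)]
      exact A₃ p q hq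
    · rw [f₇.arr 2 (by decide), f₆.arr 2 (by decide), f₅.arr 2 (by decide), f₄.arr 2 (by decide)]
      exact B₃ p q hq
    · have hr' := hr.trans_eq hV.symm
      rw [f₇.arr 8 (by decide), rank₆.get r hr']
      exact congrArg _ (ordOf_eq T hr').symm
    · rw [f₇.arr 16 (by decide), f₆.arr 16 (by decide), f₅.arr 16 (by decide),
        f₄.arr 16 (by decide), f₃.arr 16 (by decide)]
      exact pow₂ i hi
  refine Runs.seq (EliminationData.runs_eliminateAll hold₇) (fun σ₈ f₈ h₈ => ?_) le_rfl
  have h27 := h₈.trans (prod_msg T)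
  -- At most `numCons` constraints are XORs, so the stored powers of two, up to the number of
  -- vertices, suffice.
  refine runs_divide (n := F.numVars) (x := F.numXor) ?_ ?_
    (Nat.add_le_add_left numXor_le F.numVars) ?_ (by exact_mod_cast h27) ?_ modelCount_le
  · rw [f₈.reg 1 (by decide), f₇.reg 1 (by decide), f₆.reg 1 (by decide), f₅.reg 1 (by decide),
      f₄.reg 1 (by decide), f₃.reg 1 (by decide), n₂]
  · rw [f₈.reg 11 (by decide), f₇.reg 11 (by decide), f₆.reg 11 (by decide),
      f₅.reg 11 (by decide), f₄.reg 11 (by decide), x₃]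
  · intro i hi
    rw [f₈.arr 16 (by decide)]
    exact hold₇.pow i hi
  · rw [f₈.reg 0 (by decide), f₇.reg 0 (by decide), f₆.reg 0 (by decide), f₅.reg 0 (by decide),
      f₄.reg 0 (by decide), f₃.reg 0 (by decide), reg₂ 0 (by decide)]

theorem length_bagList_le (t : ℕ) : (bagList T t).length ≤ T.width := by
  by_cases ht : t < T.numNodes
  · rw [length_bagList T ⟨t, ht⟩]
    exact Finset.le_sup (f := fun t => (T.bag t).card) (Finset.mem_univ _)
  · simp [bagList, ht]

theorem graphSize_eq : F.graphSize = F.numVars + F.numCons := by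
  simp [ConstraintSystem.graphSize]

/-- If the graph has a vertex, then the width is positive. -/
theorem graphSize_le_width_mul : F.graphSize ≤ T.width * F.graphSize := by
  rcases Nat.eq_zero_or_pos F.graphSize with h | h
  · simp [h]
  · rw [graphSize_eq] at h
    exact Nat.le_mul_of_pos_left _ (Nat.zero_lt_of_lt (length_scopeOf_lt T h))

/-- Elimination costs at most `2 * 820` times `2^k * k * |G_F|`, the factor 2 coming from `children
+ 1` summed over all vertices. Parsing the system and computing the scopes is `O(k * |G_F|)`, and
handling the tree is linear in its size. As the tree has a node, its size also absorbs the additive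
constants; 3000 is not tight. -/
theorem timeBound_le :
    timeBound T ≤ 3000 * (2 ^ T.width * T.width * F.graphSize + T.size) := by
  have hkV : F.graphSize ≤ T.width * F.graphSize := graphSize_le_width_mul T
  have hP : T.width * F.graphSize ≤ 2 ^ T.width * T.width * F.graphSize := by
    rw [mul_assoc]
    exact Nat.le_mul_of_pos_left _ (by positivity)
  have hN := numNodes_pos T
  have hsys : ∑ j, 70 * ((F.con j).encode.length + 1) ≤
      280 * F.graphSize + 140 * (T.width * F.graphSize) := by
    have h1 : ∑ j, 70 * ((F.con j).encode.length + 1) ≤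
        ∑ j, (280 + 140 * (F.con j).vars.card) :=
      Finset.sum_le_sum fun j _ => by have := length_encode_le (F.con j); omega
    rw [Finset.sum_add_distrib, ← Finset.mul_sum (f := fun j => (F.con j).vars.card)] at h1
    have h2 := sum_card_vars_le T
    rw [← graphSize_eq] at h2
    have hg := graphSize_eq (F := F)
    simp only [Finset.sum_const, Finset.card_univ, Fintype.card_fin, smul_eq_mul] at h1
    omega
  have hnbr : ∑ t ∈ Finset.range T.numNodes, ((nbrList T t).length + 1) ≤ 3 * T.numNodes := by
    have := sum_length_nbrList_le T
    rw [Finset.sum_add_distrib]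
    simp
    omega
  have hbag : ∑ i ∈ Finset.range T.numNodes, ((bagList T (nodeOrder T i)).length + 1) =
      T.size := by
    rw [sum_nodeOrder T fun t => (bagList T t).length + 1, Finset.sum_add_distrib,
      sum_length_bagList, TreeDecomposition.size]
    simp [add_comm]
  have hscope : ∑ r ∈ Finset.range (F.numVars + F.numCons),
      ((bagList T (nodeOrder T (topOf T r))).length + 1) ≤
        T.width * F.graphSize + F.graphSize := by
    refine (Finset.sum_le_sum fun r _ => Nat.add_le_add_right (length_bagList_le T _) 1).trans ?_
    rw [Finset.sum_const, Finset.card_range, ← graphSize_eq, smul_eq_mul]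
    exact le_of_eq (by ring)
  have helim : ∑ r ∈ Finset.range (F.numVars + F.numCons), 820 * 2 ^ (scopeOf T r).length *
      ((scopeOf T r).length + 1) *
        ((children (F.numVars + F.numCons) (scopeOf T) r).length + 1) ≤
      1640 * (2 ^ T.width * T.width * F.graphSize) := by
    have h1 : ∀ r ∈ Finset.range (F.numVars + F.numCons), 820 * 2 ^ (scopeOf T r).length *
        ((scopeOf T r).length + 1) *
          ((children (F.numVars + F.numCons) (scopeOf T) r).length + 1) ≤
        820 * 2 ^ T.width * T.width *
          ((children (F.numVars + F.numCons) (scopeOf T) r).length + 1) := by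
      intro r hr
      have hlt := length_scopeOf_lt T (Finset.mem_range.1 hr)
      have hpow : 2 ^ (scopeOf T r).length ≤ 2 ^ T.width :=
        Nat.pow_le_pow_right (by norm_num) hlt.le
      gcongr
      exact hlt
    refine (Finset.sum_le_sum h1).trans ?_
    rw [← Finset.mul_sum, Finset.sum_add_distrib]
    have h2 := sum_length_children_le (scopeOf T) (F.numVars + F.numCons)
    have h3 : ∑ r ∈ Finset.range (F.numVars + F.numCons),
        (children (F.numVars + F.numCons) (scopeOf T) r).length +
          ∑ r ∈ Finset.range (F.numVars + F.numCons), 1 ≤ 2 * F.graphSize := by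
      rw [graphSize_eq]
      simp
      omega
    refine (Nat.mul_le_mul_left _ h3).trans (le_of_eq (by ring))
  have hsize : T.numNodes ≤ T.size := Nat.le_add_right _ _
  unfold timeBound
  rw [hbag]
  have hg := graphSize_eq (F := F)
  omega

/-- The size of a tree decomposition is at most its number of nodes times the width plus one. -/
theorem size_le : T.size ≤ T.numNodes * (T.width + 1) := by
  have := Finset.sum_le_card_nsmul Finset.univ (fun t => (T.bag t).card) T.width
    fun t _ => Finset.le_sup (f := fun t => (T.bag t).card) (Finset.mem_univ _)
  rw [Finset.card_univ, Fintype.card_fin, smul_eq_mul] at this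
  rw [TreeDecomposition.size, mul_add, mul_one]
  omega

/-- Each node accounts for at most `k + 1` units of size, and the 1 is absorbed because the number
of vertices is at most `k` times itself. -/
theorem size_le_of_numNodes_le {A : ℕ} (h : T.numNodes ≤ A * F.graphSize) :
    T.size ≤ 2 * A * (2 ^ T.width * T.width * F.graphSize) := by
  have hP : T.width * F.graphSize ≤ 2 ^ T.width * T.width * F.graphSize := by
    rw [mul_assoc]
    exact Nat.le_mul_of_pos_left _ (by positivity)
  calc T.size ≤ T.numNodes * (T.width + 1) := size_le T
    _ ≤ A * F.graphSize * (T.width + 1) := Nat.mul_le_mul_right _ h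
    _ = A * (T.width * F.graphSize + F.graphSize) := by ring
    _ ≤ A * (2 * (2 ^ T.width * T.width * F.graphSize)) := by
      have := graphSize_le_width_mul T
      exact Nat.mul_le_mul_left _ (by omega)
    _ = _ := by ring

end Main

end ModelCounting

theorem mainTheorem6 :
    ∃ p : ModelCounting.Program,
      (∃ C : ℕ, ∀ (F : ModelCounting.ConstraintSystem)
        (T : ModelCounting.TreeDecomposition F.incidenceGraph) (k : ℕ), T.width = k →
          ∃ t : ℕ, ModelCounting.CountsModelsIn p F T t ∧
            t ≤ C * (2 ^ k * k * F.graphSize + T.size)) ∧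
      (∀ A : ℕ, ∃ C : ℕ, ∀ (F : ModelCounting.ConstraintSystem)
        (T : ModelCounting.TreeDecomposition F.incidenceGraph) (k : ℕ), T.width = k →
          T.numNodes ≤ A * F.graphSize →
          ∃ t : ℕ, ModelCounting.CountsModelsIn p F T t ∧
            t ≤ C * (2 ^ k * k * F.graphSize)) := by
  have key : ∀ (F : ModelCounting.ConstraintSystem)
      (T : ModelCounting.TreeDecomposition F.incidenceGraph),
      ∃ t : ℕ, ModelCounting.CountsModelsIn ModelCounting.Algo.main F T t ∧
        t ≤ 3000 * (2 ^ T.width * T.width * F.graphSize + T.size) := by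
    intro F T
    obtain ⟨τ, t, he, ht, h⟩ := ModelCounting.runs_main T
    exact ⟨t, ⟨τ, he, h⟩, ht.trans (ModelCounting.timeBound_le T)⟩
  -- The same program serves both bounds; `2 * A` is the constant by which the size is bounded in
  -- `size_le_of_numNodes_le`.
  refine ⟨ModelCounting.Algo.main, ⟨3000, ?_⟩, fun A => ⟨3000 * (1 + 2 * A), ?_⟩⟩
  · rintro F T _ rfl
    exact key F T
  · rintro F T _ rfl hA
    obtain ⟨t, h, ht⟩ := key F T
    refine ⟨t, h, ht.trans ?_⟩
    rw [mul_assoc 3000, add_mul, one_mul]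
    exact Nat.mul_le_mul_left _ (Nat.add_le_add_left
      (ModelCounting.size_le_of_numNodes_le T hA) _)
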